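/- Let $d\ge 2$ and let $\emptyset\neq\Omega\subset\mathbb{R}^d$ be a bounded, simply connected Lipschitz domain with boundary $\Gamma=\partial\Omega$. Write $(\cdot,\cdot)_\omega$ and $\|\cdot\|_\omega$ for the $L^2(\omega)$ inner product and norm, with $\|\cdot\|=\|\cdot\|_\Omega$. Let $\widetilde H^{-1}(\Omega)=(H^1(\Omega))'$ with norm $\|\phi\|_{-1,\sim}=\sup_{0\ne v\in H^1(\Omega)}\langle\phi,v\rangle/(\|\nabla v\|^2+\|v\|^2)^{1/2}$; every $\phi\in L^2(\Omega)$ is identified with the functional $v\mapsto(\phi,v)_\Omega$. For open $\omega\subseteq\Omega$ let $H^1_{\Gamma,c}(\omega)=\{v\in H^1(\omega): v|_{\partial\omega\setminus\Gamma}=0\}$, and for $\phi\in L^2(\Omega)$ set $\|\phi\|_{-1,\omega,\Gamma}=\|\phi\|_{-1,\sim}$ if $|\omega|=|\Omega|$, and $\|\phi\|_{-1,\omega,\Gamma}=\sup_{0\ne v\in H^1_{\Gamma,c}(\omega)}(\phi,v)_\omega/\|\nabla v\|_\omega$ otherwise. Let $\mathcal T$ be a regular (conforming, finite) mesh of $\Omega$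 into open simplices, with $h_T=\operatorname{diam}(T)$ and mesh-size function $h_{\mathcal T}|_T=h_T$. For $S\subseteq\overline\Omega$ let $\omega_{\mathcal T}(S)=\{T\in\mathcal T:\overline T\cap\overline S\ne\emptyset\}$ and $\omega_{\mathcal T}(z)=\omega_{\mathcal T}(\{z\})$; let $\Omega_{\mathcal T}(S)$ be the interior of $\bigcup_{T\in\omega_{\mathcal T}(S)}\overline T$. Let $\mathcal N(T)$ be the set of vertices of $T$, $\mathcal N_{\mathcal T}=\bigcup_{T\in\mathcal T}\mathcal N(T)$, and let $\eta_z$, $z\in\mathcal N_{\mathcal T}$, be the nodal basis of the continuous piecewise affine functions. Let $\psi_{T,z}$ be the affine function on $T$ with $(\psi_{T,z},\eta_{z'})_T=\delta_{z,z'}$ for all $z'\in\mathcal N(T)$, let $\eta_{b,T}=\prod_{z\in\mathcal N(T)}\eta_z$, and define on $L^2(\Omega)$ $$\overline J_{\mathcal T}v=\sum_{z\in\mathcal N_{\mathcal T}}\sum_{T\in\omega_{\mathcal T}(z)}\frac{|T|\,(v,\psi_{T,z})_T}{\sum_{T'\in\omega_{\mathcal T}(z)}|T'|}\,\eta_z,\qquad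 B_{\mathcal T}v=\sum_{T\in\mathcal T}\frac{(v,1)_T}{(\eta_{b,T},1)_T}\,\eta_{b,T},\qquad \overline P_{\mathcal T}=\overline J_{\mathcal T}+B_{\mathcal T}(1-\overline J_{\mathcal T}).$$ Let $\Pi^0_{\mathcal T}$ be the $L^2(\Omega)$-orthogonal projection onto the space $\mathcal P^0(\mathcal T)$ of piecewise constants. Let $\overline P_{\mathcal T}'$ be the adjoint of $\overline P_{\mathcal T}$: on $L^2(\Omega)$ the $L^2$-adjoint, and for $\phi\in\widetilde H^{-1}(\Omega)$ the element $\overline P_{\mathcal T}'\phi\in L^2(\Omega)$ with $(\overline P_{\mathcal T}'\phi,v)_\Omega=\langle\phi,\overline P_{\mathcal T}v\rangle$ for all $v\in H^1(\Omega)$. Set $\widetilde Q_{\mathcal T}=\Pi^0_{\mathcal T}\overline P_{\mathcal T}'$. For every $\kappa$ there is a constant $C$, depending only on $d$, $\Omega$ and $\kappa$, such that for every regular mesh $\mathcal T$ of $\Omega$ with $\operatorname{diam}(T)^d\le\kappa|T|$ for all $T\in\mathcal T$ the following hold. (a) Projection: $\widetilde Q_{\mathcal T}^2=\widetilde Q_{\mathcal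 T}$ with range $\mathcal P^0(\mathcal T)$. Moreover, $\widetilde Q_{\mathcal T}$ is well defined on $\widetilde H^{-1}(\Omega)$ with values in $\mathcal P^0(\mathcal T)$, coincides there with the operator on $L^2(\Omega)$ for functionals given by $L^2(\Omega)$ functions, and satisfies $\widetilde Q_{\mathcal T}^2=\widetilde Q_{\mathcal T}$ on $\widetilde H^{-1}(\Omega)$. (b) Approximation: $\|(1-\widetilde Q_{\mathcal T})\phi\|_{-1,\sim}\le C\|h_{\mathcal T}\phi\|$ for all $\phi\in L^2(\Omega)$. (c) Local boundedness: $\|\widetilde Q_{\mathcal T}\phi\|_T\le C\|\phi\|_{\Omega_{\mathcal T}(T)}$ and $\|\widetilde Q_{\mathcal T}\phi\|_{-1,T,\Gamma}\le C\|\phi\|_{-1,\Omega_{\mathcal T}(T),\Gamma}$ for all $T\in\mathcal T$ and $\phi\in L^2(\Omega)$. (d) Global boundedness: $\|\widetilde Q_{\mathcal T}\phi\|_{-1,\sim}\le C\|\phi\|_{-1,\sim}$ for all $\phi\in\widetilde H^{-1}(\Omega)$. -/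

import Mathlib

open MeasureTheory Set
open scoped ENNReal NNReal InnerProductSpace

noncomputable section

namespace NegSob

/-! ### Sobolev spaces and their duals -/

/-- The Euclidean space `ℝᵈ`. -/
abbrev Euc (d : ℕ) : Type := EuclideanSpace ℝ (Fin d)

variable {d : ℕ}

/-- A bounded open set which, near each of its boundary points, is the strict epigraph of a
Lipschitz function over the hyperplane orthogonal to some unit vector `e`. -/
def IsBoundedLipschitz (Ω : Set (Euc d)) : Prop :=
  IsOpen Ω ∧ Bornology.IsBounded Ω ∧
    ∀ x ∈ frontier Ω, ∃ (e : Euc d) (r : ℝ) (K : ℝ≥0) (γ : Euc d → ℝ),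
      ‖e‖ = 1 ∧ 0 < r ∧ LipschitzWith K γ ∧
        ∀ y ∈ Metric.ball x r, y ∈ Ω ↔ γ (y - ⟪e, y⟫_ℝ • e) < ⟪e, y⟫_ℝ

/-- `L²(ω)`. -/
abbrev L2 (ω : Set (Euc d)) : Type := Lp ℝ 2 (volume.restrict ω)

/-- `L²(ω)ᵈ`. -/
abbrev L2Vec (ω : Set (Euc d)) : Type := Lp (Euc d) 2 (volume.restrict ω)

/-- Smooth real functions on `ℝᵈ` with compact support contained in `U`. -/
def IsTest (U : Set (Euc d)) (ψ : Euc d → ℝ) : Prop :=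
  ContDiff ℝ (⊤ : ℕ∞) ψ ∧ HasCompactSupport ψ ∧ tsupport ψ ⊆ U

theorem IsTest.memLp {U : Set (Euc d)} {ψ : Euc d → ℝ} (h : IsTest U ψ) (ω : Set (Euc d)) :
    MemLp ψ 2 (volume.restrict ω) :=
  (h.1.continuous.memLp_of_hasCompactSupport h.2.1)

theorem IsTest.memLp_fderiv {U : Set (Euc d)} {ψ : Euc d → ℝ} (h : IsTest U ψ)
    (ω : Set (Euc d)) (e : Euc d) :
    MemLp (fun x => fderiv ℝ ψ x e) 2 (volume.restrict ω) :=
  ((h.1.continuous_fderiv (by simp)).clm_apply continuous_const).memLp_of_hasCompactSupport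
    (h.2.1.fderiv_apply (𝕜 := ℝ) e)

theorem integrable_mul_fderiv {U ω : Set (Euc d)} {ψ : Euc d → ℝ} (h : IsTest U ψ)
    (e : Euc d) (v : L2 ω) :
    Integrable (fun x => v x * fderiv ℝ ψ x e) (volume.restrict ω) :=
  (Lp.memLp v).integrable_mul (h.memLp_fderiv ω e)

theorem integrable_inner_mul {U ω : Set (Euc d)} {ψ : Euc d → ℝ} (h : IsTest U ψ)
    (e : Euc d) (g : L2Vec ω) :
    Integrable (fun x => ⟪e, g x⟫_ℝ * ψ x) (volume.restrict ω) :=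
  ((Lp.memLp g).const_inner e).integrable_mul (h.memLp ω)

/-- The pairs `(v, g) ∈ L²(ω) × L²(ω)ᵈ` with
`∫_ω v ∂ₑψ = - ∫_ω (g · e) ψ` for all directions `e` and all test functions `ψ ∈ C_c^∞(U)`. -/
def greenSpace (U ω : Set (Euc d)) : Submodule ℝ (WithLp 2 (L2 ω × L2Vec ω)) where
  carrier := {p | ∀ ψ : Euc d → ℝ, IsTest U ψ → ∀ e : Euc d,
    ∫ x in ω, p.fst x * fderiv ℝ ψ x e = - ∫ x in ω, ⟪e, p.snd x⟫_ℝ * ψ x}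
  add_mem' := by
    intro p q hp hq ψ hψ e
    have h1 : ∫ x in ω, (p + q).fst x * fderiv ℝ ψ x e
        = ∫ x in ω, (p.fst x * fderiv ℝ ψ x e + q.fst x * fderiv ℝ ψ x e) := by
      refine integral_congr_ae ?_
      filter_upwards [Lp.coeFn_add p.fst q.fst] with x hx
      rw [WithLp.add_fst, hx, Pi.add_apply, add_mul]
    have h2 : ∫ x in ω, ⟪e, (p + q).snd x⟫_ℝ * ψ x
        = ∫ x in ω, (⟪e, p.snd x⟫_ℝ * ψ x + ⟪e, q.snd x⟫_ℝ * ψ x) := by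
      refine integral_congr_ae ?_
      filter_upwards [Lp.coeFn_add p.snd q.snd] with x hx
      rw [WithLp.add_snd, hx, Pi.add_apply, inner_add_right, add_mul]
    rw [h1, h2, integral_add (integrable_mul_fderiv hψ e _) (integrable_mul_fderiv hψ e _),
      integral_add (integrable_inner_mul hψ e _) (integrable_inner_mul hψ e _),
      hp ψ hψ e, hq ψ hψ e]
    ring
  zero_mem' := by
    intro ψ hψ e
    have h1 : ∫ x in ω, (0 : WithLp 2 (L2 ω × L2Vec ω)).fst x * fderiv ℝ ψ x e = 0 := by
      rw [← integral_zero (Euc d) ℝ (μ := volume.restrict ω)]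
      refine integral_congr_ae ?_
      filter_upwards [Lp.coeFn_zero ℝ 2 (volume.restrict ω)] with x hx
      rw [WithLp.zero_fst, hx, Pi.zero_apply, zero_mul]
    have h2 : ∫ x in ω, ⟪e, (0 : WithLp 2 (L2 ω × L2Vec ω)).snd x⟫_ℝ * ψ x = 0 := by
      rw [← integral_zero (Euc d) ℝ (μ := volume.restrict ω)]
      refine integral_congr_ae ?_
      filter_upwards [Lp.coeFn_zero (Euc d) 2 (volume.restrict ω)] with x hx
      rw [WithLp.zero_snd, hx, Pi.zero_apply, inner_zero_right, zero_mul]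
    rw [h1, h2, neg_zero]
  smul_mem' := by
    intro c p hp ψ hψ e
    have h1 : ∫ x in ω, (c • p).fst x * fderiv ℝ ψ x e
        = ∫ x in ω, c * (p.fst x * fderiv ℝ ψ x e) := by
      refine integral_congr_ae ?_
      filter_upwards [Lp.coeFn_smul c p.fst] with x hx
      rw [WithLp.smul_fst, hx, Pi.smul_apply, smul_eq_mul, mul_assoc]
    have h2 : ∫ x in ω, ⟪e, (c • p).snd x⟫_ℝ * ψ x
        = ∫ x in ω, c * (⟪e, p.snd x⟫_ℝ * ψ x) := by
      refine integral_congr_ae ?_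
      filter_upwards [Lp.coeFn_smul c p.snd] with x hx
      rw [WithLp.smul_snd, hx, Pi.smul_apply, inner_smul_right, mul_assoc]
    rw [h1, h2, integral_const_mul, integral_const_mul, hp ψ hψ e]
    ring

/-- `H¹(ω)`, each function `v` being stored together with its weak gradient as `(v, ∇v)`;
the induced norm is `(‖v‖_ω² + ‖∇v‖_ω²)^{1/2}`. -/
abbrev H1 (ω : Set (Euc d)) : Submodule ℝ (WithLp 2 (L2 ω × L2Vec ω)) := greenSpace ω ω

/-- For an open `ω ⊆ Ω` and `Γ = ∂Ω`: the space of all `v ∈ H¹(ω)` whose trace vanishes on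
`∂ω ∖ Γ = ∂ω ∩ Ω`. Vanishing of the trace is expressed by Green's formula: the boundary term
`∫_{∂ω} v ψ (n · e) = ∫_ω v ∂ₑψ + ∫_ω (∇v · e) ψ` is zero for every `ψ ∈ C_c^∞(Ω)`
(in other words, the extension of `v` by zero belongs to `H¹(Ω)`). -/
def H1c (Ω ω : Set (Euc d)) : Submodule ℝ (WithLp 2 (L2 ω × L2Vec ω)) :=
  H1 ω ⊓ greenSpace Ω ω

/-- `H̃⁻¹(ω) = (H¹(ω))'` with the operator norm, which is the dual norm `‖·‖_{-1,∼,ω}`. -/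
abbrev HTilde (ω : Set (Euc d)) : Type := StrongDual ℝ (H1 ω)

/-- The embedding `L²(ω) → H̃⁻¹(ω)`, `φ ↦ (v ↦ ∫_ω φ v)`. -/
def toHTilde {ω : Set (Euc d)} (φ : L2 ω) : HTilde ω :=
  (innerSL ℝ φ) ∘L (WithLp.fstL 2 ℝ (L2 ω) (L2Vec ω)) ∘L (H1 ω).subtypeL

open Classical in
/-- The auxiliary norm `‖φ‖_{-1,ω,Γ}` of `φ ∈ L²(Ω)` for `ω ⊆ Ω` and `Γ = ∂Ω`. -/
def auxNorm {Ω : Set (Euc d)} (ω : Set (Euc d)) (φ : L2 Ω) : ℝ≥0∞ :=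
  if volume ω = volume Ω then ‖toHTilde φ‖ₑ
  else ⨆ (v : H1c Ω ω) (_ : v ≠ 0),
    ENNReal.ofReal (∫ x in ω, φ x * v.1.fst x) / ‖v.1.snd‖ₑ

/-! ### Simplices -/

/-- The open simplex with vertex set `t`. -/
def elem (t : Finset (Euc d)) : Set (Euc d) := interior (convexHull ℝ (t : Set (Euc d)))

/-- `t` is the vertex set of a nondegenerate `d`-simplex in `ℝᵈ`. -/
def IsSimplex (t : Finset (Euc d)) : Prop :=
  t.card = d + 1 ∧ AffineIndependent ℝ ((↑) : t → Euc d)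

/-- The vertices of a nondegenerate simplex as an affine basis. -/
def IsSimplex.basis {t : Finset (Euc d)} (h : IsSimplex t) : AffineBasis t ℝ (Euc d) where
  toFun := (↑)
  ind' := h.2
  tot' := (h.2.affineSpan_eq_top_iff_card_eq_finrank_add_one).2 (by simp [h.1])

open Classical in
/-- The barycentric coordinate `λ_{T,z}` of a simplex `T` with vertex set `t`: the affine function
on `ℝᵈ` with value `1` at `z` and `0` at the other vertices, if `z ∈ t`; zero if `z ∉ t`. -/
def bary (t : Finset (Euc d)) (z x : Euc d) : ℝ :=
  if h : IsSimplex t ∧ z ∈ t then h.1.basis.coord ⟨z, h.2⟩ x else 0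

/-- The Gram matrix `(∫_T λ_{T,z} λ_{T,z'})_{z,z'}` of the nodal basis of `P¹(T)`. -/
def gram (t : Finset (Euc d)) : Matrix t t ℝ := fun z z' =>
  ∫ x in elem t, bary t z x * bary t z' x

open Classical in
/-- The dual basis function `ψ_{T,z} ∈ P¹(T)`, that is, the unique affine function satisfying
`∫_T ψ_{T,z} λ_{T,z'} = δ_{z,z'}` for all vertices `z'` of `T`. -/
def dualFn (t : Finset (Euc d)) (z x : Euc d) : ℝ :=
  if h : z ∈ t then ∑ z' : t, (gram t)⁻¹ ⟨z, h⟩ z' * bary t z' x else 0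

/-! ### Meshes -/

/-- A regular mesh of `Ω` into simplices: finitely many nondegenerate simplices, given by their
vertex sets, which cover the closure of `Ω`, the closures of any two of them meeting exactly in
the (possibly empty) simplex spanned by their common vertices. -/
structure Mesh (Ω : Set (Euc d)) where
  cells : Finset (Finset (Euc d))
  isSimplex : ∀ t ∈ cells, IsSimplex t
  cover : ⋃ t ∈ cells, convexHull ℝ (t : Set (Euc d)) = closure Ω
  regular : ∀ s ∈ cells, ∀ t ∈ cells,
    convexHull ℝ (s : Set (Euc d)) ∩ convexHull ℝ (t : Set (Euc d))
      = convexHull ℝ ((s : Set (Euc d)) ∩ (t : Set (Euc d)))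

/-- Measurable and bounded. -/
def BddMeas (f : Euc d → ℝ) : Prop := Measurable f ∧ ∃ M : ℝ, ∀ x, |f x| ≤ M

theorem BddMeas.prod {ι : Type*} (s : Finset ι) {f : ι → Euc d → ℝ} (h : ∀ i, BddMeas (f i)) :
    BddMeas (fun x => ∏ i ∈ s, f i x) := by
  choose hm M hM using h
  refine ⟨Finset.measurable_prod s fun i _ => hm i, ∏ i ∈ s, M i, fun x => ?_⟩
  rw [Finset.abs_prod]
  exact Finset.prod_le_prod (fun i _ => abs_nonneg _) fun i _ => hM i x

theorem BddMeas.iSup {ι : Type*} [Finite ι] {f : ι → Euc d → ℝ} (h : ∀ i, BddMeas (f i)) :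
    BddMeas (fun x => ⨆ i, f i x) := by
  choose hm M hM using h
  have := Fintype.ofFinite ι
  refine ⟨Measurable.iSup hm, ∑ i, M i, fun x => ?_⟩
  have hM0 : ∀ i, 0 ≤ M i := fun i => (abs_nonneg _).trans (hM i x)
  have hle : ∀ i, |f i x| ≤ ∑ i, M i := fun i =>
    (hM i x).trans (Finset.single_le_sum (fun i _ => hM0 i) (Finset.mem_univ i))
  rcases isEmpty_or_nonempty ι with hι | hι
  · simp
  · obtain ⟨i⟩ := id hι
    rw [abs_le]
    exact ⟨(abs_le.1 (hle i)).1.trans (le_ciSup (Set.finite_range fun i => f i x).bddAbove i),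
      ciSup_le fun i => (abs_le.1 (hle i)).2⟩

theorem BddMeas.indicator {f : Euc d → ℝ} (hf : Continuous f) {s K : Set (Euc d)}
    (hs : MeasurableSet s) (hK : IsCompact K) (hsK : s ⊆ K) : BddMeas (s.indicator f) := by
  refine ⟨hf.measurable.indicator hs, ?_⟩
  obtain ⟨M, hM⟩ := hK.exists_bound_of_continuousOn hf.continuousOn
  refine ⟨max M 0, fun x => ?_⟩
  by_cases hx : x ∈ s
  · rw [indicator_of_mem hx]
    exact (hM x (hsK hx)).trans (le_max_left _ _)
  · simp [indicator_of_notMem hx]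

theorem isCompact_convexHull (t : Finset (Euc d)) :
    IsCompact (convexHull ℝ (t : Set (Euc d))) :=
  t.finite_toSet.isCompact_convexHull (𝕜 := ℝ)

theorem continuous_bary (t : Finset (Euc d)) (z : Euc d) : Continuous (bary t z) := by
  unfold bary
  split_ifs with h
  · exact (h.1.basis.coord ⟨z, h.2⟩).continuous_of_finiteDimensional
  · exact continuous_const

theorem continuous_dualFn (t : Finset (Euc d)) (z : Euc d) : Continuous (dualFn t z) := by
  unfold dualFn
  split_ifs with h
  · exact continuous_finsetSum _ fun z' _ => continuous_const.mul (continuous_bary t z')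
  · exact continuous_const

/-- `f` on the open simplex `T`, extended by zero. -/
def onElem (t : Finset (Euc d)) (f : Euc d → ℝ) : Euc d → ℝ := (elem t).indicator f

theorem bddMeas_onElem (t : Finset (Euc d)) {f : Euc d → ℝ} (hf : Continuous f) :
    BddMeas (onElem t f) :=
  BddMeas.indicator hf isOpen_interior.measurableSet (isCompact_convexHull t) interior_subset

namespace Mesh

variable {Ω : Set (Euc d)} (T : Mesh Ω)

/-- `diam(T)ᵈ ≤ κ |T|` for all elements `T`. -/
def ShapeRegular (κ : ℝ) : Prop :=
  ∀ t ∈ T.cells, Metric.diam (elem t) ^ d ≤ κ * volume.real (elem t)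

/-- The mesh-size function: `diam(T)` on each open element `T`. -/
def meshSize (x : Euc d) : ℝ :=
  ∑ t ∈ T.cells, (elem t).indicator (fun _ => Metric.diam (elem t)) x

open Classical in
/-- The set of all vertices of the mesh. -/
def nodes : Finset (Euc d) := T.cells.biUnion id

open Classical in
/-- The element patch `ω_𝒯(S)`: all elements whose closure meets the closure of `S`. -/
def patch (S : Set (Euc d)) : Finset (Finset (Euc d)) :=
  T.cells.filter fun t => (closure (elem t) ∩ closure S).Nonempty

/-- The domain `Ω_𝒯(S)` of the element patch `ω_𝒯(S)`. -/
def patchDomain (S : Set (Euc d)) : Set (Euc d) :=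
  interior (⋃ t ∈ T.patch S, closure (elem t))

/-- The nodal basis function `η_{𝒯,z}` of the continuous piecewise affine functions: on each
closed element it is the barycentric coordinate of `z` (which is zero if `z` is not a vertex of the
element). All elements containing `x` yield the same value at `x`, which is written as a maximum;
outside the closure of `Ω` the function is zero. -/
def hat (z x : Euc d) : ℝ :=
  ⨆ t : T.cells, (convexHull ℝ (t.1 : Set (Euc d))).indicator (bary t.1 z) x

/-- The bubble function `η_{b,T} = ∏_{z ∈ N(T)} η_{𝒯,z}`. -/
def bubble (t : Finset (Euc d)) (x : Euc d) : ℝ := ∏ z ∈ t, T.hat z x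

theorem bddMeas_hat (z : Euc d) : BddMeas (T.hat z) :=
  BddMeas.iSup fun t => BddMeas.indicator (continuous_bary t.1 z)
    (isCompact_convexHull t.1).isClosed.measurableSet (isCompact_convexHull t.1) subset_rfl

theorem bddMeas_bubble (t : Finset (Euc d)) : BddMeas (T.bubble t) :=
  BddMeas.prod t fun z => T.bddMeas_hat z

theorem volume_lt_top {Ω : Set (Euc d)} (T : Mesh Ω) : volume Ω < ∞ := by
  have h : IsCompact (closure Ω) := by
    rw [← T.cover]
    exact T.cells.isCompact_biUnion fun t _ => isCompact_convexHull t
  exact (measure_mono subset_closure).trans_lt h.measure_lt_top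

/-- The class in `L²(Ω)` of a bounded measurable function. -/
def cls (f : Euc d → ℝ) (hf : BddMeas f) : L2 Ω :=
  MemLp.toLp f (by
    have : IsFiniteMeasure (volume.restrict Ω) :=
      ⟨by rw [Measure.restrict_apply_univ]; exact T.volume_lt_top⟩
    obtain ⟨M, hM⟩ := hf.2
    exact MemLp.of_bound hf.1.aestronglyMeasurable M (Filter.Eventually.of_forall hM))

/-- The characteristic function `χ_T` in `L²(Ω)`. -/
def chi (t : Finset (Euc d)) : L2 Ω :=
  T.cls (onElem t fun _ => 1) (bddMeas_onElem t continuous_const)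

/-- `η_{𝒯,z}` in `L²(Ω)`. -/
def hatL2 (z : Euc d) : L2 Ω := T.cls (T.hat z) (T.bddMeas_hat z)

/-- `η_{b,T}` in `L²(Ω)`. -/
def bubbleL2 (t : Finset (Euc d)) : L2 Ω := T.cls (T.bubble t) (T.bddMeas_bubble t)

/-- `ψ_{T,z}`, extended by zero outside `T`, in `L²(Ω)`. -/
def dualL2 (t : Finset (Euc d)) (z : Euc d) : L2 Ω :=
  T.cls (onElem t (dualFn t z)) (bddMeas_onElem t (continuous_dualFn t z))

/-- The Scott--Zhang type operator `J̄_𝒯` on `L²(Ω)`,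
`J̄ v = ∑_z ∑_{T ∈ ω(z)} (|T| / ∑_{T' ∈ ω(z)} |T'|) (v, ψ_{T,z})_T η_z`,
with summation over all vertices `z` of the mesh (including those on the boundary). -/
def JBar : L2 Ω →L[ℝ] L2 Ω :=
  ∑ z ∈ T.nodes, ∑ t ∈ T.patch {z},
    (volume.real (elem t) / ∑ t' ∈ T.patch {z}, volume.real (elem t')) •
      (innerSL ℝ (T.dualL2 t z)).smulRight (T.hatL2 z)

/-- The bubble operator `B_𝒯 v = ∑_T (v, 1)_T / (η_{b,T}, 1)_T η_{b,T}` on `L²(Ω)`. -/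
def bubbleOp : L2 Ω →L[ℝ] L2 Ω :=
  ∑ t ∈ T.cells, (∫ x in elem t, T.bubble t x)⁻¹ •
    (innerSL ℝ (T.chi t)).smulRight (T.bubbleL2 t)

/-- `P̄_𝒯 = J̄_𝒯 + B_𝒯 (1 - J̄_𝒯)` on `L²(Ω)`. -/
def PBar : L2 Ω →L[ℝ] L2 Ω :=
  T.JBar + T.bubbleOp ∘L (ContinuousLinearMap.id ℝ (L2 Ω) - T.JBar)

/-- The piecewise constant functions `P⁰(𝒯) ⊆ L²(Ω)`. -/
def P0 : Submodule ℝ (L2 Ω) := Submodule.span ℝ (Set.range fun t : T.cells => T.chi t.1)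

instance : FiniteDimensional ℝ T.P0 :=
  FiniteDimensional.span_of_finite ℝ (Set.finite_range _)

/-- The `L²(Ω)`-orthogonal projection `Π⁰_𝒯` onto `P⁰(𝒯)`. -/
def Pi0 : L2 Ω →L[ℝ] L2 Ω := T.P0.starProjection

/-- `Q̃_𝒯 = Π⁰_𝒯 P̄_𝒯'` on `L²(Ω)`, where `P̄_𝒯'` is the `L²(Ω)`-adjoint of `P̄_𝒯`. -/
def QTilde : L2 Ω →L[ℝ] L2 Ω := T.Pi0 ∘L ContinuousLinearMap.adjoint T.PBar

/-- `g ∈ L²(Ω)` is the image `P̄_𝒯' φ` of `φ ∈ H̃⁻¹(Ω)` under the dual of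
`P̄_𝒯 : H¹(Ω) → H¹(Ω)`: for all `v ∈ H¹(Ω)` also `P̄_𝒯 v ∈ H¹(Ω)`, and `(g, v) = ⟨φ, P̄_𝒯 v⟩`. -/
def IsPBarDual (φ : HTilde Ω) (g : L2 Ω) : Prop :=
  ∀ v : H1 Ω, ∃ w : H1 Ω, w.1.fst = T.PBar v.1.fst ∧ ⟪g, v.1.fst⟫_ℝ = φ w

/-- `q ∈ L²(Ω)` is the image `Q̃_𝒯 φ = Π⁰_𝒯 P̄_𝒯' φ` of `φ ∈ H̃⁻¹(Ω)`. -/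
def IsQTildeOf (φ : HTilde Ω) (q : L2 Ω) : Prop :=
  ∃ g : L2 Ω, T.IsPBarDual φ g ∧ q = T.Pi0 g

end Mesh

end NegSob

end

/-!
The operator `Q̃ = Π⁰ P̄'` is adjoint to `P̄ Π⁰`, that is, `(Q̃ φ, v) = (φ, P̄ Π⁰ v)`
(`inner_QTilde`). Hence the bounds of `Q̃` in negative norms are dual to bounds of `P̄` in `H¹`, and
these are needed for piecewise constant arguments only. The projection property is dual to the fact
that the bubble correction makes `P̄` preserve the integrals over the elements (`inner_chi_PBar`):
`P̄'` is the identity on the piecewise constants.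

For a piecewise constant function `w` the coefficients of `J̄ w` are weighted means of the values of
`w` on the stars of the vertices, because each dual function `ψ_{T,z}` has integral one. So on an
element `T` both `P̄ w - w` and `diam(T) ∇(P̄ w)` are bounded by the differences of the values of
`w` on elements sharing a vertex with `T` (`localPBar_pw_le`). As `P̄ w` is continuous and piecewise
polynomial, it belongs to `H¹(Ω)` (`exists_H1_PBar`).

The analytic core is the estimate, for `v ∈ H¹(Ω)`, of the differences of the mean values of `v` on
two elements `S`, `T` with a common vertex `z`, by `C diam(S) |S|^{-1/2}` times the norm of `∇v` on
the star of `z` (`exists_const_star`). It rests on two ingredients.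

* If `S` and `T` share a face, a ball around the centroid of the face is contained in the union of
  their closures (`ball_center_subset`), and the mean values over `S` and `T` are compared with
  those over small copies of `S` and `T` in this ball. On a convex set, mean values are compared by
  integrating the translation estimate `‖v(· + τ) - v‖ ≤ |τ| ‖∇v‖`, which follows directly from the
  definition of weak derivatives by differentiating `s ↦ ∫ v ψ(· - s τ)`; no density of smooth
  functions in `H¹(G)` is needed.
* Any two elements of a star are linked by a chain of elements of the star in which consecutive ones
  share a face (`star_induction`). Near `z` the Lipschitz domain contains a connected open set which
  is covered by the star, and a generic segment in it meets no face of codimension two. The length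
  of the chain is bounded because shape regularity bounds the cardinality of the star, which in turn
  follows by comparing the volumes of homothetic copies of its elements with a ball.

For the bound in the local auxiliary norm, a function on `T` that vanishes on the part of the
boundary inside `Ω` is extended by zero. Since `Ω` is connected, some face neighbour of `T` exists,
on which the mean value is zero, so the comparison of mean values becomes a Friedrichs inequality
(`exists_const_smoothing_local`).

On the dual space, `Q̃` is well defined because `P̄` has a finite-dimensional range in `H¹(Ω)`
(`exists_PBar_dual`), and unique since `H¹(Ω)` is dense in `L²(Ω)` (`eq_of_inner_H1_eq`). -/

noncomputable section

namespace NegSob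

variable {d : ℕ}

/-! ### Geometry of a single simplex -/

theorem IsSimplex.range_basis {t : Finset (Euc d)} (h : IsSimplex t) :
    range h.basis = (t : Set (Euc d)) := by
  ext x
  constructor
  · rintro ⟨i, rfl⟩
    exact i.2
  · intro hx
    exact ⟨⟨x, hx⟩, rfl⟩

theorem IsSimplex.bary_eq {t : Finset (Euc d)} (h : IsSimplex t) {z : Euc d} (hz : z ∈ t)
    (x : Euc d) : bary t z x = h.basis.coord ⟨z, hz⟩ x := by
  simp [bary, h, hz]

theorem bary_of_notMem {t : Finset (Euc d)} {z : Euc d} (hz : z ∉ t) (x : Euc d) :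
    bary t z x = 0 := by
  simp [bary, hz]

open Classical in
/-- The constant gradient of the barycentric coordinate `λ_{T,z}`; zero if `z` is no vertex. -/
def baryGrad (t : Finset (Euc d)) (z : Euc d) : Euc d :=
  if h : IsSimplex t ∧ z ∈ t then
    (InnerProductSpace.toDual ℝ (Euc d)).symm
      (LinearMap.toContinuousLinearMap (h.1.basis.coord ⟨z, h.2⟩).linear)
  else 0

theorem bary_sub (t : Finset (Euc d)) (z x y : Euc d) :
    bary t z x - bary t z y = ⟪baryGrad t z, x - y⟫_ℝ := by
  unfold bary baryGrad
  split_ifs with h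
  · rw [InnerProductSpace.toDual_symm_apply]
    simpa using ((h.1.basis.coord ⟨z, h.2⟩).linearMap_vsub x y).symm
  · simp

theorem bary_eq_add (t : Finset (Euc d)) (z x y : Euc d) :
    bary t z x = bary t z y + ⟪baryGrad t z, x - y⟫_ℝ := by
  rw [← bary_sub]; ring

theorem hasFDerivAt_bary (t : Finset (Euc d)) (z x : Euc d) :
    HasFDerivAt (bary t z) (innerSL ℝ (baryGrad t z)) x := by
  have h : bary t z = fun y => innerSL ℝ (baryGrad t z) y + bary t z 0 := by
    funext y
    rw [bary_eq_add t z y 0]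
    simp [add_comm]
  rw [h]
  exact (innerSL ℝ (baryGrad t z)).hasFDerivAt.add_const _

theorem contDiff_bary (t : Finset (Euc d)) (z : Euc d) {n : WithTop ℕ∞} :
    ContDiff ℝ n (bary t z) := by
  have h : bary t z = fun y => innerSL ℝ (baryGrad t z) y + bary t z 0 := by
    funext y
    rw [bary_eq_add t z y 0]
    simp [add_comm]
  rw [h]
  exact (innerSL ℝ (baryGrad t z)).contDiff.add contDiff_const

theorem bary_lineMap (t : Finset (Euc d)) (z x y : Euc d) (θ : ℝ) :
    bary t z (AffineMap.lineMap x y θ) = (1 - θ) * bary t z x + θ * bary t z y := by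
  rw [bary_eq_add t z (AffineMap.lineMap x y θ) x, bary_eq_add t z y x,
    AffineMap.lineMap_apply_module', add_sub_cancel_right, inner_smul_right]
  ring

theorem IsSimplex.bary_self {t : Finset (Euc d)} (h : IsSimplex t) {z : Euc d} (hz : z ∈ t) :
    bary t z z = 1 := by
  rw [h.bary_eq hz]
  exact h.basis.coord_apply_eq ⟨z, hz⟩

theorem bary_ne {t : Finset (Euc d)} {z y : Euc d} (hy : y ∈ t) (hzy : z ≠ y) :
    bary t z y = 0 := by
  unfold bary
  split_ifs with h
  · exact h.1.basis.coord_apply_ne (i := ⟨z, h.2⟩) (j := ⟨y, hy⟩) (by simpa using hzy)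
  · rfl

theorem IsSimplex.sum_bary {t : Finset (Euc d)} (h : IsSimplex t) (x : Euc d) :
    ∑ z ∈ t, bary t z x = 1 := by
  rw [← Finset.sum_attach, ← h.basis.sum_coord_apply_eq_one x]
  exact Finset.sum_congr rfl fun z _ => h.bary_eq z.2 x

theorem IsSimplex.sum_bary_smul {t : Finset (Euc d)} (h : IsSimplex t) (x : Euc d) :
    ∑ z ∈ t, bary t z x • z = x := by
  conv_rhs => rw [← h.basis.linear_combination_coord_eq_self x]
  rw [← Finset.sum_attach]
  exact Finset.sum_congr rfl fun z _ => by rw [h.bary_eq z.2 x]; rfl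

theorem IsSimplex.mem_convexHull {t : Finset (Euc d)} (h : IsSimplex t) {x : Euc d} :
    x ∈ convexHull ℝ (t : Set (Euc d)) ↔ ∀ z ∈ t, 0 ≤ bary t z x := by
  rw [← h.range_basis, h.basis.convexHull_eq_nonneg_coord]
  constructor
  · intro hx z hz
    rw [h.bary_eq hz]
    exact hx ⟨z, hz⟩
  · rintro hx ⟨z, hz⟩
    rw [← h.bary_eq hz]
    exact hx z hz

theorem IsSimplex.mem_elem {t : Finset (Euc d)} (h : IsSimplex t) {x : Euc d} :
    x ∈ elem t ↔ ∀ z ∈ t, 0 < bary t z x := by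
  rw [elem, ← h.range_basis, h.basis.interior_convexHull]
  constructor
  · intro hx z hz
    rw [h.bary_eq hz]
    exact hx ⟨z, hz⟩
  · rintro hx ⟨z, hz⟩
    rw [← h.bary_eq hz]
    exact hx z hz

theorem bary_nonneg {t : Finset (Euc d)} {x : Euc d}
    (hx : x ∈ convexHull ℝ (t : Set (Euc d))) (z : Euc d) : 0 ≤ bary t z x := by
  by_cases h : IsSimplex t ∧ z ∈ t
  · exact h.1.mem_convexHull.1 hx z h.2
  · simp [bary, h]

theorem IsSimplex.bary_le_one {t : Finset (Euc d)} (h : IsSimplex t) {x : Euc d}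
    (hx : x ∈ convexHull ℝ (t : Set (Euc d))) (z : Euc d) : bary t z x ≤ 1 := by
  by_cases hz : z ∈ t
  · rw [← h.sum_bary x]
    exact Finset.single_le_sum (f := fun z => bary t z x) (fun z _ => bary_nonneg hx z) hz
  · rw [bary_of_notMem hz]
    exact zero_le_one

theorem isOpen_elem (t : Finset (Euc d)) : IsOpen (elem t) := isOpen_interior

theorem measurableSet_elem (t : Finset (Euc d)) : MeasurableSet (elem t) :=
  isOpen_interior.measurableSet

theorem convex_elem (t : Finset (Euc d)) : Convex ℝ (elem t) := (convex_convexHull ℝ _).interior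

theorem elem_subset (t : Finset (Euc d)) : elem t ⊆ convexHull ℝ (t : Set (Euc d)) :=
  interior_subset

theorem IsSimplex.nonempty_elem {t : Finset (Euc d)} (h : IsSimplex t) : (elem t).Nonempty := by
  rw [elem, ← h.range_basis]
  exact ⟨_, h.basis.centroid_mem_interior_convexHull⟩

theorem IsSimplex.closure_elem {t : Finset (Euc d)} (h : IsSimplex t) :
    closure (elem t) = convexHull ℝ (t : Set (Euc d)) := by
  rw [elem, (convex_convexHull ℝ _).closure_interior_eq_closure_of_nonempty_interior
    h.nonempty_elem, (isCompact_convexHull t).isClosed.closure_eq]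

theorem volume_elem_ne_top (t : Finset (Euc d)) : volume (elem t) ≠ ∞ :=
  ((measure_mono (elem_subset t)).trans_lt (isCompact_convexHull t).measure_lt_top).ne

theorem IsSimplex.volume_pos {t : Finset (Euc d)} (h : IsSimplex t) : 0 < volume.real (elem t) :=
  ENNReal.toReal_pos ((isOpen_elem t).measure_pos _ h.nonempty_elem).ne' (volume_elem_ne_top t)

theorem elem_ae_eq (t : Finset (Euc d)) :
    elem t =ᵐ[volume] convexHull ℝ (t : Set (Euc d)) :=
  interior_ae_eq_of_null_frontier ((convex_convexHull ℝ _).addHaar_frontier volume)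

theorem isBounded_convexHull (t : Finset (Euc d)) :
    Bornology.IsBounded (convexHull ℝ (t : Set (Euc d))) := (isCompact_convexHull t).isBounded

theorem IsSimplex.diam_convexHull {t : Finset (Euc d)} (h : IsSimplex t) :
    Metric.diam (convexHull ℝ (t : Set (Euc d))) = Metric.diam (elem t) := by
  rw [← h.closure_elem, Metric.diam_closure]

theorem IsSimplex.norm_sub_le {t : Finset (Euc d)} (h : IsSimplex t) {x y : Euc d}
    (hx : x ∈ convexHull ℝ (t : Set (Euc d))) (hy : y ∈ convexHull ℝ (t : Set (Euc d))) :
    ‖x - y‖ ≤ Metric.diam (elem t) := by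
  rw [← h.diam_convexHull, ← dist_eq_norm]
  exact Metric.dist_le_diam_of_mem (isBounded_convexHull t) hx hy

theorem subset_hull {t : Finset (Euc d)} {z : Euc d} (hz : z ∈ t) :
    z ∈ convexHull ℝ (t : Set (Euc d)) := subset_convexHull ℝ _ hz

/-- The gradient of a barycentric coordinate is at least the inverse length of every edge that
ends in the vertex. -/
theorem IsSimplex.one_le_norm_baryGrad_mul {t : Finset (Euc d)} (h : IsSimplex t) {z y : Euc d}
    (hz : z ∈ t) (hy : y ∈ t) (hzy : z ≠ y) : 1 ≤ ‖baryGrad t z‖ * ‖z - y‖ := by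
  have := bary_sub t z z y
  rw [h.bary_self hz, bary_ne hy hzy, sub_zero] at this
  rw [this]
  exact real_inner_le_norm _ _

theorem IsSimplex.exists_ne {t : Finset (Euc d)} (h : IsSimplex t) (hd : 2 ≤ d) (z : Euc d) :
    ∃ y ∈ t, z ≠ y := by
  obtain ⟨y, hy, hyz⟩ := t.exists_mem_ne (by rw [h.1]; omega) z
  exact ⟨y, hy, hyz.symm⟩

theorem IsSimplex.diam_pos {t : Finset (Euc d)} (h : IsSimplex t) (hd : 2 ≤ d) :
    0 < Metric.diam (elem t) := by
  obtain ⟨z, hz⟩ : t.Nonempty := Finset.card_pos.1 (by rw [h.1]; omega)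
  obtain ⟨y, hy, hzy⟩ := h.exists_ne hd z
  exact (norm_pos_iff.2 (sub_ne_zero.2 hzy)).trans_le
    (h.norm_sub_le (subset_hull hz) (subset_hull hy))

/-- The volume of the unit ball in `ℝᵈ`. -/
def ballVol (d : ℕ) : ℝ := volume.real (Metric.ball (0 : Euc d) 1)

theorem ballVol_pos (d : ℕ) : 0 < ballVol d :=
  ENNReal.toReal_pos (Metric.measure_ball_pos _ _ one_pos).ne' measure_ball_lt_top.ne

theorem volume_closedBall (x : Euc d) {r : ℝ} (hr : 0 ≤ r) :
    volume.real (Metric.closedBall x r) = r ^ d * ballVol d := by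
  rw [measureReal_def, Measure.addHaar_closedBall _ _ hr, ENNReal.toReal_mul,
    ENNReal.toReal_ofReal (by positivity), finrank_euclideanSpace_fin]
  rfl

theorem IsSimplex.volume_le {t : Finset (Euc d)} (h : IsSimplex t) :
    volume.real (elem t) ≤ Metric.diam (elem t) ^ d * ballVol d := by
  obtain ⟨x, hx⟩ := h.nonempty_elem
  rw [← volume_closedBall x Metric.diam_nonneg]
  refine measureReal_mono ?_ measure_closedBall_lt_top.ne
  intro y hy
  rw [Metric.mem_closedBall, dist_eq_norm]
  exact h.norm_sub_le (elem_subset t hy) (elem_subset t hx)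

/-- A barycentric coordinate of `T` varies on the scale of `diam(T)`: the translates of `T` by
integer multiples of the width of the slab `0 < λ < 1` are disjoint, and about
`diam(T) ‖∇λ‖` of them fit into a ball of radius `3 diam(T)`. -/
theorem IsSimplex.norm_baryGrad_mul_diam_mul_volume_le {t : Finset (Euc d)} (h : IsSimplex t)
    (hd : 2 ≤ d) (z : Euc d) :
    ‖baryGrad t z‖ * Metric.diam (elem t) * volume.real (elem t)
      ≤ (3 * Metric.diam (elem t)) ^ d * ballVol d := by
  by_cases hz : z ∈ t
  swap
  · have : baryGrad t z = 0 := by simp [baryGrad, hz]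
    rw [this, norm_zero, zero_mul, zero_mul]
    have := ballVol_pos d
    have := Metric.diam_nonneg (s := elem t)
    positivity
  obtain ⟨y, hy, hzy⟩ := h.exists_ne hd z
  set D := Metric.diam (elem t) with hD
  set g := baryGrad t z with hg
  have hgD : 1 ≤ ‖g‖ * D := (h.one_le_norm_baryGrad_mul hz hy hzy).trans
    (mul_le_mul_of_nonneg_left (h.norm_sub_le (subset_hull hz) (subset_hull hy)) (norm_nonneg _))
  have hDpos : 0 < D := h.diam_pos hd
  have hgpos : 0 < ‖g‖ := by
    by_contra hcon
    have : ‖g‖ = 0 := le_antisymm (not_lt.1 hcon) (norm_nonneg _)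
    rw [this] at hgD
    linarith
  -- the number of translates; since `‖∇λ‖ diam(T) ≥ 1`, rounding up costs at most a factor `2`
  set N := ⌈‖g‖ * D⌉₊ with hN
  have hN1 : ‖g‖ * D ≤ N := Nat.le_ceil _
  have hN2 : (N : ℝ) ≤ 2 * (‖g‖ * D) := by
    have := Nat.ceil_lt_add_one (show 0 ≤ ‖g‖ * D by positivity)
    linarith
  -- the shift by which `λ` increases by one
  set n : Euc d := (‖g‖ ^ 2)⁻¹ • g with hn
  have hgn : ⟪g, n⟫_ℝ = 1 := by
    rw [hn, inner_smul_right, real_inner_self_eq_norm_sq]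
    field_simp
  have hnn : ‖n‖ = ‖g‖⁻¹ := by
    rw [hn, norm_smul, norm_inv, norm_pow, norm_norm]
    field_simp
  let A : ℕ → Set (Euc d) := fun k => (fun x => (k : ℝ) • n + x) '' elem t
  have hAvol : ∀ k, volume (A k) = volume (elem t) := fun k => by
    simp only [A, image_add_left, measure_preimage_add]
  have hAopen : ∀ k, MeasurableSet (A k) := fun k => by
    simp only [A, image_add_left]
    exact (measurable_const_add _) (measurableSet_elem t)
  have hAbary : ∀ k, ∀ x ∈ A k, (k : ℝ) < bary t z x ∧ bary t z x < k + 1 := by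
    rintro k _ ⟨x, hx, rfl⟩
    have h1 : bary t z ((k : ℝ) • n + x) = bary t z x + k := by
      rw [bary_eq_add t z _ x, add_sub_cancel_right, inner_smul_right, hgn, mul_one]
    have h2 := h.mem_elem.1 hx z hz
    have h3 := h.mem_elem.1 hx y hy
    have h4 : bary t z x + bary t y x ≤ 1 := by
      rw [← h.sum_bary x, ← Finset.sum_pair (f := fun w => bary t w x) hzy]
      exact Finset.sum_le_sum_of_subset_of_nonneg (by simp [Finset.insert_subset_iff, hz, hy])
        fun w _ _ => bary_nonneg (elem_subset t hx) w
    simp only [h1]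
    constructor <;> linarith
  have hdisj : Pairwise (Function.onFun Disjoint A) := by
    intro i j hij
    rw [Function.onFun, Set.disjoint_left]
    intro x hi hj
    have h1 := hAbary i x hi
    have h2 := hAbary j x hj
    apply hij
    have h3 : (i : ℝ) < j + 1 := by linarith
    have h4 : (j : ℝ) < i + 1 := by linarith
    norm_cast at h3 h4
    omega
  obtain ⟨x₀, hx₀⟩ := h.nonempty_elem
  have hsub : (⋃ k ∈ Finset.range N, A k) ⊆ Metric.closedBall x₀ (3 * D) := by
    intro x hx
    simp only [mem_iUnion] at hx
    obtain ⟨k, hk, x, hx, rfl⟩ := hx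
    rw [Metric.mem_closedBall, dist_eq_norm, add_sub_assoc]
    refine (norm_add_le _ _).trans ?_
    have h1 : ‖x - x₀‖ ≤ D := h.norm_sub_le (elem_subset t hx) (elem_subset t hx₀)
    have h2 : ‖(k : ℝ) • n‖ ≤ 2 * D := by
      rw [norm_smul, hnn, Real.norm_natCast]
      have : (k : ℝ) ≤ N := by exact_mod_cast (Finset.mem_range.1 hk).le
      calc (k : ℝ) * ‖g‖⁻¹ ≤ (2 * (‖g‖ * D)) * ‖g‖⁻¹ := by gcongr; linarith
        _ = 2 * D := by field_simp
    linarith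
  have hmain : (N : ℝ) * volume.real (elem t) ≤ (3 * D) ^ d * ballVol d := by
    rw [← volume_closedBall x₀ (by positivity)]
    refine le_trans (le_of_eq ?_) (measureReal_mono hsub measure_closedBall_lt_top.ne)
    simp only [measureReal_def]
    rw [measure_biUnion_finset (fun i _ j _ hij => hdisj hij) (fun i _ => hAopen i)]
    simp [hAvol, ENNReal.toReal_mul]
  refine le_trans ?_ hmain
  gcongr

theorem shrink_image_subset {G : Set (Euc d)} (hG : Convex ℝ G) {c : Euc d} (hc : c ∈ G)
    {S : Set (Euc d)} (hS : S ⊆ G) {θ : ℝ} (h0 : 0 ≤ θ) (h1 : θ ≤ 1) :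
    AffineMap.homothety c θ '' S ⊆ G := by
  rintro _ ⟨x, hx, rfl⟩
  rw [AffineMap.homothety_eq_lineMap]
  exact hG.lineMap_mem hc (hS hx) ⟨h0, h1⟩

theorem volume_homothety (c : Euc d) {θ : ℝ} (h0 : 0 ≤ θ) (S : Set (Euc d)) :
    volume.real (AffineMap.homothety c θ '' S) = θ ^ d * volume.real S := by
  rw [measureReal_def, Measure.addHaar_image_homothety, ENNReal.toReal_mul,
    ENNReal.toReal_ofReal (abs_nonneg _), finrank_euclideanSpace_fin, abs_of_nonneg (by positivity)]
  rfl

/-- The centroid of a finite set of points. -/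
def center (F : Finset (Euc d)) : Euc d := (F.card : ℝ)⁻¹ • ∑ y ∈ F, y

theorem center_mem {F : Finset (Euc d)} (hF : F.Nonempty) :
    center F ∈ convexHull ℝ (F : Set (Euc d)) := by
  have := F.centerMass_mem_convexHull (R := ℝ) (w := fun _ => 1) (z := id)
    (s := (F : Set (Euc d))) (fun _ _ => zero_le_one) (by simpa using hF) (fun i hi => hi)
  simpa [Finset.centerMass, center] using this

theorem IsSimplex.bary_center {t : Finset (Euc d)} (h : IsSimplex t) {F : Finset (Euc d)}
    (hF : F.Nonempty) (hFt : F ⊆ t) {z : Euc d} (hz : z ∈ F) :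
    bary t z (center F) = (F.card : ℝ)⁻¹ := by
  have hc : (F.card : ℝ) ≠ 0 := by exact_mod_cast (Finset.card_pos.2 hF).ne'
  have h1 : (F.card : ℝ) * bary t z (center F) = ∑ y ∈ F, bary t z y := by
    have h2 : ∀ y, bary t z y = bary t z (center F) + ⟪baryGrad t z, y - center F⟫_ℝ :=
      fun y => bary_eq_add t z y _
    rw [Finset.sum_congr rfl fun y _ => h2 y, Finset.sum_add_distrib, ← inner_sum,
      Finset.sum_sub_distrib, Finset.sum_const, Finset.sum_const, center,
      ← Nat.cast_smul_eq_nsmul ℝ, ← Nat.cast_smul_eq_nsmul ℝ, smul_smul, mul_inv_cancel₀ hc]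
    simp
  have h3 : ∑ y ∈ F, bary t z y = 1 := by
    rw [Finset.sum_eq_single_of_mem z hz fun y hy hyz => bary_ne (hFt hy) hyz.symm,
      h.bary_self (hFt hz)]
  rw [h3] at h1
  field_simp
  linarith

/-- The integral of the bubble function is at least a fixed multiple of the volume: on the copy of
`T` shrunk by the factor `1/2` towards the centroid, all barycentric coordinates are at least
`1 / (2 (d + 1))`. -/
theorem IsSimplex.le_integral_prod_bary {t : Finset (Euc d)} (h : IsSimplex t) :
    (1 / 2) ^ d * (1 / (2 * (d + 1))) ^ (d + 1) * volume.real (elem t)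
      ≤ ∫ x in elem t, ∏ z ∈ t, bary t z x := by
  have hne : t.Nonempty := Finset.card_pos.1 (by rw [h.1]; omega)
  -- all barycentric coordinates of the centroid are `1 / (d + 1)`
  have hcm : center t ∈ elem t := h.mem_elem.2 fun z hz => by
    rw [h.bary_center hne subset_rfl hz, h.1]; positivity
  set A := AffineMap.homothety (center t) (1 / 2 : ℝ) '' elem t with hA
  have hAs : A ⊆ elem t :=
    shrink_image_subset (convex_elem t) hcm subset_rfl (by norm_num) (by norm_num)
  have hcont : Continuous fun x => ∏ z ∈ t, bary t z x :=
    continuous_finsetProd _ fun z _ => continuous_bary t z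
  have hint : IntegrableOn (fun x => ∏ z ∈ t, bary t z x) (elem t) :=
    (hcont.continuousOn.integrableOn_compact (isCompact_convexHull t)).mono_set (elem_subset t)
  have hAo : IsOpen A :=
    (AffineMap.homothety_isOpenMap (center t) _ (by norm_num)) _ (isOpen_elem t)
  calc (1 / 2) ^ d * (1 / (2 * ((d : ℝ) + 1))) ^ (d + 1) * volume.real (elem t)
      = (1 / (2 * ((d : ℝ) + 1))) ^ (d + 1) * volume.real A := by
        rw [hA, volume_homothety _ (by norm_num)]; ring
    _ ≤ ∫ x in A, ∏ z ∈ t, bary t z x := by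
        refine setIntegral_ge_of_const_le_real hAo.measurableSet ?_ ?_ (hint.mono_set hAs)
        · exact ((measure_mono hAs).trans_lt (volume_elem_ne_top t).lt_top).ne
        · rintro _ ⟨x, hx, rfl⟩
          rw [← h.1, ← Finset.prod_const]
          refine Finset.prod_le_prod (fun z _ => by positivity) fun z hz => ?_
          rw [AffineMap.homothety_eq_lineMap, bary_lineMap, h.bary_center hne subset_rfl hz]
          have := bary_nonneg (elem_subset t hx) z
          rw [h.1]
          push_cast
          have h2 : (1 : ℝ) / (2 * (d + 1)) = (1 - 1 / 2) * ((d : ℝ) + 1)⁻¹ := by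
            field_simp; norm_num
          rw [h2]
          linarith
    _ ≤ _ := by
        refine setIntegral_mono_set hint ?_ hAs.eventuallyLE
        filter_upwards [ae_restrict_mem (measurableSet_elem t)] with x hx
        exact Finset.prod_nonneg fun z _ => bary_nonneg (elem_subset t hx) z

/-! ### Lipschitz domains -/

/-- Projection onto the hyperplane orthogonal to the unit vector `e`. -/
def perp (e y : Euc d) : Euc d := y - ⟪e, y⟫_ℝ • e

theorem perp_add_smul {e : Euc d} (he : ‖e‖ = 1) (y : Euc d) (s : ℝ) :
    perp e (y + s • e) = perp e y := by
  simp only [perp, inner_add_right, inner_smul_right, real_inner_self_eq_norm_sq, he]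
  module

theorem inner_perp {e : Euc d} (he : ‖e‖ = 1) (y : Euc d) : ⟪e, perp e y⟫_ℝ = 0 := by
  simp [perp, inner_sub_right, inner_smul_right, he]

theorem perp_sub (e x y : Euc d) : perp e x - perp e y = perp e (x - y) := by
  simp only [perp, inner_sub_right]
  module

theorem norm_perp_le {e : Euc d} (he : ‖e‖ = 1) (y : Euc d) : ‖perp e y‖ ≤ ‖y‖ := by
  have h : y = perp e y + ⟪e, y⟫_ℝ • e := by simp [perp]
  have h2 : ⟪perp e y, ⟪e, y⟫_ℝ • e⟫_ℝ = 0 := by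
    rw [inner_smul_right, real_inner_comm e, inner_perp he, mul_zero]
  have h3 := norm_add_sq_eq_norm_sq_add_norm_sq_real h2
  rw [← h] at h3
  nlinarith [norm_nonneg y, norm_nonneg (perp e y), norm_nonneg (⟪e, y⟫_ℝ • e)]

theorem continuous_perp (e : Euc d) : Continuous (perp e) := by
  unfold perp
  fun_prop

/-- A boundary point lies on the graph, and points below the graph are outside of `closure Ω`. -/
theorem graph_of_mem_frontier {Ω : Set (Euc d)} {x e : Euc d} {r : ℝ}
    {γ : Euc d → ℝ} (hx : x ∈ frontier Ω) (hΩ : IsOpen Ω) (hr : 0 < r)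
    (hγ : Continuous γ)
    (hloc : ∀ y ∈ Metric.ball x r, y ∈ Ω ↔ γ (y - ⟪e, y⟫_ℝ • e) < ⟪e, y⟫_ℝ) :
    γ (perp e x) = ⟪e, x⟫_ℝ := by
  have hxΩ : x ∉ Ω := fun h => by
    rw [hΩ.frontier_eq] at hx; exact hx.2 h
  have h1 : ⟪e, x⟫_ℝ ≤ γ (perp e x) := not_lt.1 fun h =>
    hxΩ ((hloc x (Metric.mem_ball_self hr)).2 h)
  refine le_antisymm ?_ h1
  by_contra hcon
  have hopen : IsOpen {y | ⟪e, y⟫_ℝ < γ (perp e y)} :=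
    isOpen_lt (by fun_prop) (hγ.comp (continuous_perp e))
  obtain ⟨y, ⟨hy1, hy2⟩, hy3⟩ := mem_closure_iff.1 (frontier_subset_closure hx) _
    (hopen.inter Metric.isOpen_ball) ⟨not_le.1 hcon, Metric.mem_ball_self hr⟩
  exact lt_asymm hy1 ((hloc y hy2).1 hy3)

/-- A Lipschitz domain has no slits: it is the interior of its closure. -/
theorem IsBoundedLipschitz.interior_closure {Ω : Set (Euc d)} (h : IsBoundedLipschitz Ω) :
    interior (closure Ω) = Ω := by
  refine subset_antisymm (fun x hx => ?_) (interior_maximal subset_closure h.1)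
  by_contra hxΩ
  have hxf : x ∈ frontier Ω := by
    rw [h.1.frontier_eq]; exact ⟨interior_subset hx, hxΩ⟩
  obtain ⟨e, r, K, γ, he, hr, hγ, hloc⟩ := h.2.2 x hxf
  have hgr := graph_of_mem_frontier hxf h.1 hr hγ.continuous hloc
  -- points slightly below `x` in direction `e` are at positive distance from `Ω`
  have hcont : Continuous fun s : ℝ => x + s • e := by fun_prop
  have hnear : ∀ᶠ s in nhds (0 : ℝ), x + s • e ∈ interior (closure Ω) ∩ Metric.ball x r := by
    refine hcont.continuousAt.eventually_mem ?_
    simp only [zero_smul, add_zero]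
    exact (isOpen_interior.inter Metric.isOpen_ball).mem_nhds ⟨hx, Metric.mem_ball_self hr⟩
  obtain ⟨s, ⟨hs1, hs2⟩, hs⟩ :=
    ((hnear.filter_mono nhdsWithin_le_nhds).and
      (self_mem_nhdsWithin (s := Iio (0 : ℝ)))).exists
  have hopen : IsOpen {y | ⟪e, y⟫_ℝ < γ (perp e y)} :=
    isOpen_lt (by fun_prop) (hγ.continuous.comp (continuous_perp e))
  have hmem : x + s • e ∈ {y | ⟪e, y⟫_ℝ < γ (perp e y)} := by
    simp only [mem_ofPred_eq, perp_add_smul he, hgr, inner_add_right, inner_smul_right,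
      real_inner_self_eq_norm_sq, he]
    have : s < 0 := hs
    linarith
  obtain ⟨y, ⟨hy1, hy2⟩, hy3⟩ := mem_closure_iff.1 (interior_subset hs1) _
    (hopen.inter Metric.isOpen_ball) ⟨hmem, hs2⟩
  exact lt_asymm hy1 ((hloc y hy2).1 hy3)

/-- A Lipschitz domain is locally connected up to its boundary: near a boundary point, the part of
the domain below height `ρ` above the graph and over a ball of radius `ρ` in the hyperplane is the
continuous image of a convex set. -/
theorem IsBoundedLipschitz.exists_preconnected {Ω : Set (Euc d)} (h : IsBoundedLipschitz Ω)
    {z : Euc d} (hz : z ∈ closure Ω) {ε : ℝ} (hε : 0 < ε) :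
    ∃ U : Set (Euc d), IsOpen U ∧ IsPreconnected U ∧ U ⊆ Ω ∧ U ⊆ Metric.ball z ε ∧
      ∃ δ > 0, Ω ∩ Metric.ball z δ ⊆ U := by
  by_cases hzΩ : z ∈ Ω
  · obtain ⟨r, hr, hrΩ⟩ := Metric.isOpen_iff.1 h.1 z hzΩ
    refine ⟨Metric.ball z (min r ε), Metric.isOpen_ball, (convex_ball _ _).isPreconnected,
      (Metric.ball_subset_ball (min_le_left _ _)).trans hrΩ,
      Metric.ball_subset_ball (min_le_right _ _), min r ε, lt_min hr hε, inter_subset_right⟩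
  have hzf : z ∈ frontier Ω := by rw [h.1.frontier_eq]; exact ⟨hz, hzΩ⟩
  obtain ⟨e, r, K, γ, he, hr, hγ, hloc⟩ := h.2.2 z hzf
  have hgr := graph_of_mem_frontier hzf h.1 hr hγ.continuous hloc
  set m := min r ε with hm
  have hmpos : 0 < m := lt_min hr hε
  -- the points of `U` below have distance less than `(K + 2) ρ` from `z`, so this choice of `ρ`
  -- keeps `U` inside both the graph neighbourhood and the `ε`-ball
  obtain ⟨ρ, hρ, hρm⟩ : ∃ ρ : ℝ, 0 < ρ ∧ (K + 2) * ρ < m := by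
    refine ⟨m / (2 * (K + 2)), by positivity, ?_⟩
    have : (0 : ℝ) < K + 2 := by positivity
    field_simp
    linarith
  set U : Set (Euc d) := {y | ‖perp e (y - z)‖ < ρ ∧ γ (perp e y) < ⟪e, y⟫_ℝ ∧
    ⟪e, y⟫_ℝ < γ (perp e y) + ρ} with hU
  have hγp : Continuous fun y => γ (perp e y) := hγ.continuous.comp (continuous_perp e)
  have hlip : ∀ y, |γ (perp e y) - ⟪e, z⟫_ℝ| ≤ K * ‖perp e (y - z)‖ := fun y => by
    rw [← hgr, ← perp_sub, ← Real.norm_eq_abs]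
    exact hγ.norm_sub_le _ _
  have hdecomp : ∀ y : Euc d, ‖y - z‖ ≤ ‖perp e (y - z)‖ + |⟪e, y⟫_ℝ - ⟪e, z⟫_ℝ| := fun y => by
    have h1 : y - z = perp e (y - z) + ⟪e, y - z⟫_ℝ • e := by simp [perp]
    calc ‖y - z‖ = ‖perp e (y - z) + ⟪e, y - z⟫_ℝ • e‖ := by rw [← h1]
      _ ≤ _ := by
        refine (norm_add_le _ _).trans ?_
        rw [norm_smul, he, mul_one, inner_sub_right, Real.norm_eq_abs]
  have hUball : U ⊆ Metric.ball z m := fun y hy => by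
    rw [Metric.mem_ball, dist_eq_norm]
    refine lt_of_le_of_lt ?_ hρm
    have h1 := hdecomp y
    have h2 := hlip y
    have h3 : K * ‖perp e (y - z)‖ ≤ K * ρ := by gcongr; exact hy.1.le
    have h4 := hy.1
    have h5 := hy.2.1
    have h6 := hy.2.2
    have h7 : |⟪e, y⟫_ℝ - ⟪e, z⟫_ℝ| ≤ ρ + K * ρ := by
      rw [abs_le] at h2 ⊢
      constructor <;> linarith
    linarith
  refine ⟨U, ?_, ?_, ?_, ?_, ?_⟩
  · have hin : Continuous fun y : Euc d => ⟪e, y⟫_ℝ := by fun_prop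
    have hn : Continuous fun y : Euc d => ‖perp e (y - z)‖ :=
      ((continuous_perp e).comp (continuous_id.sub continuous_const)).norm
    exact (isOpen_lt hn continuous_const).inter
      ((isOpen_lt hγp hin).inter (isOpen_lt hin (hγp.add continuous_const)))
  -- `U` is the image of the convex cylinder `V` under the vertical shear by the graph
  · let V : Set (Euc d) := {y | ‖perp e (y - z)‖ < ρ ∧ 0 < ⟪e, y⟫_ℝ ∧ ⟪e, y⟫_ℝ < ρ}
    let Φ : Euc d → Euc d := fun y => y + γ (perp e y) • e
    have hV : Convex ℝ V := by
      intro x hx y hy a b ha hb hab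
      have h1 : perp e (a • x + b • y - z) = a • perp e (x - z) + b • perp e (y - z) := by
        have : z = (a + b) • z := by rw [hab, one_smul]
        conv_lhs => rw [this]
        simp only [perp, inner_sub_right, inner_add_right, inner_smul_right]
        module
      have h2 : ⟪e, a • x + b • y⟫_ℝ = a * ⟪e, x⟫_ℝ + b * ⟪e, y⟫_ℝ := by
        rw [inner_add_right, inner_smul_right, inner_smul_right]
      have h3 := (convex_ball (0 : Euc d) ρ) (mem_ball_zero_iff.2 hx.1) (mem_ball_zero_iff.2 hy.1)
        ha hb hab
      have h4 := (convex_Ioo (0 : ℝ) ρ) hx.2 hy.2 ha hb hab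
      refine ⟨by rw [h1]; exact mem_ball_zero_iff.1 h3, ?_⟩
      rw [h2]
      exact h4
    have hΦ : Continuous Φ := continuous_id.add (hγp.smul continuous_const)
    have himg : Φ '' V = U := by
      have hin : ∀ y s, ⟪e, y + s • e⟫_ℝ = ⟪e, y⟫_ℝ + s := fun y s => by
        rw [inner_add_right, inner_smul_right, real_inner_self_eq_norm_sq, he]; simp
      ext y
      constructor
      · rintro ⟨x, hx, rfl⟩
        simp only [hU, Φ, mem_ofPred_eq, perp_add_smul he, hin]
        refine ⟨?_, by linarith [hx.2.1], by linarith [hx.2.2]⟩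
        rw [add_sub_right_comm, perp_add_smul he]
        exact hx.1
      · intro hy
        refine ⟨y + (-γ (perp e y)) • e, ⟨?_, ?_, ?_⟩, ?_⟩
        · rw [add_sub_right_comm, perp_add_smul he]; exact hy.1
        · rw [hin]; linarith [hy.2.1]
        · rw [hin]; linarith [hy.2.2]
        · simp only [Φ, perp_add_smul he]
          module
    rw [← himg]
    exact hV.isPreconnected.image Φ hΦ.continuousOn
  · intro y hy
    exact (hloc y (Metric.ball_subset_ball (min_le_left _ _) (hUball hy))).2 hy.2.1
  · exact hUball.trans (Metric.ball_subset_ball (min_le_right _ _))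
  -- a point at distance `ϱ` from `z` has height at most `(K + 1) ϱ` above the graph
  · refine ⟨min r (ρ / (K + 1)), lt_min hr (by positivity), ?_⟩
    rintro y ⟨hyΩ, hy⟩
    have hy1 : y ∈ Metric.ball z r := Metric.ball_subset_ball (min_le_left _ _) hy
    have hy2 : ‖y - z‖ < ρ / (K + 1) := by
      rw [← dist_eq_norm]
      exact (Metric.mem_ball.1 hy).trans_le (min_le_right _ _)
    rw [lt_div_iff₀ (by positivity)] at hy2
    have h1 := norm_perp_le he (y - z)
    have h2 := hlip y
    have hK : (0 : ℝ) ≤ K := K.2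
    have h3 : K * ‖perp e (y - z)‖ ≤ K * ‖y - z‖ := by gcongr
    have h4 : ⟪e, y⟫_ℝ - ⟪e, z⟫_ℝ ≤ ‖y - z‖ := by
      rw [← inner_sub_right]
      simpa [he] using real_inner_le_norm e (y - z)
    have h5 : 0 ≤ K * ‖y - z‖ := by positivity
    rw [abs_le] at h2
    refine ⟨by nlinarith [norm_nonneg (y - z)], (hloc y hy1).1 hyΩ, ?_⟩
    nlinarith [norm_nonneg (y - z)]

/-! ### Meshes as partitions -/

namespace Mesh

variable {Ω : Set (Euc d)} (T : Mesh Ω)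

theorem elem_subset_domain (hI : interior (closure Ω) = Ω) {t : Finset (Euc d)}
    (ht : t ∈ T.cells) : elem t ⊆ Ω := by
  rw [← hI, ← T.cover]
  exact interior_mono (subset_biUnion_of_mem (u := fun t : Finset (Euc d) =>
    convexHull ℝ (t : Set (Euc d))) ht)

theorem convexHull_subset_closure {t : Finset (Euc d)} (ht : t ∈ T.cells) :
    convexHull ℝ (t : Set (Euc d)) ⊆ closure Ω := by
  rw [← T.cover]
  exact (subset_biUnion_of_mem (u := fun t : Finset (Euc d) =>
    convexHull ℝ (t : Set (Euc d))) ht)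

theorem bary_eq_zero_of_mem_convexHull {t : Finset (Euc d)} {F : Set (Euc d)}
    (hF : F ⊆ t) {z : Euc d} (hz : z ∉ F) {x : Euc d} (hx : x ∈ convexHull ℝ F) :
    bary t z x = 0 := by
  have : convexHull ℝ F ⊆ {x | bary t z x = 0} := by
    refine convexHull_min (fun y hy => bary_ne (hF hy) fun h => hz (h ▸ hy)) ?_
    intro x hx y hy a b ha hb hab
    have h1 : a • x + b • y = AffineMap.lineMap x y b := by
      rw [AffineMap.lineMap_apply_module, ← hab]; simp
    simp only [mem_ofPred_eq] at hx hy ⊢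
    rw [h1, bary_lineMap, hx, hy]
    simp
  exact this hx

theorem exists_mem_notMem {s t : Finset (Euc d)} (hs : s ∈ T.cells) (ht : t ∈ T.cells)
    (hst : s ≠ t) : ∃ z ∈ s, z ∉ t := by
  by_contra! hcon
  exact hst (Finset.eq_of_subset_of_card_le hcon
    (by rw [(T.isSimplex s hs).1, (T.isSimplex t ht).1]))

/-- An open element does not meet the closure of another element. -/
theorem notMem_convexHull {s t : Finset (Euc d)} (hs : s ∈ T.cells) (ht : t ∈ T.cells)
    (hst : s ≠ t) {x : Euc d} (hx : x ∈ elem s) : x ∉ convexHull ℝ (t : Set (Euc d)) := by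
  intro hxt
  obtain ⟨z, hz, hzt⟩ := T.exists_mem_notMem hs ht hst
  have h1 : x ∈ convexHull ℝ ((s : Set (Euc d)) ∩ t) := by
    rw [← T.regular s hs t ht]; exact ⟨elem_subset s hx, hxt⟩
  have h2 := bary_eq_zero_of_mem_convexHull (t := s) inter_subset_left
    (z := z) (fun h => hzt h.2) h1
  exact ((T.isSimplex s hs).mem_elem.1 hx z hz).ne' h2

theorem pairwiseDisjoint_elem : (T.cells : Set (Finset (Euc d))).PairwiseDisjoint elem := by
  intro s hs t ht hst
  exact Set.disjoint_left.2 fun x hx hxt => T.notMem_convexHull hs ht hst hx (elem_subset t hxt)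

theorem domain_ae_eq (hI : interior (closure Ω) = Ω) :
    Ω =ᵐ[volume] ⋃ t ∈ T.cells, elem t := by
  have h1 : (⋃ t ∈ T.cells, elem t) ⊆ Ω := iUnion₂_subset fun t ht => T.elem_subset_domain hI ht
  have h2 : (⋃ t ∈ T.cells, elem t) =ᵐ[volume] ⋃ t ∈ T.cells, convexHull ℝ (t : Set (Euc d)) :=
    Filter.EventuallyEq.countable_bUnion T.cells.countable_toSet fun t _ => elem_ae_eq t
  refine Filter.EventuallyLE.antisymm ?_ h1.eventuallyLE
  refine Filter.EventuallyLE.trans ?_ h2.symm.le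
  rw [T.cover]
  exact subset_closure.eventuallyLE

theorem restrict_domain (hI : interior (closure Ω) = Ω) :
    volume.restrict Ω = volume.restrict (⋃ t ∈ T.cells, elem t) :=
  Measure.restrict_congr_set (T.domain_ae_eq hI)

theorem ae_domain (hI : interior (closure Ω) = Ω) {p : Euc d → Prop}
    (h : ∀ t ∈ T.cells, ∀ x ∈ elem t, p x) : ∀ᵐ x ∂volume.restrict Ω, p x := by
  rw [T.restrict_domain hI]
  refine (ae_restrict_iff' (T.cells.measurableSet_biUnion fun t _ => measurableSet_elem t)).2
    (Filter.Eventually.of_forall fun x hx => ?_)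
  simp only [mem_iUnion] at hx
  obtain ⟨t, ht, hxt⟩ := hx
  exact h t ht x hxt

theorem setIntegral_domain (hI : interior (closure Ω) = Ω) {f : Euc d → ℝ}
    (hf : IntegrableOn f Ω) : ∫ x in Ω, f x = ∑ t ∈ T.cells, ∫ x in elem t, f x := by
  rw [T.restrict_domain hI]
  exact integral_biUnion_finset T.cells (fun t _ => measurableSet_elem t) T.pairwiseDisjoint_elem
    fun t ht => hf.mono_set (T.elem_subset_domain hI ht)

/-- The boundary of a domain that admits a mesh is a null set, since the boundaries of the elements
are. -/
theorem volume_closure (T : Mesh Ω) (hI : interior (closure Ω) = Ω) :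
    volume (closure Ω) = volume Ω := by
  rw [measure_congr (T.domain_ae_eq hI), ← T.cover]
  exact (measure_congr (Filter.EventuallyEq.countable_bUnion T.cells.countable_toSet
    fun t _ => elem_ae_eq t)).symm

/-! ### Nodal basis functions and bubbles on the elements -/

/-- Conformity of the mesh: barycentric coordinates of different elements agree on the
intersection of the elements. -/
theorem bary_eq_bary {s t : Finset (Euc d)} (hs : s ∈ T.cells) (ht : t ∈ T.cells) {x : Euc d}
    (hxs : x ∈ convexHull ℝ (s : Set (Euc d))) (hxt : x ∈ convexHull ℝ (t : Set (Euc d)))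
    (z : Euc d) : bary s z x = bary t z x := by
  have hx : x ∈ convexHull ℝ ((s : Set (Euc d)) ∩ t) := by
    rw [← T.regular s hs t ht]; exact ⟨hxs, hxt⟩
  have : convexHull ℝ ((s : Set (Euc d)) ∩ t) ⊆ {x | bary s z x = bary t z x} := by
    refine convexHull_min (fun y hy => ?_) ?_
    · by_cases hzy : z = y
      · subst hzy
        rw [mem_ofPred_eq, (T.isSimplex s hs).bary_self hy.1, (T.isSimplex t ht).bary_self hy.2]
      · rw [mem_ofPred_eq, bary_ne hy.1 hzy, bary_ne hy.2 hzy]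
    · intro x hx y hy a b ha hb hab
      have h1 : a • x + b • y = AffineMap.lineMap x y b := by
        rw [AffineMap.lineMap_apply_module, ← hab]; simp
      simp only [mem_ofPred_eq] at hx hy ⊢
      rw [h1, bary_lineMap, bary_lineMap, hx, hy]
  exact this hx

theorem hat_eq {t : Finset (Euc d)} (ht : t ∈ T.cells) (z : Euc d) {x : Euc d}
    (hx : x ∈ convexHull ℝ (t : Set (Euc d))) : T.hat z x = bary t z x := by
  have hne : Nonempty T.cells := ⟨⟨t, ht⟩⟩
  refine le_antisymm (ciSup_le fun s => ?_) ?_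
  · by_cases hxs : x ∈ convexHull ℝ (s.1 : Set (Euc d))
    · rw [indicator_of_mem hxs, T.bary_eq_bary s.2 ht hxs hx]
    · rw [indicator_of_notMem hxs]
      exact bary_nonneg hx z
  · have := le_ciSup (f := fun s : T.cells =>
      (convexHull ℝ (s.1 : Set (Euc d))).indicator (bary s.1 z) x)
      (Set.finite_range _).bddAbove ⟨t, ht⟩
    simpa [hat, indicator_of_mem hx] using this

theorem bubble_eq {s : Finset (Euc d)} (hs : s ∈ T.cells) (t : Finset (Euc d)) {x : Euc d}
    (hx : x ∈ convexHull ℝ (s : Set (Euc d))) : T.bubble t x = ∏ z ∈ t, bary s z x :=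
  Finset.prod_congr rfl fun z _ => T.hat_eq hs z hx

theorem bubble_eq_zero {s t : Finset (Euc d)} (hs : s ∈ T.cells) (ht : t ∈ T.cells)
    (hst : t ≠ s) {x : Euc d} (hx : x ∈ convexHull ℝ (s : Set (Euc d))) : T.bubble t x = 0 := by
  obtain ⟨z, hz, hzs⟩ := T.exists_mem_notMem ht hs hst
  rw [T.bubble_eq hs t hx]
  exact Finset.prod_eq_zero hz (bary_of_notMem hzs x)

theorem mem_nodes {z : Euc d} : z ∈ T.nodes ↔ ∃ t ∈ T.cells, z ∈ t := by
  simp [nodes]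

/-- A mesh node that lies in the closure of an element is one of its vertices. -/
theorem mem_of_mem_convexHull {z : Euc d} (hz : z ∈ T.nodes) {t : Finset (Euc d)}
    (ht : t ∈ T.cells) (hzt : z ∈ convexHull ℝ (t : Set (Euc d))) : z ∈ t := by
  obtain ⟨s, hs, hzs⟩ := T.mem_nodes.1 hz
  by_contra hcon
  have h1 := T.bary_eq_bary hs ht (subset_hull hzs) hzt z
  rw [(T.isSimplex s hs).bary_self hzs, bary_of_notMem hcon] at h1
  exact one_ne_zero h1

open Classical in
/-- The elements with vertex `z`. -/
def star (z : Euc d) : Finset (Finset (Euc d)) := T.cells.filter (z ∈ ·)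

theorem mem_star {z : Euc d} {t : Finset (Euc d)} : t ∈ T.star z ↔ t ∈ T.cells ∧ z ∈ t := by
  simp [star]

theorem patch_singleton {z : Euc d} (hz : z ∈ T.nodes) : T.patch {z} = T.star z := by
  ext t
  simp only [patch, star, Finset.mem_filter, closure_singleton]
  refine and_congr_right fun ht => ?_
  rw [(T.isSimplex t ht).closure_elem]
  constructor
  · rintro ⟨y, hy1, rfl⟩
    exact T.mem_of_mem_convexHull hz ht hy1
  · intro h
    exact ⟨z, subset_hull h, rfl⟩

theorem mem_patch_elem {s t : Finset (Euc d)} (ht : t ∈ T.cells) :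
    s ∈ T.patch (elem t) ↔ s ∈ T.cells ∧ ∃ z ∈ s, z ∈ t := by
  simp only [patch, Finset.mem_filter]
  refine and_congr_right fun hs => ?_
  rw [(T.isSimplex t ht).closure_elem, (T.isSimplex s hs).closure_elem, T.regular s hs t ht,
    convexHull_nonempty_iff]
  rfl

theorem patch_subset (S : Set (Euc d)) : T.patch S ⊆ T.cells := by
  classical
  simp only [patch]
  exact Finset.filter_subset _ _

theorem patchDomain_subset (hI : interior (closure Ω) = Ω) (S : Set (Euc d)) :
    T.patchDomain S ⊆ Ω := by
  refine (interior_mono (iUnion₂_subset fun t ht => ?_)).trans hI.subset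
  have htc : t ∈ T.cells := T.patch_subset S ht
  rw [(T.isSimplex t htc).closure_elem]
  exact T.convexHull_subset_closure htc

theorem elem_subset_patchDomain {S : Set (Euc d)} {t : Finset (Euc d)} (ht : t ∈ T.patch S) :
    elem t ⊆ T.patchDomain S := by
  have htc : t ∈ T.cells := T.patch_subset S ht
  refine interior_maximal ?_ (isOpen_elem t)
  exact subset_closure.trans (subset_biUnion_of_mem (u := fun t => closure (elem t)) ht)

theorem ShapeRegular.mono {T : Mesh Ω} {κ κ' : ℝ} (h : T.ShapeRegular κ) (hκ : κ ≤ κ') :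
    T.ShapeRegular κ' := fun t ht =>
  (h t ht).trans (mul_le_mul_of_nonneg_right hκ measureReal_nonneg)

end Mesh

/-! ### Square-integrable functions -/

theorem norm_sq_L2 {α E : Type*} [MeasurableSpace α] {μ : Measure α} [NormedAddCommGroup E]
    [InnerProductSpace ℝ E] (f : Lp E 2 μ) : ‖f‖ ^ 2 = ∫ x, ‖f x‖ ^ 2 ∂μ := by
  rw [← real_inner_self_eq_norm_sq, L2.inner_def]
  simp only [real_inner_self_eq_norm_sq]

theorem norm_sq_toLp {α E : Type*} [MeasurableSpace α] {μ : Measure α} [NormedAddCommGroup E]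
    [InnerProductSpace ℝ E] {f : α → E} (hf : MemLp f 2 μ) :
    ‖hf.toLp f‖ ^ 2 = ∫ x, ‖f x‖ ^ 2 ∂μ := by
  rw [norm_sq_L2]
  refine integral_congr_ae ?_
  filter_upwards [hf.coeFn_toLp] with x hx
  rw [hx]

theorem inner_toLp {α E : Type*} [MeasurableSpace α] {μ : Measure α} [NormedAddCommGroup E]
    [InnerProductSpace ℝ E] {f g : α → E} (hf : MemLp f 2 μ) (hg : MemLp g 2 μ) :
    ⟪hf.toLp f, hg.toLp g⟫_ℝ = ∫ x, ⟪f x, g x⟫_ℝ ∂μ := by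
  rw [L2.inner_def]
  refine integral_congr_ae ?_
  filter_upwards [hf.coeFn_toLp, hg.coeFn_toLp] with x hx hy
  rw [hx, hy]

theorem abs_integral_inner_le {α E : Type*} [MeasurableSpace α] {μ : Measure α}
    [NormedAddCommGroup E] [InnerProductSpace ℝ E] {f g : α → E} (hf : MemLp f 2 μ)
    (hg : MemLp g 2 μ) :
    |∫ x, ⟪f x, g x⟫_ℝ ∂μ| ≤ √(∫ x, ‖f x‖ ^ 2 ∂μ) * √(∫ x, ‖g x‖ ^ 2 ∂μ) := by
  rw [← inner_toLp hf hg, ← norm_sq_toLp hf, ← norm_sq_toLp hg, Real.sqrt_sq (norm_nonneg _),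
    Real.sqrt_sq (norm_nonneg _)]
  exact abs_real_inner_le_norm _ _

theorem abs_integral_mul_le {α : Type*} [MeasurableSpace α] {μ : Measure α} {f g : α → ℝ}
    (hf : MemLp f 2 μ) (hg : MemLp g 2 μ) :
    |∫ x, f x * g x ∂μ| ≤ √(∫ x, f x ^ 2 ∂μ) * √(∫ x, g x ^ 2 ∂μ) := by
  have h := abs_integral_inner_le hf hg
  simp only [Real.norm_eq_abs, sq_abs] at h
  refine le_of_eq_of_le ?_ h
  congr 1
  refine integral_congr_ae (Filter.Eventually.of_forall fun x => ?_)
  simp [mul_comm]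

theorem sq_integral_le {α : Type*} [MeasurableSpace α] {μ : Measure α} [IsFiniteMeasure μ]
    {f : α → ℝ} (hf : MemLp f 2 μ) :
    (∫ x, f x ∂μ) ^ 2 ≤ μ.real univ * ∫ x, f x ^ 2 ∂μ := by
  have h := abs_integral_mul_le hf (memLp_const (1 : ℝ))
  simp only [mul_one, one_pow, integral_const, smul_eq_mul] at h
  rw [← sq_abs]
  have h0 : 0 ≤ ∫ x, f x ^ 2 ∂μ := integral_nonneg fun x => sq_nonneg _
  calc |∫ x, f x ∂μ| ^ 2 ≤ (√(∫ x, f x ^ 2 ∂μ) * √(μ.real univ)) ^ 2 := by gcongr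
    _ = _ := by
      rw [mul_pow, Real.sq_sqrt h0, Real.sq_sqrt measureReal_nonneg, mul_comm]

theorem integral_quadratic {α : Type*} [MeasurableSpace α] {μ : Measure α} [IsFiniteMeasure μ]
    {f : α → ℝ} (hf : MemLp f 2 μ) (a b c : ℝ) :
    Integrable (fun x => a * f x ^ 2 + b * f x + c) μ ∧
      ∫ x, (a * f x ^ 2 + b * f x + c) ∂μ
        = a * (∫ x, f x ^ 2 ∂μ) + b * (∫ x, f x ∂μ) + c * μ.real univ := by
  have h1 : Integrable (fun x => a * f x ^ 2) μ := hf.integrable_sq.const_mul a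
  have h2 : Integrable (fun x => b * f x) μ := (hf.integrable (by norm_num)).const_mul b
  have h12 : Integrable (fun x => a * f x ^ 2 + b * f x) μ := h1.add h2
  have h3 : Integrable (fun _ => c) μ := integrable_const c
  refine ⟨h12.add h3, ?_⟩
  rw [integral_add h12 h3, integral_add h1 h2, integral_const_mul, integral_const_mul,
    integral_const, smul_eq_mul, mul_comm c]

/-! ### Test functions -/

theorem IsTest.mono {U V : Set (Euc d)} {ψ : Euc d → ℝ} (h : IsTest U ψ) (hUV : U ⊆ V) :
    IsTest V ψ := ⟨h.1, h.2.1, h.2.2.trans hUV⟩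

theorem IsTest.eq_zero {U : Set (Euc d)} {ψ : Euc d → ℝ} (h : IsTest U ψ) {x : Euc d}
    (hx : x ∉ U) : ψ x = 0 :=
  image_eq_zero_of_notMem_tsupport fun hx' => hx (h.2.2 hx')

theorem IsTest.fderiv_eq_zero {U : Set (Euc d)} {ψ : Euc d → ℝ} (h : IsTest U ψ) {x : Euc d}
    (hx : x ∉ U) : fderiv ℝ ψ x = 0 :=
  image_eq_zero_of_notMem_tsupport fun hx' => hx (h.2.2 (tsupport_fderiv_subset ℝ hx'))

theorem IsTest.translate {U V : Set (Euc d)} {ψ : Euc d → ℝ} (h : IsTest U ψ) (τ : Euc d)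
    (hV : ∀ x ∈ U, x + τ ∈ V) : IsTest V fun x => ψ (x - τ) := by
  have h1 : (fun x => ψ (x - τ)) = ψ ∘ Homeomorph.subRight τ := rfl
  refine ⟨h.1.comp (contDiff_id.sub contDiff_const), ?_, ?_⟩
  · rw [h1]; exact h.2.1.comp_homeomorph _
  · rw [h1, tsupport_comp_eq_preimage]
    intro x hx
    have := hV _ (h.2.2 hx)
    simpa using this

/-- Test functions are dense in `L²(U)`; in dual form: an `L²` norm is determined by testing. -/
theorem integral_sq_le_of_test {U : Set (Euc d)} (hU : IsOpen U) {f : Euc d → ℝ}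
    (hf : MemLp f 2 (volume.restrict U)) {M : ℝ} (hM : 0 ≤ M)
    (h : ∀ ψ, IsTest U ψ → |∫ x in U, f x * ψ x| ≤ M * √(∫ x in U, ψ x ^ 2)) :
    ∫ x in U, f x ^ 2 ≤ M ^ 2 := by
  let D : Submodule ℝ (L2 U) :=
    { carrier := {F | ∃ ψ, ∃ hψ : IsTest U ψ, F = (hψ.memLp U).toLp ψ}
      add_mem' := by
        rintro _ _ ⟨ψ, hψ, rfl⟩ ⟨χ, hχ, rfl⟩
        exact ⟨ψ + χ, ⟨hψ.1.add hχ.1, hψ.2.1.add hχ.2.1,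
          (tsupport_add ψ χ).trans (union_subset hψ.2.2 hχ.2.2)⟩, rfl⟩
      zero_mem' := by
        refine ⟨0, ⟨contDiff_const, HasCompactSupport.zero, ?_⟩, rfl⟩
        simp [tsupport]
      smul_mem' := by
        rintro c _ ⟨ψ, hψ, rfl⟩
        exact ⟨c • ψ, ⟨contDiff_const.smul hψ.1, hψ.2.1.smul_left (f := fun _ => c),
          (tsupport_smul_subset_right (fun _ => c) ψ).trans hψ.2.2⟩, rfl⟩ }
  -- an element orthogonal to all test functions vanishes by the fundamental lemma
  have hdense : D.topologicalClosure = ⊤ := by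
    rw [Submodule.topologicalClosure_eq_top_iff, Submodule.eq_bot_iff]
    intro F hF
    have hloc : LocallyIntegrableOn F U volume :=
      locallyIntegrableOn_of_locallyIntegrable_restrict
        ((Lp.memLp F).locallyIntegrable (by norm_num))
    have h0 := hU.ae_eq_zero_of_integral_contDiff_smul_eq_zero hloc fun ψ h1 h2 h3 => by
      have hψ : IsTest U ψ := ⟨h1, h2, h3⟩
      have h4 := (Submodule.mem_orthogonal D F).1 hF _ ⟨ψ, hψ, rfl⟩
      rw [L2.inner_def] at h4
      rw [← setIntegral_eq_integral_of_forall_compl_eq_zero (s := U)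
        fun x hx => by rw [hψ.eq_zero hx, zero_smul], ← h4]
      refine integral_congr_ae ?_
      filter_upwards [(hψ.memLp U).coeFn_toLp] with x hx
      rw [hx]
      simp [mul_comm]
    rw [Lp.eq_zero_iff_ae_eq_zero]
    exact (ae_restrict_iff' hU.measurableSet).2 h0
  have hle : ∀ F : L2 U, ⟪hf.toLp f, F⟫_ℝ ≤ M * ‖F‖ := by
    have hcl : IsClosed {F : L2 U | ⟪hf.toLp f, F⟫_ℝ ≤ M * ‖F‖} :=
      isClosed_le (by fun_prop) (by fun_prop)
    have hsub : (D : Set (L2 U)) ⊆ {F : L2 U | ⟪hf.toLp f, F⟫_ℝ ≤ M * ‖F‖} := by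
      rintro _ ⟨ψ, hψ, rfl⟩
      have h1 := (le_abs_self _).trans (h ψ hψ)
      have h2 := norm_sq_toLp (hψ.memLp U)
      simp only [Real.norm_eq_abs, sq_abs] at h2
      rw [mem_ofPred_eq, inner_toLp]
      rw [← h2, Real.sqrt_sq (norm_nonneg _)] at h1
      refine le_of_eq_of_le ?_ h1
      refine integral_congr_ae (Filter.Eventually.of_forall fun x => ?_)
      simp [mul_comm]
    have h2 := closure_minimal hsub hcl
    rw [← Submodule.topologicalClosure_coe, hdense] at h2
    exact fun F => h2 (mem_univ F)
  have h1 := hle (hf.toLp f)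
  rw [real_inner_self_eq_norm_sq, sq] at h1
  have h2 : ‖hf.toLp f‖ ≤ M := by
    by_contra hcon
    rw [not_le] at hcon
    nlinarith [norm_nonneg (hf.toLp f)]
  have h3 := norm_sq_toLp hf
  simp only [Real.norm_eq_abs, sq_abs] at h3
  rw [← h3]
  gcongr

/-! ### Translation estimate and Poincaré inequalities for weakly differentiable functions -/

/-- `v ∈ L²(G)` has the weak gradient `g ∈ L²(G)ᵈ`. Both are represented by measurable functions
on the whole space. -/
structure HasWeakGrad (G : Set (Euc d)) (v : Euc d → ℝ) (g : Euc d → Euc d) : Prop where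
  meas : Measurable v
  meas_grad : Measurable g
  memLp : MemLp v 2 (volume.restrict G)
  memLp_grad : MemLp g 2 (volume.restrict G)
  green : ∀ ψ, IsTest G ψ → ∀ e : Euc d,
    ∫ x in G, v x * fderiv ℝ ψ x e = - ∫ x in G, ⟪e, g x⟫_ℝ * ψ x

theorem HasWeakGrad.of_H1 {Ω : Set (Euc d)} (p : H1 Ω) : HasWeakGrad Ω p.1.fst p.1.snd :=
  ⟨(Lp.stronglyMeasurable _).measurable, (Lp.stronglyMeasurable _).measurable, Lp.memLp _,
    Lp.memLp _, fun ψ hψ e => p.2 ψ hψ e⟩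

theorem HasWeakGrad.mono {Ω G : Set (Euc d)} {v : Euc d → ℝ} {g : Euc d → Euc d}
    (h : HasWeakGrad Ω v g) (hG : G ⊆ Ω) :
    HasWeakGrad G v g := by
  refine ⟨h.meas, h.meas_grad, h.memLp.mono_measure (Measure.restrict_mono hG le_rfl),
    h.memLp_grad.mono_measure (Measure.restrict_mono hG le_rfl), fun ψ hψ e => ?_⟩
  rw [setIntegral_eq_integral_of_forall_compl_eq_zero fun x hx => by
      rw [hψ.fderiv_eq_zero hx]; simp,
    setIntegral_eq_integral_of_forall_compl_eq_zero fun x hx => by rw [hψ.eq_zero hx]; simp]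
  have := h.green ψ (hψ.mono hG) e
  rwa [setIntegral_eq_integral_of_forall_compl_eq_zero fun x hx => by
      rw [hψ.fderiv_eq_zero fun h => hx (hG h)]; simp,
    setIntegral_eq_integral_of_forall_compl_eq_zero fun x hx => by
      rw [hψ.eq_zero fun h => hx (hG h)]; simp] at this

/-- Testing the difference `v(· + τ) - v`: the function `s ↦ ∫ v ψ(· - s τ)` has derivative
`∫ (∇v · τ) ψ(· - s τ)`. -/
theorem HasWeakGrad.abs_integral_sub_le {G : Set (Euc d)} (hG : Convex ℝ G)
    (hGf : volume G ≠ ∞) {v : Euc d → ℝ} {g : Euc d → Euc d} (h : HasWeakGrad G v g) (τ : Euc d)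
    {ψ : Euc d → ℝ} (hψ : IsTest {x | x ∈ G ∧ x + τ ∈ G} ψ) :
    |(∫ x in G, v x * ψ (x - τ)) - ∫ x in G, v x * ψ x|
      ≤ ‖τ‖ * √(∫ x in G, ‖g x‖ ^ 2) * √(∫ x, ψ x ^ 2) := by
  have hfin : IsFiniteMeasure (volume.restrict G) := ⟨by
    rw [Measure.restrict_apply_univ]; exact hGf.lt_top⟩
  have hcd : Continuous (fderiv ℝ ψ) := hψ.1.continuous_fderiv (by simp)
  obtain ⟨C, hC⟩ := (hψ.2.1.fderiv (𝕜 := ℝ)).exists_bound_of_continuous hcd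
  obtain ⟨C', hC'⟩ := hψ.2.1.exists_bound_of_continuous hψ.1.continuous
  have hvint : Integrable v (volume.restrict G) := h.memLp.integrable (by norm_num)
  have hder : ∀ s : ℝ, HasDerivAt (fun s => ∫ x in G, v x * ψ (x - s • τ))
      (∫ x in G, v x * fderiv ℝ ψ (x - s • τ) (-τ)) s := fun s => by
    refine (hasDerivAt_integral_of_dominated_loc_of_deriv_le (𝕜 := ℝ) (E := ℝ)
      (F := fun s x => v x * ψ (x - s • τ)) (F' := fun s x => v x * fderiv ℝ ψ (x - s • τ) (-τ))
      (bound := fun x => ‖v x‖ * (C * ‖τ‖)) Filter.univ_mem ?_ ?_ ?_ ?_ ?_ ?_).2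
    · refine Filter.Eventually.of_forall fun s => ?_
      have : Continuous fun x => ψ (x - s • τ) := hψ.1.continuous.comp (by fun_prop)
      exact (h.meas.mul this.measurable).aestronglyMeasurable
    · have : Continuous fun x => ψ (x - s • τ) := hψ.1.continuous.comp (by fun_prop)
      exact hvint.mul_bdd (c := C') this.aestronglyMeasurable
        (Filter.Eventually.of_forall fun x => hC' _)
    · have : Continuous fun x => fderiv ℝ ψ (x - s • τ) (-τ) :=
        (hcd.comp (by fun_prop)).clm_apply continuous_const
      exact (h.meas.mul this.measurable).aestronglyMeasurable
    · refine Filter.Eventually.of_forall fun x s _ => ?_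
      rw [norm_mul]
      gcongr
      refine (ContinuousLinearMap.le_opNorm _ _).trans ?_
      rw [norm_neg]
      gcongr
      exact hC _
    · exact hvint.norm.mul_const _
    · refine Filter.Eventually.of_forall fun x s _ => ?_
      have h1 : HasFDerivAt ψ (fderiv ℝ ψ (x - s • τ)) (x - s • τ) :=
        (hψ.1.differentiable (by simp) _).hasFDerivAt
      have h2 : HasDerivAt (fun s : ℝ => x - s • τ) (-τ) s := by
        simpa using ((hasDerivAt_id s).smul_const τ).const_sub x
      exact (h1.comp_hasDerivAt s h2).const_mul (v x)
  have hbound : ∀ s ∈ Ico (0 : ℝ) 1, ‖∫ x in G, v x * fderiv ℝ ψ (x - s • τ) (-τ)‖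
      ≤ ‖τ‖ * √(∫ x in G, ‖g x‖ ^ 2) * √(∫ x, ψ x ^ 2) := by
    intro s hs
    -- by convexity of `G`, the translates by the fractions of `τ` are test functions on `G`
    have hψs : IsTest G fun x => ψ (x - s • τ) := by
      refine hψ.translate (s • τ) fun x hx => ?_
      have := hG.add_smul_mem hx.1 hx.2 ⟨hs.1, hs.2.le⟩
      exact this
    have hfd : ∀ x, fderiv ℝ (fun x => ψ (x - s • τ)) x = fderiv ℝ ψ (x - s • τ) := fun x => by
      simp only [sub_eq_add_neg]
      exact fderiv_comp_add_right (-(s • τ))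
    have h1 := h.green _ hψs (-τ)
    simp only [hfd] at h1
    have h2 : MemLp (fun x => ψ (x - s • τ) • τ) 2 (volume.restrict G) := by
      exact (ContinuousLinearMap.toSpanSingleton ℝ τ).comp_memLp' (hψs.memLp G)
    have h3 := abs_integral_inner_le h2 h.memLp_grad
    rw [h1, Real.norm_eq_abs, abs_neg]
    have h4 : ∫ x in G, ⟪-τ, g x⟫_ℝ * ψ (x - s • τ) = -∫ x in G, ⟪ψ (x - s • τ) • τ, g x⟫_ℝ := by
      rw [← integral_neg]
      refine integral_congr_ae (Filter.Eventually.of_forall fun x => ?_)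
      simp only [inner_neg_left, inner_smul_left, RCLike.conj_to_real]
      ring
    rw [h4, abs_neg]
    refine h3.trans ?_
    have h5 : ∫ x in G, ‖ψ (x - s • τ) • τ‖ ^ 2 = ‖τ‖ ^ 2 * ∫ x, ψ x ^ 2 := by
      rw [← integral_const_mul,
        setIntegral_eq_integral_of_forall_compl_eq_zero fun x hx => by rw [hψs.eq_zero hx]; simp,
        ← integral_sub_right_eq_self (fun x => ‖τ‖ ^ 2 * ψ x ^ 2) (s • τ)]
      refine integral_congr_ae (Filter.Eventually.of_forall fun x => ?_)
      simp only [norm_smul, mul_pow, Real.norm_eq_abs, sq_abs]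
      ring
    rw [h5, Real.sqrt_mul (sq_nonneg _), Real.sqrt_sq (norm_nonneg _)]
    exact le_of_eq (by ring)
  have := norm_image_sub_le_of_norm_deriv_le_segment_01' (fun s _ => (hder s).hasDerivWithinAt)
    hbound
  simpa using this

/-- The translation estimate, in dual form: `v - v(· + τ)` is tested on the set where both terms are
defined. -/
theorem HasWeakGrad.integral_sq_translate_le {G : Set (Euc d)} (hG : Convex ℝ G) (hGo : IsOpen G)
    (hGf : volume G ≠ ∞) {v : Euc d → ℝ} {g : Euc d → Euc d} (h : HasWeakGrad G v g)
    (τ : Euc d) :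
    ∫⁻ x in {x | x ∈ G ∧ x + τ ∈ G}, ENNReal.ofReal ((v x - v (x + τ)) ^ 2)
      ≤ ENNReal.ofReal (‖τ‖ ^ 2 * ∫ x in G, ‖g x‖ ^ 2) := by
  set V : Set (Euc d) := {x | x ∈ G ∧ x + τ ∈ G} with hV
  have hVo : IsOpen V := hGo.inter (hGo.preimage (continuous_add_const τ))
  have hVG : V ⊆ G := fun x hx => hx.1
  have h1 : MemLp v 2 (volume.restrict V) :=
    h.memLp.mono_measure (Measure.restrict_mono hVG le_rfl)
  have h2 : MemLp (fun x => v (x + τ)) 2 (volume.restrict V) := by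
    have h3 : MemLp (G.indicator v) 2 volume := (memLp_indicator_iff_restrict hGo.measurableSet).2
      h.memLp
    have h4 : MemLp (fun x => G.indicator v (x + τ)) 2 volume :=
      h3.comp_measurePreserving (measurePreserving_add_right volume τ)
    refine (h4.restrict V).ae_eq ?_
    filter_upwards [ae_restrict_mem hVo.measurableSet] with x hx
    exact indicator_of_mem hx.2 _
  have h12 : MemLp (fun x => v x - v (x + τ)) 2 (volume.restrict V) := h1.sub h2
  have hM : 0 ≤ ‖τ‖ * √(∫ x in G, ‖g x‖ ^ 2) := by positivity
  have key := integral_sq_le_of_test hVo h12 hM fun ψ hψ => by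
    have h3 := h.abs_integral_sub_le hG hGf τ hψ
    have h4 : ∫ x in G, v x * ψ x = ∫ x in V, v x * ψ x := by
      rw [setIntegral_eq_integral_of_forall_compl_eq_zero fun x hx => by
          rw [hψ.eq_zero fun h => hx (hVG h)]; simp,
        setIntegral_eq_integral_of_forall_compl_eq_zero fun x hx => by
          rw [hψ.eq_zero hx]; simp]
    have h5 : ∫ x in G, v x * ψ (x - τ) = ∫ x in V, v (x + τ) * ψ x := by
      rw [setIntegral_eq_integral_of_forall_compl_eq_zero fun x hx => by
          rw [hψ.eq_zero fun h => hx (by simpa using h.2)]; simp,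
        setIntegral_eq_integral_of_forall_compl_eq_zero fun x hx => by
          rw [hψ.eq_zero hx]; simp,
        ← integral_add_right_eq_self _ τ]
      simp
    have h6 : ∫ x in V, ψ x ^ 2 = ∫ x, ψ x ^ 2 :=
      setIntegral_eq_integral_of_forall_compl_eq_zero fun x hx => by rw [hψ.eq_zero hx]; simp
    rw [h4, h5, abs_sub_comm] at h3
    rw [h6]
    refine le_of_eq_of_le ?_ h3
    congr 1
    have i1 : IntegrableOn (fun x => v x * ψ x) V := h1.integrable_mul (hψ.memLp V)
    have i2 : IntegrableOn (fun x => v (x + τ) * ψ x) V := h2.integrable_mul (hψ.memLp V)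
    rw [← integral_sub i1 i2]
    simp only [sub_mul]
  rw [mul_pow, Real.sq_sqrt (integral_nonneg fun x => sq_nonneg _)] at key
  rw [← ofReal_integral_eq_lintegral_ofReal h12.integrable_sq
    (Filter.Eventually.of_forall fun x => sq_nonneg _)]
  exact ENNReal.ofReal_le_ofReal key

/-- The double integral of `|v(x) - v(y)|²` over a convex set, computed by integrating the
translation estimate over all differences `τ = y - x`. -/
theorem HasWeakGrad.lintegral_lintegral_le {G : Set (Euc d)} (hG : Convex ℝ G) (hGo : IsOpen G)
    (hGb : Bornology.IsBounded G) {v : Euc d → ℝ} {g : Euc d → Euc d} (h : HasWeakGrad G v g) :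
    ∫⁻ x in G, ∫⁻ y in G, ENNReal.ofReal ((v x - v y) ^ 2)
      ≤ ENNReal.ofReal (ballVol d * Metric.diam G ^ (d + 2) * ∫ x in G, ‖g x‖ ^ 2) := by
  have hGm := hGo.measurableSet
  set D := Metric.diam G
  set E := ∫ x in G, ‖g x‖ ^ 2 with hE
  have hE0 : 0 ≤ E := integral_nonneg fun x => sq_nonneg _
  let k : Euc d → Euc d → ℝ≥0∞ := fun x τ =>
    {x | x ∈ G ∧ x + τ ∈ G}.indicator (fun x => ENNReal.ofReal ((v x - v (x + τ)) ^ 2)) x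
  have hkm : Measurable (Function.uncurry k) := by
    have h1 : Function.uncurry k = {p : Euc d × Euc d | p.1 ∈ G ∧ p.1 + p.2 ∈ G}.indicator
        (fun p => ENNReal.ofReal ((v p.1 - v (p.1 + p.2)) ^ 2)) := by
      funext p
      simp only [Function.uncurry, k, indicator, mem_ofPred_eq]
    rw [h1]
    have := h.meas
    refine Measurable.indicator (by fun_prop) ?_
    exact (hGm.preimage measurable_fst).inter (hGm.preimage (measurable_fst.add measurable_snd))
  calc ∫⁻ x in G, ∫⁻ y in G, ENNReal.ofReal ((v x - v y) ^ 2)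
      = ∫⁻ x, ∫⁻ τ, k x τ := by
        rw [← lintegral_indicator hGm]
        refine lintegral_congr fun x => ?_
        by_cases hx : x ∈ G
        · rw [indicator_of_mem hx, ← lintegral_indicator hGm, ← lintegral_add_left_eq_self _ x]
          refine lintegral_congr fun τ => ?_
          by_cases hxτ : x + τ ∈ G <;> simp [k, indicator, hx, hxτ]
        · rw [indicator_of_notMem hx]
          simp [k, indicator, hx]
    _ = ∫⁻ τ, ∫⁻ x, k x τ := lintegral_lintegral_swap hkm.aemeasurable
    _ ≤ ∫⁻ τ, (Metric.closedBall (0 : Euc d) D).indicator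
          (fun _ => ENNReal.ofReal (D ^ 2 * E)) τ := by
        refine lintegral_mono fun τ => ?_
        by_cases hτ : τ ∈ Metric.closedBall 0 D
        · rw [indicator_of_mem hτ]
          have hVm : MeasurableSet {x | x ∈ G ∧ x + τ ∈ G} :=
            hGm.inter (hGm.preimage (measurable_add_const τ))
          simp only [k]
          rw [lintegral_indicator hVm]
          refine (h.integral_sq_translate_le hG hGo hGb.measure_lt_top.ne τ).trans
            (ENNReal.ofReal_le_ofReal ?_)
          have := mem_closedBall_zero_iff.1 hτ
          gcongr
        · rw [indicator_of_notMem hτ]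
          refine le_of_eq ?_
          rw [lintegral_eq_zero_of_ae_eq_zero]
          refine Filter.Eventually.of_forall fun x => indicator_of_notMem (fun hx => hτ ?_) _
          rw [mem_closedBall_zero_iff]
          have := Metric.dist_le_diam_of_mem hGb hx.2 hx.1
          simpa [dist_eq_norm] using this
    _ = ENNReal.ofReal (ballVol d * D ^ (d + 2) * E) := by
        rw [lintegral_indicator measurableSet_closedBall, setLIntegral_const,
          ← ofReal_measureReal measure_closedBall_lt_top.ne,
          volume_closedBall _ (show 0 ≤ D from Metric.diam_nonneg),
          ← ENNReal.ofReal_mul (by positivity)]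
        congr 1
        ring

/-- The double integral of `|v(x) - v(y)|²` over `A × B`, written in terms of the moments of `v` on
the subsets `A` and `B` of a convex set. -/
theorem HasWeakGrad.moments_le {G : Set (Euc d)} (hG : Convex ℝ G) (hGo : IsOpen G)
    (hGb : Bornology.IsBounded G) {v : Euc d → ℝ} {g : Euc d → Euc d} (h : HasWeakGrad G v g)
    {A B : Set (Euc d)} (hA : A ⊆ G) (hB : B ⊆ G) :
    (∫ x in A, v x ^ 2) * volume.real B - 2 * (∫ x in A, v x) * (∫ x in B, v x)
        + volume.real A * (∫ x in B, v x ^ 2)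
      ≤ ballVol d * Metric.diam G ^ (d + 2) * ∫ x in G, ‖g x‖ ^ 2 := by
  have hGf := hGb.measure_lt_top (μ := volume)
  have hfA : IsFiniteMeasure (volume.restrict A) := ⟨by
    rw [Measure.restrict_apply_univ]; exact (measure_mono hA).trans_lt hGf⟩
  have hfB : IsFiniteMeasure (volume.restrict B) := ⟨by
    rw [Measure.restrict_apply_univ]; exact (measure_mono hB).trans_lt hGf⟩
  have hvA : MemLp v 2 (volume.restrict A) :=
    h.memLp.mono_measure (Measure.restrict_mono hA le_rfl)
  have hvB : MemLp v 2 (volume.restrict B) :=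
    h.memLp.mono_measure (Measure.restrict_mono hB le_rfl)
  have hexp : ∀ x y, (v x - v y) ^ 2 = 1 * v y ^ 2 + (-(2 * v x)) * v y + v x ^ 2 :=
    fun x y => by ring
  have hin : ∀ x, Integrable (fun y => (v x - v y) ^ 2) (volume.restrict B) := fun x => by
    simp only [hexp]
    exact (integral_quadratic hvB _ _ _).1
  have hinner : ∀ x, ∫ y in B, (v x - v y) ^ 2
      = volume.real B * v x ^ 2 + (-(2 * ∫ y in B, v y)) * v x + ∫ y in B, v y ^ 2 := fun x => by
    simp only [hexp]
    rw [(integral_quadratic hvB _ _ _).2, measureReal_restrict_apply_univ]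
    ring
  have hout : Integrable (fun x => ∫ y in B, (v x - v y) ^ 2) (volume.restrict A) := by
    simp only [hinner]
    exact (integral_quadratic hvA _ _ _).1
  have houter : ∫ x in A, ∫ y in B, (v x - v y) ^ 2
      = (∫ x in A, v x ^ 2) * volume.real B - 2 * (∫ x in A, v x) * (∫ x in B, v x)
        + volume.real A * (∫ x in B, v x ^ 2) := by
    simp only [hinner]
    rw [(integral_quadratic hvA _ _ _).2, measureReal_restrict_apply_univ]
    ring
  rw [← houter]
  have hR : 0 ≤ ballVol d * Metric.diam G ^ (d + 2) * ∫ x in G, ‖g x‖ ^ 2 := by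
    have := ballVol_pos d
    have h1 : 0 ≤ ∫ x in G, ‖g x‖ ^ 2 := integral_nonneg fun x => sq_nonneg _
    have := Metric.diam_nonneg (s := G)
    positivity
  rw [← ENNReal.ofReal_le_ofReal_iff hR, ofReal_integral_eq_lintegral_ofReal hout
    (Filter.Eventually.of_forall fun x => integral_nonneg fun y => sq_nonneg _)]
  refine le_trans ?_ (h.lintegral_lintegral_le hG hGo hGb)
  refine (lintegral_mono_set hA).trans (lintegral_mono fun x => ?_)
  rw [ofReal_integral_eq_lintegral_ofReal (hin x)
    (Filter.Eventually.of_forall fun y => sq_nonneg _)]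
  exact lintegral_mono_set hB

/-- The average of `v` over `A`. -/
def avg (A : Set (Euc d)) (v : Euc d → ℝ) : ℝ := (∫ x in A, v x) / volume.real A

/-- Mean values over two subsets of a convex set. After the expansion of the double integral of
`|v(x) - v(y)|²`, the squares are bounded from below by the means (Cauchy–Schwarz). -/
theorem HasWeakGrad.sq_avg_sub_avg_le {G : Set (Euc d)} (hG : Convex ℝ G) (hGo : IsOpen G)
    (hGb : Bornology.IsBounded G) {v : Euc d → ℝ} {g : Euc d → Euc d} (h : HasWeakGrad G v g)
    {A B : Set (Euc d)} (hA : A ⊆ G) (hB : B ⊆ G) (hA0 : 0 < volume.real A)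
    (hB0 : 0 < volume.real B) :
    (avg A v - avg B v) ^ 2 ≤ ballVol d * Metric.diam G ^ (d + 2) * (∫ x in G, ‖g x‖ ^ 2)
      / (volume.real A * volume.real B) := by
  have hmom := h.moments_le hG hGo hGb hA hB
  have hGf := hGb.measure_lt_top (μ := volume)
  have hfA : IsFiniteMeasure (volume.restrict A) := ⟨by
    rw [Measure.restrict_apply_univ]; exact (measure_mono hA).trans_lt hGf⟩
  have hfB : IsFiniteMeasure (volume.restrict B) := ⟨by
    rw [Measure.restrict_apply_univ]; exact (measure_mono hB).trans_lt hGf⟩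
  have h1 := sq_integral_le (h.memLp.mono_measure (Measure.restrict_mono hA le_rfl))
  have h2 := sq_integral_le (h.memLp.mono_measure (Measure.restrict_mono hB le_rfl))
  rw [measureReal_restrict_apply_univ] at h1 h2
  rw [le_div_iff₀ (by positivity)]
  refine le_trans ?_ hmom
  unfold avg
  set a0 := volume.real A
  set b0 := volume.real B
  set a1 := ∫ x in A, v x
  set b1 := ∫ x in B, v x
  have h3 : (a1 / a0 - b1 / b0) ^ 2 * (a0 * b0) = a1 ^ 2 / a0 * b0 - 2 * a1 * b1
      + a0 * (b1 ^ 2 / b0) := by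
    field_simp; ring
  rw [h3]
  have h4 : a1 ^ 2 / a0 ≤ ∫ x in A, v x ^ 2 := by rw [div_le_iff₀ hA0]; linarith
  have h5 : b1 ^ 2 / b0 ≤ ∫ x in B, v x ^ 2 := by rw [div_le_iff₀ hB0]; linarith
  gcongr

/-- The Poincaré inequality on a convex set. -/
theorem HasWeakGrad.integral_sq_sub_avg_le {G : Set (Euc d)} (hG : Convex ℝ G) (hGo : IsOpen G)
    (hGb : Bornology.IsBounded G) {v : Euc d → ℝ} {g : Euc d → Euc d} (h : HasWeakGrad G v g)
    (hG0 : 0 < volume.real G) :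
    ∫ x in G, (v x - avg G v) ^ 2
      ≤ ballVol d * Metric.diam G ^ (d + 2) * (∫ x in G, ‖g x‖ ^ 2) / volume.real G := by
  have hmom := h.moments_le hG hGo hGb subset_rfl subset_rfl
  have hfG : IsFiniteMeasure (volume.restrict G) := ⟨by
    rw [Measure.restrict_apply_univ]; exact hGb.measure_lt_top⟩
  have h1 : ∫ x in G, (v x - avg G v) ^ 2
      = (∫ x in G, v x ^ 2) - (∫ x in G, v x) ^ 2 / volume.real G := by
    have hexp : ∀ y, (v y - avg G v) ^ 2
        = 1 * v y ^ 2 + (-(2 * avg G v)) * v y + avg G v ^ 2 := fun y => by ring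
    simp only [hexp]
    rw [(integral_quadratic h.memLp _ _ _).2, measureReal_restrict_apply_univ]
    unfold avg
    field_simp
    ring
  rw [h1, le_div_iff₀ hG0]
  have h2 : ((∫ x in G, v x ^ 2) - (∫ x in G, v x) ^ 2 / volume.real G) * volume.real G
      = (∫ x in G, v x ^ 2) * volume.real G - (∫ x in G, v x) ^ 2 := by
    field_simp
  have h3 := sq_integral_le h.memLp
  rw [measureReal_restrict_apply_univ] at h3
  rw [h2]
  nlinarith

/-! ### Face connectivity of vertex patches -/

open Classical in
/-- The elements with vertex sets `s` and `t` share a face (of codimension one). -/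
def ShareFace (s t : Finset (Euc d)) : Prop := (s ∩ t).card = d

theorem ShareFace.symm {s t : Finset (Euc d)} (h : ShareFace s t) : ShareFace t s := by
  classical
  unfold ShareFace at *
  rw [Finset.inter_comm]
  exact h

theorem ShareFace.exists_insert {s t : Finset (Euc d)} (hs : IsSimplex s)
    (hst : ShareFace s t) : ∃ a, a ∈ s ∧ a ∉ t ∧ ∀ z ∈ s, z = a ∨ z ∈ t := by
  classical
  have hcard : (s ∩ t).card = d := by unfold ShareFace at hst; convert hst
  have h1 : (s \ t).card = 1 := by
    have := Finset.card_sdiff_add_card_inter s t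
    rw [hs.1] at this
    omega
  obtain ⟨a, ha⟩ := Finset.card_eq_one.1 h1
  have ha' : a ∈ s \ t := by rw [ha]; simp
  rw [Finset.mem_sdiff] at ha'
  refine ⟨a, ha'.1, ha'.2, fun z hz => ?_⟩
  by_cases hzt : z ∈ t
  · exact Or.inr hzt
  · left
    have : z ∈ s \ t := Finset.mem_sdiff.2 ⟨hz, hzt⟩
    rwa [ha, Finset.mem_singleton] at this

theorem affineSpan_ne_top {F : Finset (Euc d)} (hF : F.card ≤ d) :
    affineSpan ℝ (F : Set (Euc d)) ≠ ⊤ := by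
  classical
  intro htop
  rcases F.eq_empty_or_nonempty with rfl | hne
  · rw [Finset.coe_empty, AffineSubspace.span_empty] at htop
    exact bot_ne_top htop
  · obtain ⟨n, hn⟩ : ∃ n, F.card = n + 1 := ⟨F.card - 1, by
      have := Finset.card_pos.2 hne; omega⟩
    have h1 := finrank_vectorSpan_image_finset_le ℝ (id : Euc d → Euc d) F hn
    rw [Finset.image_id, ← direction_affineSpan, htop, AffineSubspace.direction_top, finrank_top,
      finrank_euclideanSpace_fin] at h1
    omega

/-- A point of an open set outside finitely many affine spans of at most `d` points each: these
spans are proper affine subspaces, hence null sets. -/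
theorem exists_generic {V : Set (Euc d)} (hV : IsOpen V) (hne : V.Nonempty)
    {ι : Type*} (I : Finset ι) (F : ι → Finset (Euc d)) (hF : ∀ i ∈ I, (F i).card ≤ d) :
    ∃ p ∈ V, ∀ i ∈ I, p ∉ affineSpan ℝ (F i : Set (Euc d)) := by
  by_contra! hcon
  have h1 : V ⊆ ⋃ i ∈ I, (affineSpan ℝ (F i : Set (Euc d)) : Set (Euc d)) := fun p hp => by
    obtain ⟨i, hi, hpi⟩ := hcon p hp
    exact mem_biUnion hi hpi
  have h2 : volume (⋃ i ∈ I, (affineSpan ℝ (F i : Set (Euc d)) : Set (Euc d))) = 0 :=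
    (measure_biUnion_null_iff I.countable_toSet).2 fun i hi =>
      Measure.addHaar_affineSubspace _ _ (affineSpan_ne_top (hF i hi))
  exact (hV.measure_pos volume hne).ne' (measure_mono_null h1 h2)

namespace Mesh

variable {Ω : Set (Euc d)} (T : Mesh Ω)

theorem isClosed_biUnion (A : Finset (Finset (Euc d))) :
    IsClosed (⋃ t ∈ A, convexHull ℝ (t : Set (Euc d))) :=
  A.finite_toSet.isClosed_biUnion fun t _ => (isCompact_convexHull t).isClosed

/-- A connected open set covered by two families of elements and met by both of them is crossed by
a face between the two families. Otherwise the families would only meet in sets of codimension two,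
which are avoided by a generic segment between two nearby points. -/
theorem exists_shareFace {U : Set (Euc d)} (hUo : IsOpen U) (hUc : IsPreconnected U)
    {A B : Finset (Finset (Euc d))} (hA : A ⊆ T.cells) (hB : B ⊆ T.cells) (hAB : Disjoint A B)
    (hcov : U ⊆ (⋃ t ∈ A, convexHull ℝ (t : Set (Euc d)))
      ∪ ⋃ t ∈ B, convexHull ℝ (t : Set (Euc d)))
    (hUA : (U ∩ ⋃ t ∈ A, convexHull ℝ (t : Set (Euc d))).Nonempty)
    (hUB : (U ∩ ⋃ t ∈ B, convexHull ℝ (t : Set (Euc d))).Nonempty) :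
    ∃ s ∈ A, ∃ t ∈ B, ShareFace s t := by
  classical
  by_contra! hcon
  have hcard : ∀ i ∈ A ×ˢ B, (i.1 ∩ i.2).card + 1 ≤ d := by
    rintro ⟨s, t⟩ hi
    obtain ⟨hs, ht⟩ := Finset.mem_product.1 hi
    have hst : s ≠ t := fun h => Finset.disjoint_left.1 hAB hs (h ▸ ht)
    have h1 : (s ∩ t).card ≠ d := fun h => hcon s hs t ht (by unfold ShareFace; convert h)
    have h2 : (s ∩ t).card < d + 1 := by
      rw [← (T.isSimplex s (hA hs)).1]
      refine Finset.card_lt_card (Finset.ssubset_iff_subset_ne.2 ⟨Finset.inter_subset_left, ?_⟩)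
      intro h
      obtain ⟨z, hz, hzt⟩ := T.exists_mem_notMem (hA hs) (hB ht) hst
      rw [← h] at hz
      exact hzt (Finset.mem_inter.1 hz).2
    simp only at *
    omega
  obtain ⟨x, hxU, hxA, hxB⟩ := isPreconnected_closed_iff.1 hUc _ _ (isClosed_biUnion A)
    (isClosed_biUnion B) hcov hUA hUB
  obtain ⟨r, hr, hrU⟩ := Metric.isOpen_iff.1 hUo x hxU
  have hmeet : ∀ t ∈ T.cells, x ∈ convexHull ℝ (t : Set (Euc d)) →
      (Metric.ball x r ∩ elem t).Nonempty := fun t ht hx => by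
    rw [← (T.isSimplex t ht).closure_elem] at hx
    exact mem_closure_iff.1 hx _ Metric.isOpen_ball (Metric.mem_ball_self hr)
  simp only [mem_iUnion] at hxA hxB
  obtain ⟨s₀, hs₀, hxs₀⟩ := hxA
  obtain ⟨t₀, ht₀, hxt₀⟩ := hxB
  -- `p` avoids the intersections themselves, and `q` the spans of `p` and an intersection: the
  -- segment from `p` to `q` would have to cross from one family to the other within such a span
  obtain ⟨p, hp, hpgen⟩ := exists_generic (Metric.isOpen_ball.inter (isOpen_elem s₀))
    (hmeet s₀ (hA hs₀) hxs₀) (A ×ˢ B) (fun i => i.1 ∩ i.2) fun i hi => by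
      have := hcard i hi; omega
  obtain ⟨q, hq, hqgen⟩ := exists_generic (Metric.isOpen_ball.inter (isOpen_elem t₀))
    (hmeet t₀ (hB ht₀) hxt₀) (A ×ˢ B) (fun i => insert p (i.1 ∩ i.2)) fun i hi =>
      (Finset.card_insert_le _ _).trans (hcard i hi)
  have hseg : segment ℝ p q ⊆ U := ((convex_ball x r).segment_subset hp.1 hq.1).trans hrU
  obtain ⟨w, hw, hwA, hwB⟩ := isPreconnected_closed_iff.1 (convex_segment p q).isPreconnected _ _
    (isClosed_biUnion A) (isClosed_biUnion B) (hseg.trans hcov)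
    ⟨p, left_mem_segment ℝ p q, mem_biUnion hs₀ (elem_subset s₀ hp.2)⟩
    ⟨q, right_mem_segment ℝ p q, mem_biUnion ht₀ (elem_subset t₀ hq.2)⟩
  simp only [mem_iUnion] at hwA hwB
  obtain ⟨s, hs, hws⟩ := hwA
  obtain ⟨t, ht, hwt⟩ := hwB
  have hst : (s, t) ∈ A ×ˢ B := Finset.mem_product.2 ⟨hs, ht⟩
  have hwst : w ∈ affineSpan ℝ ((s ∩ t : Finset (Euc d)) : Set (Euc d)) := by
    refine convexHull_subset_affineSpan _ ?_
    rw [Finset.coe_inter, ← T.regular s (hA hs) t (hB ht)]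
    exact ⟨hws, hwt⟩
  have hwp : w ≠ p := fun h => hpgen _ hst (h ▸ hwst)
  rw [segment_eq_image_lineMap] at hw
  obtain ⟨θ, -, rfl⟩ := hw
  have hθ : θ ≠ 0 := by
    rintro rfl
    exact hwp (AffineMap.lineMap_apply_zero p q)
  apply hqgen _ hst
  -- `q` lies on the line through `p` and the crossing point `w`
  have hq : q = AffineMap.lineMap p (AffineMap.lineMap p q θ) θ⁻¹ := by
    simp only [AffineMap.lineMap_apply_module', add_sub_cancel_right, smul_smul,
      inv_mul_cancel₀ hθ, one_smul, sub_add_cancel]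
  rw [hq]
  refine AffineMap.lineMap_mem _ (subset_affineSpan ℝ _ (by simp)) ?_
  exact affineSpan_mono ℝ (by simp) hwst

/-- Near a node, the closure of the domain is covered by the elements at the node, as the other
elements are closed sets that do not contain the node. -/
theorem exists_ball_subset_star {z : Euc d} (hz : z ∈ T.nodes) :
    ∃ ε > 0, Metric.ball z ε ∩ closure Ω ⊆ ⋃ t ∈ T.star z, convexHull ℝ (t : Set (Euc d)) := by
  classical
  have hcl : IsClosed (⋃ t ∈ T.cells.filter (z ∉ ·), convexHull ℝ (t : Set (Euc d))) :=
    isClosed_biUnion _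
  have hzn : z ∉ ⋃ t ∈ T.cells.filter (z ∉ ·), convexHull ℝ (t : Set (Euc d)) := by
    intro h
    simp only [mem_iUnion, Finset.mem_filter] at h
    obtain ⟨t, ⟨ht, hzt⟩, h⟩ := h
    exact hzt (T.mem_of_mem_convexHull hz ht h)
  obtain ⟨ε, hε, hball⟩ := Metric.isOpen_iff.1 hcl.isOpen_compl z hzn
  refine ⟨ε, hε, fun x hx => ?_⟩
  have h1 := hx.2
  rw [← T.cover] at h1
  simp only [mem_iUnion] at h1 ⊢
  obtain ⟨t, ht, hxt⟩ := h1
  refine ⟨t, T.mem_star.2 ⟨ht, ?_⟩, hxt⟩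
  by_contra hzt
  exact hball hx.1 (mem_biUnion (by simp [ht, hzt]) hxt)

theorem star_subset (z : Euc d) : T.star z ⊆ T.cells := fun _ ht => (T.mem_star.1 ht).1

theorem mem_nodes_of_mem {z : Euc d} {t : Finset (Euc d)} (ht : t ∈ T.cells) (hz : z ∈ t) :
    z ∈ T.nodes := T.mem_nodes.2 ⟨t, ht, hz⟩

/-- Vertex patches of a mesh of a Lipschitz domain are connected through faces. -/
theorem exists_shareFace_star (hΩ : IsBoundedLipschitz Ω) {z : Euc d}
    {A : Finset (Finset (Euc d))} (hA : A ⊆ T.star z) (hne : A.Nonempty) (hA' : A ≠ T.star z) :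
    ∃ s ∈ A, ∃ t ∈ T.star z, t ∉ A ∧ ShareFace s t := by
  classical
  obtain ⟨s₀, hs₀⟩ := hne
  obtain ⟨hs₀c, hzs₀⟩ := T.mem_star.1 (hA hs₀)
  have hz : z ∈ T.nodes := T.mem_nodes_of_mem hs₀c hzs₀
  obtain ⟨ε, hε, hball⟩ := T.exists_ball_subset_star hz
  have hzcl : z ∈ closure Ω := T.convexHull_subset_closure hs₀c (subset_hull hzs₀)
  obtain ⟨U, hUo, hUc, hUΩ, hUball, δ, hδ, hδU⟩ := hΩ.exists_preconnected hzcl hε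
  have hmeet : ∀ t ∈ T.star z, (U ∩ convexHull ℝ (t : Set (Euc d))).Nonempty := fun t ht => by
    obtain ⟨htc, hzt⟩ := T.mem_star.1 ht
    have h1 : z ∈ closure (elem t) := by
      rw [(T.isSimplex t htc).closure_elem]; exact subset_hull hzt
    obtain ⟨y, hy1, hy2⟩ := mem_closure_iff.1 h1 _ Metric.isOpen_ball (Metric.mem_ball_self hδ)
    exact ⟨y, hδU ⟨T.elem_subset_domain hΩ.interior_closure htc hy2, hy1⟩, elem_subset t hy2⟩
  obtain ⟨t₀, ht₀, ht₀A⟩ : ∃ t ∈ T.star z, t ∉ A := by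
    by_contra! hcon
    exact hA' (Finset.Subset.antisymm hA hcon)
  obtain ⟨s, hs, t, ht, hst⟩ := T.exists_shareFace hUo hUc (A := A) (B := T.star z \ A)
    (hA.trans (T.star_subset z)) (Finset.sdiff_subset.trans (T.star_subset z))
    Finset.disjoint_sdiff
    (fun x hx => by
      have h1 := hball ⟨hUball hx, subset_closure (hUΩ hx)⟩
      simp only [mem_iUnion] at h1
      obtain ⟨t, ht, hxt⟩ := h1
      by_cases htA : t ∈ A
      · exact Or.inl (mem_biUnion htA hxt)
      · exact Or.inr (mem_biUnion (Finset.mem_coe.2 (Finset.mem_sdiff.2 ⟨ht, htA⟩)) hxt))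
    ((hmeet s₀ (hA hs₀)).mono (inter_subset_inter_right _ (subset_biUnion_of_mem
      (u := fun t : Finset (Euc d) => convexHull ℝ (t : Set (Euc d))) hs₀)))
    ((hmeet t₀ ht₀).mono (inter_subset_inter_right _ (subset_biUnion_of_mem
      (u := fun t : Finset (Euc d) => convexHull ℝ (t : Set (Euc d)))
      (Finset.mem_coe.2 (Finset.mem_sdiff.2 ⟨ht₀, ht₀A⟩)))))
  obtain ⟨ht1, ht2⟩ := Finset.mem_sdiff.1 ht
  exact ⟨s, hs, t, ht1, ht2, hst⟩

/-- Induction along chains of face neighbours in a vertex patch; the length of the chain is bounded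
by the number of elements. -/
theorem star_induction (hΩ : IsBoundedLipschitz Ω) {z : Euc d} {s₀ : Finset (Euc d)}
    (hs₀ : s₀ ∈ T.star z) {Q : ℕ → Finset (Euc d) → Prop} (h0 : Q 0 s₀)
    (hmono : ∀ k, ∀ t ∈ T.star z, Q k t → Q (k + 1) t)
    (hstep : ∀ k, ∀ s ∈ T.star z, ∀ t ∈ T.star z, ShareFace s t → Q k s → Q (k + 1) t)
    {t : Finset (Euc d)} (ht : t ∈ T.star z) {N : ℕ} (hN : (T.star z).card ≤ N) : Q N t := by
  classical
  -- after `k` steps, at least `k + 1` elements are reached by chains of length at most `k`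
  have key : ∀ k, k < (T.star z).card → ∃ A ⊆ T.star z, A.card = k + 1 ∧ ∀ t ∈ A, Q k t := by
    intro k
    induction k with
    | zero =>
      intro _
      exact ⟨{s₀}, by simpa using hs₀, by simp, by simpa using h0⟩
    | succ k ih =>
      intro hk
      obtain ⟨A, hA, hcard, hQ⟩ := ih (by omega)
      obtain ⟨s, hs, t, ht, htA, hst⟩ := T.exists_shareFace_star hΩ hA
        (Finset.card_pos.1 (by omega)) (fun h => by rw [h] at hcard; omega)
      refine ⟨insert t A, Finset.insert_subset ht hA, ?_, ?_⟩
      · rw [Finset.card_insert_of_notMem htA, hcard]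
      · intro u hu
        rcases Finset.mem_insert.1 hu with rfl | hu
        · exact hstep k s (hA hs) _ ht hst (hQ s hs)
        · exact hmono k u (hA hu) (hQ u hu)
  have hpos : 0 < (T.star z).card := Finset.card_pos.2 ⟨t, ht⟩
  obtain ⟨A, hA, hcard, hQ⟩ := key ((T.star z).card - 1) (by omega)
  have hAeq : A = T.star z := Finset.eq_of_subset_of_card_le hA (by omega)
  have hlift : ∀ n, Q ((T.star z).card - 1) t → Q ((T.star z).card - 1 + n) t := by
    intro n h
    induction n with
    | zero => exact h
    | succ n ih => exact hmono _ t ht ih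
  have := hlift (N - ((T.star z).card - 1)) (hQ t (hAeq ▸ ht))
  rwa [Nat.add_sub_cancel' (by omega)] at this

/-- In a mesh with at least two elements, every element has a face neighbour. -/
theorem exists_neighbour (hΩ : IsBoundedLipschitz Ω) (hc : IsPreconnected Ω)
    {t : Finset (Euc d)} (ht : t ∈ T.cells) (hne : volume (elem t) ≠ volume Ω) :
    ∃ s ∈ T.cells, s ≠ t ∧ ShareFace t s := by
  classical
  have hmeet : ∀ t ∈ T.cells, (Ω ∩ convexHull ℝ (t : Set (Euc d))).Nonempty := fun t ht => by
    obtain ⟨y, hy⟩ := (T.isSimplex t ht).nonempty_elem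
    exact ⟨y, T.elem_subset_domain hΩ.interior_closure ht hy, elem_subset t hy⟩
  obtain ⟨s₀, hs₀⟩ : (T.cells.erase t).Nonempty := by
    by_contra hcon
    rw [Finset.not_nonempty_iff_eq_empty, Finset.erase_eq_empty_iff] at hcon
    have h1 : T.cells = {t} := hcon.resolve_left (Finset.ne_empty_of_mem ht)
    have h2 := measure_congr (T.domain_ae_eq hΩ.interior_closure)
    rw [h1] at h2
    simp only [Finset.mem_singleton, iUnion_iUnion_eq_left] at h2
    exact hne h2.symm
  obtain ⟨s, hs, u, hu, hsu⟩ := T.exists_shareFace hΩ.1 hc (A := {t}) (B := T.cells.erase t)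
    (by simpa using ht) (Finset.erase_subset _ _) (by simp)
    (fun x hx => by
      have h1 := subset_closure hx
      rw [← T.cover] at h1
      simp only [mem_iUnion] at h1
      obtain ⟨s, hs, hxs⟩ := h1
      by_cases hst : s = t
      · exact Or.inl (mem_biUnion (by simp [hst]) hxs)
      · exact Or.inr (mem_biUnion (by simp [hst, hs]) hxs))
    (by simpa using hmeet t ht)
    ((hmeet s₀ (Finset.mem_of_mem_erase hs₀)).mono (inter_subset_inter_right _
      (subset_biUnion_of_mem (u := fun t : Finset (Euc d) => convexHull ℝ (t : Set (Euc d)))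
      (Finset.mem_coe.2 hs₀))))
  rw [Finset.mem_singleton] at hs
  subst hs
  exact ⟨u, Finset.mem_of_mem_erase hu, Finset.ne_of_mem_erase hu, hsu⟩

/-! ### Consequences of shape regularity -/

/-- The number of elements at a vertex: scaled to the same diameter, all of them have comparable
volume and lie in a common ball around the vertex. -/
theorem ShapeRegular.card_star_le {T : Mesh Ω} (hd : 2 ≤ d) {κ : ℝ} (hκ : 0 ≤ κ)
    (h : T.ShapeRegular κ) (z : Euc d) : ((T.star z).card : ℝ) ≤ κ * ballVol d := by
  rcases (T.star z).eq_empty_or_nonempty with hemp | hne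
  · rw [hemp, Finset.card_empty, Nat.cast_zero]
    exact mul_nonneg hκ (ballVol_pos d).le
  -- the smallest diameter in the star, to which all elements are scaled with centre `z`
  obtain ⟨r, hr, hrle⟩ : ∃ r > 0, ∀ t ∈ T.star z, r ≤ Metric.diam (elem t) := by
    obtain ⟨t, ht, hmin⟩ := (T.star z).exists_min_image (fun t => Metric.diam (elem t)) hne
    exact ⟨_, (T.isSimplex t (T.star_subset z ht)).diam_pos hd, hmin⟩
  let A : Finset (Euc d) → Set (Euc d) := fun t =>
    AffineMap.homothety z (r / Metric.diam (elem t)) '' elem t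
  have hpos : ∀ t ∈ T.star z, 0 < Metric.diam (elem t) := fun t ht => hr.trans_le (hrle t ht)
  have hAo : ∀ t ∈ T.star z, IsOpen (A t) := fun t ht =>
    AffineMap.homothety_isOpenMap z _ (div_pos hr (hpos t ht)).ne' _ (isOpen_elem t)
  have hAe : ∀ t ∈ T.star z, A t ⊆ elem t := fun t ht => by
    refine interior_maximal ?_ (hAo t ht)
    exact shrink_image_subset (convex_convexHull ℝ _) (subset_hull (T.mem_star.1 ht).2)
      (elem_subset t) (div_pos hr (hpos t ht)).le ((div_le_one (hpos t ht)).2 (hrle t ht))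
  have hAb : ∀ t ∈ T.star z, A t ⊆ Metric.closedBall z r := by
    rintro t ht _ ⟨x, hx, rfl⟩
    have hx' := (T.isSimplex t (T.star_subset z ht)).norm_sub_le (elem_subset t hx)
      (subset_hull (T.mem_star.1 ht).2)
    rw [Metric.mem_closedBall, dist_eq_norm, AffineMap.homothety_apply, vsub_eq_sub, vadd_eq_add,
      add_sub_cancel_right, norm_smul, Real.norm_eq_abs, abs_of_pos (div_pos hr (hpos t ht))]
    calc r / Metric.diam (elem t) * ‖x - z‖
        ≤ r / Metric.diam (elem t) * Metric.diam (elem t) := by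
          have := hpos t ht
          gcongr
      _ = r := by have := (hpos t ht).ne'; field_simp
  have hAv : ∀ t ∈ T.star z, r ^ d ≤ κ * volume.real (A t) := fun t ht => by
    have h1 := h t (T.star_subset z ht)
    have h2 := hpos t ht
    simp only [A]
    rw [volume_homothety _ (by positivity), div_pow]
    calc r ^ d = r ^ d / Metric.diam (elem t) ^ d * Metric.diam (elem t) ^ d := by field_simp
      _ ≤ r ^ d / Metric.diam (elem t) ^ d * (κ * volume.real (elem t)) := by gcongr
      _ = _ := by ring
  have hsum : ∑ t ∈ T.star z, volume.real (A t) ≤ r ^ d * ballVol d := by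
    rw [← volume_closedBall z hr.le, ← measureReal_biUnion_finset
      (fun s hs t ht hst => (T.pairwiseDisjoint_elem (T.star_subset z hs) (T.star_subset z ht)
        hst).mono (hAe s hs) (hAe t ht)) (fun t ht => (hAo t ht).measurableSet)
      (fun t ht => ((measure_mono (hAe t ht)).trans_lt (volume_elem_ne_top t).lt_top).ne)]
    exact measureReal_mono (iUnion₂_subset hAb) measure_closedBall_lt_top.ne
  have h3 : ((T.star z).card : ℝ) * r ^ d ≤ κ * (r ^ d * ballVol d) := by
    calc ((T.star z).card : ℝ) * r ^ d = ∑ t ∈ T.star z, r ^ d := by simp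
      _ ≤ ∑ t ∈ T.star z, κ * volume.real (A t) := Finset.sum_le_sum hAv
      _ = κ * ∑ t ∈ T.star z, volume.real (A t) := by rw [Finset.mul_sum]
      _ ≤ _ := by gcongr
  have hrd : 0 < r ^ d := by positivity
  nlinarith

/-- The constant in the bound of the gradients of barycentric coordinates by the inverse
diameter. -/
def gradConst (d : ℕ) (κ : ℝ) : ℝ := max 1 (3 ^ d * ballVol d * κ)

theorem one_le_gradConst (d : ℕ) (κ : ℝ) : 1 ≤ gradConst d κ := le_max_left _ _

theorem ShapeRegular.norm_baryGrad_mul_le {T : Mesh Ω} (hd : 2 ≤ d) {κ : ℝ}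
    (h : T.ShapeRegular κ) {t : Finset (Euc d)} (ht : t ∈ T.cells) (z : Euc d) :
    ‖baryGrad t z‖ * Metric.diam (elem t) ≤ gradConst d κ := by
  have hs := T.isSimplex t ht
  have h1 := hs.norm_baryGrad_mul_diam_mul_volume_le hd z
  have h2 := h t ht
  have h3 := hs.volume_pos
  have h4 := ballVol_pos d
  refine le_trans ?_ (le_max_right _ _)
  refine le_of_mul_le_mul_right ?_ h3
  calc _ ≤ (3 * Metric.diam (elem t)) ^ d * ballVol d := h1
    _ = 3 ^ d * ballVol d * Metric.diam (elem t) ^ d := by ring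
    _ ≤ 3 ^ d * ballVol d * (κ * volume.real (elem t)) := by gcongr
    _ = _ := by ring

theorem ShapeRegular.norm_baryGrad_le {T : Mesh Ω} (hd : 2 ≤ d) {κ : ℝ}
    (h : T.ShapeRegular κ) {t : Finset (Euc d)} (ht : t ∈ T.cells) (z : Euc d) :
    ‖baryGrad t z‖ ≤ gradConst d κ / Metric.diam (elem t) := by
  rw [le_div_iff₀ ((T.isSimplex t ht).diam_pos hd)]
  exact h.norm_baryGrad_mul_le hd ht z

/-- Face neighbours have an edge in common, hence comparable diameters. -/
theorem ShapeRegular.diam_le {T : Mesh Ω} (hd : 2 ≤ d) {κ : ℝ} (h : T.ShapeRegular κ)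
    {s t : Finset (Euc d)} (hs : s ∈ T.cells) (ht : t ∈ T.cells) (hst : ShareFace s t) :
    Metric.diam (elem s) ≤ gradConst d κ * Metric.diam (elem t) := by
  classical
  have hcard : 1 < (s ∩ t).card := by
    have : (s ∩ t).card = d := by unfold ShareFace at hst; convert hst
    omega
  obtain ⟨a, ha, b, hb, hab⟩ := Finset.one_lt_card.1 hcard
  rw [Finset.mem_inter] at ha hb
  have h1 := (T.isSimplex s hs).one_le_norm_baryGrad_mul ha.1 hb.1 hab
  have h2 := (T.isSimplex t ht).norm_sub_le (subset_hull ha.2) (subset_hull hb.2)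
  have h3 := h.norm_baryGrad_mul_le hd hs a
  have h4 := (T.isSimplex s hs).diam_pos hd
  calc Metric.diam (elem s) = 1 * Metric.diam (elem s) := (one_mul _).symm
    _ ≤ (‖baryGrad s a‖ * ‖a - b‖) * Metric.diam (elem s) := by gcongr
    _ = (‖baryGrad s a‖ * Metric.diam (elem s)) * ‖a - b‖ := by ring
    _ ≤ gradConst d κ * Metric.diam (elem t) := by
      have := one_le_gradConst d κ
      gcongr

/-- A ball around the centroid of an interior face, small in relation to the two adjacent elements,
is contained in their union: the two barycentric coordinates that vanish on the face have opposite
signs, since the elements cannot lie on the same side of the face. -/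
theorem ball_center_subset {s t : Finset (Euc d)} (hd : 2 ≤ d) (hs : s ∈ T.cells)
    (ht : t ∈ T.cells) {F : Finset (Euc d)} (hFs : F ⊆ s) (hFt : F ⊆ t) (hF : F.card = d)
    (hFst : ∀ z, z ∈ s → z ∈ t → z ∈ F) {δ : ℝ} (hδ : 0 < δ)
    (hgs : ∀ z, ‖baryGrad s z‖ * δ < 1 / d) (hgt : ∀ z, ‖baryGrad t z‖ * δ < 1 / d) :
    Metric.ball (center F) δ ⊆ convexHull ℝ (s : Set (Euc d)) ∪ convexHull ℝ (t : Set (Euc d)) := by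
  classical
  have hSs := T.isSimplex s hs
  have hSt := T.isSimplex t ht
  have hFne : F.Nonempty := Finset.card_pos.1 (by omega)
  have hFeq : s ∩ t = F := Finset.Subset.antisymm
    (fun z hz => hFst z (Finset.mem_inter.1 hz).1 (Finset.mem_inter.1 hz).2)
    (Finset.subset_inter hFs hFt)
  have hface : ShareFace s t := by
    have h1 : (s ∩ t).card = d := hFeq ▸ hF
    unfold ShareFace
    convert h1
  obtain ⟨a, has, hat, ha⟩ := hface.exists_insert hSs
  obtain ⟨b, hbt, hbs, hb⟩ := hface.symm.exists_insert hSt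
  set m := center F with hm
  have hpos : ∀ u, IsSimplex u → F ⊆ u → (∀ z, ‖baryGrad u z‖ * δ < 1 / d) →
      ∀ z ∈ F, ∀ x ∈ Metric.ball m δ, 0 < bary u z x := by
    intro u hu hFu hgu z hz x hx
    rw [bary_eq_add u z x m, hm, hu.bary_center hFne hFu hz, ← hm, hF]
    have h1 : |⟪baryGrad u z, x - m⟫_ℝ| ≤ ‖baryGrad u z‖ * δ := by
      refine (abs_real_inner_le_norm _ _).trans ?_
      gcongr
      rw [← dist_eq_norm]
      exact (Metric.mem_ball.1 hx).le
    have h2 := hgu z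
    rw [abs_le] at h1
    rw [one_div] at h2
    linarith [h1.1]
  have haF : a ∉ F := fun h => hat (hFt h)
  have hm_a : bary s a m = 0 :=
    bary_eq_zero_of_mem_convexHull (F := (F : Set (Euc d))) (by exact_mod_cast hFs)
      (by exact_mod_cast haF) (center_mem hFne)
  -- the barycentric coordinate of `b` in `t` is a multiple of the one of `a` in `s`
  have hrel : ∀ x, bary t b x = bary s a x * bary t b a := by
    intro x
    obtain ⟨c, g, h1⟩ : ∃ c g, ∀ y, bary t b y = c + ⟪g, y⟫_ℝ :=
      ⟨bary t b 0, baryGrad t b, fun y => by rw [bary_eq_add t b y 0, sub_zero]⟩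
    have h2 : bary t b x = ∑ z ∈ s, bary s z x * bary t b z := by
      simp only [h1, mul_add, Finset.sum_add_distrib, ← Finset.sum_mul, hSs.sum_bary x, one_mul,
        ← inner_smul_right, ← inner_sum, hSs.sum_bary_smul x]
    rw [h2]
    refine Finset.sum_eq_single_of_mem a has fun z hz hza => ?_
    have hzt := (ha z hz).resolve_left hza
    rw [bary_ne hzt (fun h : b = z => hbs (h ▸ hz)), mul_zero]
  have hneg : bary t b a ≤ 0 := by
    by_contra hcon
    rw [not_le] at hcon
    -- a point slightly off the centroid of the face would belong to both elements
    obtain ⟨θ, hθ0, hθ1, hθ⟩ : ∃ θ : ℝ, 0 < θ ∧ θ ≤ 1 ∧ θ * ‖a - m‖ < δ := by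
      refine ⟨min 1 (δ / (2 * (‖a - m‖ + 1))), lt_min one_pos (by positivity), min_le_left _ _, ?_⟩
      have h0 : 0 < ‖a - m‖ + 1 := by positivity
      calc min 1 (δ / (2 * (‖a - m‖ + 1))) * ‖a - m‖
          ≤ (δ / (2 * (‖a - m‖ + 1))) * (‖a - m‖ + 1) := by
            gcongr
            · exact min_le_right _ _
            · linarith
        _ = δ / 2 := by field_simp
        _ < δ := by linarith
    set x := AffineMap.lineMap m a θ with hx
    have hxb : x ∈ Metric.ball m δ := by
      rw [Metric.mem_ball, dist_eq_norm, hx, AffineMap.lineMap_apply_module', add_sub_cancel_right,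
        norm_smul, Real.norm_eq_abs, abs_of_pos hθ0]
      exact hθ
    have hxa : bary s a x = θ := by
      rw [hx, bary_lineMap, hm_a, hSs.bary_self has]; ring
    have hxs : x ∈ elem s := hSs.mem_elem.2 fun z hz => by
      rcases ha z hz with rfl | hzt
      · rw [hxa]; exact hθ0
      · exact hpos s hSs hFs hgs z (hFst z hz hzt) x hxb
    have hxt : x ∈ convexHull ℝ (t : Set (Euc d)) := hSt.mem_convexHull.2 fun z hz => by
      rcases hb z hz with rfl | hzs
      · rw [hrel, hxa]; positivity
      · exact (hpos t hSt hFt hgt z (hFst z hzs hz) x hxb).le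
    exact T.notMem_convexHull hs ht (fun h => hat (h ▸ has)) hxs hxt
  intro x hx
  by_cases hxa : 0 ≤ bary s a x
  · left
    refine hSs.mem_convexHull.2 fun z hz => ?_
    rcases ha z hz with rfl | hzt
    · exact hxa
    · exact (hpos s hSs hFs hgs z (hFst z hz hzt) x hx).le
  · right
    refine hSt.mem_convexHull.2 fun z hz => ?_
    rcases hb z hz with rfl | hzs
    · rw [hrel]
      exact mul_nonneg_of_nonpos_of_nonpos (not_le.1 hxa).le hneg
    · exact (hpos t hSt hFt hgt z (hFst z hzs hz) x hx).le

end Mesh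

namespace Mesh

variable {Ω : Set (Euc d)} (T : Mesh Ω)

/-! ### Averages over neighbouring elements -/

/-- The square of `diam(T) |T|^{-1/2}`, the scaling factor between the `L²(T)` norm of a gradient
and the oscillation of averages. -/
def scale (t : Finset (Euc d)) : ℝ := Metric.diam (elem t) ^ 2 / volume.real (elem t)

/-- The Dirichlet energy on an element. -/
def energy (g : Euc d → Euc d) (t : Finset (Euc d)) : ℝ := ∫ x in elem t, ‖g x‖ ^ 2

theorem energy_nonneg (g : Euc d → Euc d) (t : Finset (Euc d)) : 0 ≤ energy g t :=
  integral_nonneg fun _ => sq_nonneg _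

theorem scale_nonneg (t : Finset (Euc d)) : 0 ≤ scale t :=
  div_nonneg (sq_nonneg _) measureReal_nonneg

theorem isBounded_elem (t : Finset (Euc d)) : Bornology.IsBounded (elem t) :=
  (isBounded_convexHull t).subset (elem_subset t)

/-- The mean value over an element against that over a part of it with a fixed fraction `c` of the
volume. -/
theorem ShapeRegular.sq_avg_sub_avg_le {T : Mesh Ω} (hI : interior (closure Ω) = Ω) {κ : ℝ}
    (hκ : 0 ≤ κ) (h : T.ShapeRegular κ) {t : Finset (Euc d)} (ht : t ∈ T.cells) {v : Euc d → ℝ}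
    {g : Euc d → Euc d} (hv : HasWeakGrad Ω v g) {A : Set (Euc d)} (hA : A ⊆ elem t) {c : ℝ}
    (hc : 0 < c) (hAc : c * volume.real (elem t) ≤ volume.real A) :
    (avg (elem t) v - avg A v) ^ 2 ≤ ballVol d * κ / c * (scale t * energy g t) := by
  have hpos := (T.isSimplex t ht).volume_pos
  have hApos : 0 < volume.real A := (by positivity : 0 < c * volume.real (elem t)).trans_le hAc
  have h1 := (hv.mono (T.elem_subset_domain hI ht)).sq_avg_sub_avg_le (convex_elem t)
    (isOpen_elem t) (isBounded_elem t) subset_rfl hA hpos hApos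
  refine h1.trans ?_
  have h2 := h t ht
  have h3 := energy_nonneg g t
  have h4 := ballVol_pos d
  change ballVol d * Metric.diam (elem t) ^ (d + 2) * energy g t / _ ≤ _
  unfold scale
  calc ballVol d * Metric.diam (elem t) ^ (d + 2) * energy g t
        / (volume.real (elem t) * volume.real A)
      = ballVol d * (Metric.diam (elem t) ^ d * Metric.diam (elem t) ^ 2) * energy g t
        / (volume.real (elem t) * volume.real A) := by rw [pow_add]
    _ ≤ ballVol d * ((κ * volume.real (elem t)) * Metric.diam (elem t) ^ 2) * energy g t
        / (volume.real (elem t) * (c * volume.real (elem t))) := by gcongr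
    _ = _ := by field_simp

theorem ShapeRegular.integral_sq_sub_avg_le {T : Mesh Ω} (hI : interior (closure Ω) = Ω) {κ : ℝ}
    (h : T.ShapeRegular κ) {t : Finset (Euc d)} (ht : t ∈ T.cells) {v : Euc d → ℝ}
    {g : Euc d → Euc d} (hv : HasWeakGrad Ω v g) :
    ∫ x in elem t, (v x - avg (elem t) v) ^ 2
      ≤ ballVol d * κ * (Metric.diam (elem t) ^ 2 * energy g t) := by
  have hpos := (T.isSimplex t ht).volume_pos
  have h1 := (hv.mono (T.elem_subset_domain hI ht)).integral_sq_sub_avg_le (convex_elem t)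
    (isOpen_elem t) (isBounded_elem t) hpos
  refine h1.trans ?_
  have h2 := h t ht
  have h3 := energy_nonneg g t
  have h4 := ballVol_pos d
  change ballVol d * Metric.diam (elem t) ^ (d + 2) * energy g t / _ ≤ _
  calc ballVol d * Metric.diam (elem t) ^ (d + 2) * energy g t / volume.real (elem t)
      = ballVol d * (Metric.diam (elem t) ^ d * Metric.diam (elem t) ^ 2) * energy g t
        / volume.real (elem t) := by rw [pow_add]
    _ ≤ ballVol d * ((κ * volume.real (elem t)) * Metric.diam (elem t) ^ 2) * energy g t
        / volume.real (elem t) := by gcongr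
    _ = _ := by field_simp

/-- Elements of comparable diameters have comparable scaling factors. -/
theorem ShapeRegular.scale_le {T : Mesh Ω} (hd : 2 ≤ d) {κ : ℝ} (h : T.ShapeRegular κ)
    {s t : Finset (Euc d)} (hs : s ∈ T.cells) (ht : t ∈ T.cells) {C : ℝ} (hC : 1 ≤ C)
    (hts : Metric.diam (elem t) ≤ C * Metric.diam (elem s)) :
    scale s ≤ C ^ d * ballVol d * κ * scale t := by
  have hs0 := (T.isSimplex s hs).volume_pos
  have ht0 := (T.isSimplex t ht).volume_pos
  have h1 := h s hs
  have h2 := (T.isSimplex t ht).volume_le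
  have h4 := ballVol_pos d
  have h5 := (T.isSimplex s hs).diam_pos hd
  have h6 := (T.isSimplex t ht).diam_pos hd
  unfold scale
  rw [← mul_div_assoc, div_le_div_iff₀ hs0 ht0]
  obtain ⟨n, rfl⟩ : ∃ n, d = n + 2 := ⟨d - 2, by omega⟩
  calc Metric.diam (elem s) ^ 2 * volume.real (elem t)
      ≤ Metric.diam (elem s) ^ 2 * (Metric.diam (elem t) ^ (n + 2) * ballVol (n + 2)) := by gcongr
    _ = Metric.diam (elem s) ^ 2 * (Metric.diam (elem t) ^ n * Metric.diam (elem t) ^ 2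
        * ballVol (n + 2)) := by rw [pow_add]
    _ ≤ Metric.diam (elem s) ^ 2 * ((C * Metric.diam (elem s)) ^ n * Metric.diam (elem t) ^ 2
        * ballVol (n + 2)) := by gcongr
    _ = C ^ n * ballVol (n + 2) * Metric.diam (elem t) ^ 2 * Metric.diam (elem s) ^ (n + 2) := by
        ring
    _ ≤ C ^ (n + 2) * ballVol (n + 2) * Metric.diam (elem t) ^ 2
        * (κ * volume.real (elem s)) := by
        gcongr
        omega
    _ = _ := by ring

theorem homothety_image_subset_ball {t : Finset (Euc d)} (ht : IsSimplex t) {m : Euc d}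
    (hm : m ∈ convexHull ℝ (t : Set (Euc d))) {θ δ : ℝ} (hθ : 0 ≤ θ)
    (hδ : θ * Metric.diam (elem t) < δ) :
    AffineMap.homothety m θ '' elem t ⊆ Metric.ball m δ := by
  rintro _ ⟨x, hx, rfl⟩
  rw [Metric.mem_ball, dist_eq_norm, AffineMap.homothety_apply, vsub_eq_sub, vadd_eq_add,
    add_sub_cancel_right, norm_smul, Real.norm_eq_abs, abs_of_nonneg hθ]
  refine lt_of_le_of_lt ?_ hδ
  gcongr
  exact ht.norm_sub_le (elem_subset t hx) hm

theorem homothety_image_subset_elem {t : Finset (Euc d)} {m : Euc d}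
    (hm : m ∈ convexHull ℝ (t : Set (Euc d))) {θ : ℝ} (hθ : 0 < θ) (hθ1 : θ ≤ 1) :
    AffineMap.homothety m θ '' elem t ⊆ elem t :=
  interior_maximal (shrink_image_subset (convex_convexHull ℝ _) hm (elem_subset t) hθ.le hθ1)
    (AffineMap.homothety_isOpenMap m θ hθ.ne' _ (isOpen_elem t))

theorem setIntegral_le_energy_add {U : Set (Euc d)} {s t : Finset (Euc d)} {g : Euc d → Euc d}
    (hU : U ⊆ convexHull ℝ (s : Set (Euc d)) ∪ convexHull ℝ (t : Set (Euc d)))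
    (hs : IntegrableOn (fun x => ‖g x‖ ^ 2) (elem s))
    (ht : IntegrableOn (fun x => ‖g x‖ ^ 2) (elem t)) :
    ∫ x in U, ‖g x‖ ^ 2 ≤ energy g s + energy g t := by
  have hs' : IntegrableOn (fun x => ‖g x‖ ^ 2) (convexHull ℝ (s : Set (Euc d))) :=
    hs.congr_set_ae (elem_ae_eq s).symm
  have ht' : IntegrableOn (fun x => ‖g x‖ ^ 2) (convexHull ℝ (t : Set (Euc d))) :=
    ht.congr_set_ae (elem_ae_eq t).symm
  have hnn : ∀ V : Set (Euc d), 0 ≤ᵐ[volume.restrict V] fun x => ‖g x‖ ^ 2 := fun V =>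
    Filter.Eventually.of_forall fun x => sq_nonneg _
  calc ∫ x in U, ‖g x‖ ^ 2
      ≤ ∫ x in convexHull ℝ (s : Set (Euc d)) ∪ convexHull ℝ (t : Set (Euc d)), ‖g x‖ ^ 2 :=
        setIntegral_mono_set (hs'.union ht') (hnn _) hU.eventuallyLE
    _ ≤ (∫ x in convexHull ℝ (s : Set (Euc d)), ‖g x‖ ^ 2)
        + ∫ x in convexHull ℝ (t : Set (Euc d)), ‖g x‖ ^ 2 := by
        rw [← integral_add_measure hs' ht']
        exact integral_mono_measure (Measure.restrict_union_le _ _)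
          (Filter.Eventually.of_forall fun x => sq_nonneg _)
          ((show Integrable _ _ from hs').add_measure ht')
    _ = _ := by
        rw [setIntegral_congr_set (elem_ae_eq s).symm, setIntegral_congr_set (elem_ae_eq t).symm]
        rfl

set_option maxHeartbeats 1000000 in
/-- Averages over two elements with a common face: both are compared with averages over small copies
of the elements, which lie in a common ball around the centroid of the face. -/
theorem exists_const_shareFace (hd : 2 ≤ d) {κ : ℝ} (hκ : 0 ≤ κ) :
    ∃ C : ℝ, 1 ≤ C ∧ ∀ {Ω : Set (Euc d)} (_ : IsBoundedLipschitz Ω) (T : Mesh Ω),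
      T.ShapeRegular κ → ∀ s ∈ T.cells, ∀ t ∈ T.cells, ShareFace s t →
        Metric.diam (elem s) ≤ C * Metric.diam (elem t) ∧ scale s ≤ C * scale t ∧
        ∀ {v : Euc d → ℝ} {g : Euc d → Euc d}, HasWeakGrad Ω v g →
          (avg (elem s) v - avg (elem t) v) ^ 2
            ≤ C * scale s * (energy g s + energy g t) := by
  classical
  have hω := ballVol_pos d
  set C₁ := gradConst d κ with hC₁
  have hC₁1 : 1 ≤ C₁ := one_le_gradConst d κ
  have hd0 : (0 : ℝ) < d := by
    have : 0 < d := by omega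
    exact_mod_cast this
  set K := C₁ ^ d * ballVol d * κ with hK
  have hK0 : 0 ≤ K := by positivity
  -- the ratio of the copies; small enough for them to lie in the ball of radius `δ` below
  set θ : ℝ := 1 / (4 * d * C₁ ^ 3) with hθ
  have hθ0 : 0 < θ := by positivity
  have hθ1 : θ ≤ 1 := by
    rw [hθ, div_le_one (by positivity)]
    have h1 : 1 ≤ C₁ ^ 3 := one_le_pow₀ hC₁1
    have h2 : (2 : ℝ) ≤ d := by exact_mod_cast hd
    nlinarith
  -- `M` compares an element with its copy, `M'` the two copies within the ball; `K` converts
  -- scaling factors from one element to the other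
  set M := ballVol d * κ / θ ^ d with hM
  have hM0 : 0 ≤ M := by positivity
  set M' := ballVol d * κ * C₁ ^ d / (θ ^ d * θ ^ d) with hM'
  have hM'0 : 0 ≤ M' := by positivity
  refine ⟨1 + C₁ + K + 3 * (M + M' + M * K), by nlinarith [mul_nonneg hM0 hK0], ?_⟩
  have hCC₁ : C₁ ≤ 1 + C₁ + K + 3 * (M + M' + M * K) := by nlinarith [mul_nonneg hM0 hK0]
  have hCK : K ≤ 1 + C₁ + K + 3 * (M + M' + M * K) := by nlinarith [mul_nonneg hM0 hK0]
  intro Ω hΩ T h s hs t ht hst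
  have hI := hΩ.interior_closure
  have hSs := T.isSimplex s hs
  have hSt := T.isSimplex t ht
  have hsd := hSs.diam_pos hd
  have htd := hSt.diam_pos hd
  have hsv := hSs.volume_pos
  have htv := hSt.volume_pos
  have hst1 := h.diam_le hd hs ht hst
  have hts1 := h.diam_le hd ht hs hst.symm
  have hsc : scale t ≤ K * scale s := h.scale_le hd ht hs hC₁1 hst1
  refine ⟨hst1.trans (by gcongr), (h.scale_le hd hs ht hC₁1 hts1).trans
    (mul_le_mul_of_nonneg_right hCK (scale_nonneg t)), ?_⟩
  intro v g hv
  set F := s ∩ t with hF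
  have hFc : F.card = d := by unfold ShareFace at hst; convert hst
  have hFne : F.Nonempty := Finset.card_pos.1 (by omega)
  set m := center F with hm
  have hms : m ∈ convexHull ℝ (s : Set (Euc d)) :=
    convexHull_mono (by exact_mod_cast Finset.inter_subset_left) (center_mem hFne)
  have hmt : m ∈ convexHull ℝ (t : Set (Euc d)) :=
    convexHull_mono (by exact_mod_cast Finset.inter_subset_right) (center_mem hFne)
  -- with this radius, the barycentric coordinates of the vertices of the face, which are `1 / d` at
  -- its centroid, stay positive in the ball for both elements
  set δ := Metric.diam (elem s) / (2 * d * C₁ ^ 2) with hδ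
  have hδ0 : 0 < δ := by positivity
  have hgs : ∀ z, ‖baryGrad s z‖ * δ < 1 / d := fun z => by
    have h1 := h.norm_baryGrad_mul_le hd hs z
    calc ‖baryGrad s z‖ * δ = ‖baryGrad s z‖ * Metric.diam (elem s) / (2 * d * C₁ ^ 2) := by
          rw [hδ]; ring
      _ ≤ C₁ / (2 * d * C₁ ^ 2) := by gcongr
      _ = 1 / d * (1 / (2 * C₁)) := by field_simp
      _ < 1 / d * 1 := by
          gcongr
          rw [div_lt_one (by positivity)]
          linarith
      _ = 1 / d := mul_one _
  have hgt : ∀ z, ‖baryGrad t z‖ * δ < 1 / d := fun z => by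
    have h1 := h.norm_baryGrad_mul_le hd ht z
    calc ‖baryGrad t z‖ * δ = ‖baryGrad t z‖ * Metric.diam (elem s) / (2 * d * C₁ ^ 2) := by
          rw [hδ]; ring
      _ ≤ ‖baryGrad t z‖ * (C₁ * Metric.diam (elem t)) / (2 * d * C₁ ^ 2) := by gcongr
      _ = ‖baryGrad t z‖ * Metric.diam (elem t) * C₁ / (2 * d * C₁ ^ 2) := by ring
      _ ≤ C₁ * C₁ / (2 * d * C₁ ^ 2) := by gcongr
      _ = 1 / d * (1 / 2) := by field_simp
      _ < 1 / d * 1 := by gcongr; norm_num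
      _ = 1 / d := mul_one _
  have hball := T.ball_center_subset hd hs ht (F := F) Finset.inter_subset_left
    Finset.inter_subset_right hFc (fun z h1 h2 => Finset.mem_inter.2 ⟨h1, h2⟩) hδ0 hgs hgt
  have hballΩ : Metric.ball m δ ⊆ Ω := by
    refine (interior_maximal (hball.trans (union_subset ?_ ?_)) Metric.isOpen_ball).trans hI.subset
    · exact T.convexHull_subset_closure hs
    · exact T.convexHull_subset_closure ht
  set A := AffineMap.homothety m θ '' elem s with hA
  set B := AffineMap.homothety m θ '' elem t with hB
  have hθδ : θ * (C₁ * Metric.diam (elem s)) < δ := by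
    rw [hθ, hδ]
    calc 1 / (4 * d * C₁ ^ 3) * (C₁ * Metric.diam (elem s))
        = Metric.diam (elem s) / (2 * d * C₁ ^ 2) * (1 / 2) := by field_simp; norm_num
      _ < Metric.diam (elem s) / (2 * d * C₁ ^ 2) * 1 := by gcongr; norm_num
      _ = _ := mul_one _
  have hAball : A ⊆ Metric.ball m δ := homothety_image_subset_ball hSs hms hθ0.le
    (lt_of_le_of_lt (by nlinarith [mul_pos hθ0 hsd]) hθδ)
  have hBball : B ⊆ Metric.ball m δ := homothety_image_subset_ball hSt hmt hθ0.le
    (lt_of_le_of_lt (by gcongr) hθδ)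
  have hAv : volume.real A = θ ^ d * volume.real (elem s) := volume_homothety _ hθ0.le _
  have hBv : volume.real B = θ ^ d * volume.real (elem t) := volume_homothety _ hθ0.le _
  have hθd : 0 < θ ^ d := by positivity
  have e1 := h.sq_avg_sub_avg_le hI hκ hs hv (homothety_image_subset_elem hms hθ0 hθ1) hθd hAv.ge
  have e3 := h.sq_avg_sub_avg_le hI hκ ht hv (homothety_image_subset_elem hmt hθ0 hθ1) hθd hBv.ge
  have e2 := (hv.mono hballΩ).sq_avg_sub_avg_le (convex_ball m δ) Metric.isOpen_ball
    Metric.isBounded_ball hAball hBball (by rw [hAv]; positivity) (by rw [hBv]; positivity)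
  have hes := energy_nonneg g s
  have het := energy_nonneg g t
  have hss := scale_nonneg s
  have e2' : (avg A v - avg B v) ^ 2 ≤ M' * (scale s * (energy g s + energy g t)) := by
    refine e2.trans ?_
    have hdiam : Metric.diam (Metric.ball m δ) ≤ Metric.diam (elem s) := by
      refine (Metric.diam_ball hδ0.le).trans ?_
      have h1 : 1 ≤ d * C₁ ^ 2 := one_le_mul_of_one_le_of_one_le
        (by exact_mod_cast (by omega : 1 ≤ d)) (one_le_pow₀ hC₁1)
      calc 2 * δ = Metric.diam (elem s) / (d * C₁ ^ 2) := by rw [hδ]; field_simp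
        _ ≤ Metric.diam (elem s) := div_le_self hsd.le h1
    have hint : ∫ x in Metric.ball m δ, ‖g x‖ ^ 2 ≤ energy g s + energy g t :=
      setIntegral_le_energy_add hball
        (hv.mono (T.elem_subset_domain hI hs)).memLp_grad.norm.integrable_sq
        (hv.mono (T.elem_subset_domain hI ht)).memLp_grad.norm.integrable_sq
    have hht := h t ht
    rw [hAv, hBv]
    calc ballVol d * Metric.diam (Metric.ball m δ) ^ (d + 2) * (∫ x in Metric.ball m δ, ‖g x‖ ^ 2)
          / (θ ^ d * volume.real (elem s) * (θ ^ d * volume.real (elem t)))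
        ≤ ballVol d * Metric.diam (elem s) ^ (d + 2) * (energy g s + energy g t)
          / (θ ^ d * volume.real (elem s) * (θ ^ d * volume.real (elem t))) := by
          gcongr
      _ = ballVol d * (Metric.diam (elem s) ^ d * Metric.diam (elem s) ^ 2)
          * (energy g s + energy g t)
          / (θ ^ d * volume.real (elem s) * (θ ^ d * volume.real (elem t))) := by rw [pow_add]
      _ ≤ ballVol d * ((C₁ * Metric.diam (elem t)) ^ d * Metric.diam (elem s) ^ 2)
          * (energy g s + energy g t)
          / (θ ^ d * volume.real (elem s) * (θ ^ d * volume.real (elem t))) := by gcongr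
      _ = ballVol d * (C₁ ^ d * Metric.diam (elem t) ^ d * Metric.diam (elem s) ^ 2)
          * (energy g s + energy g t)
          / (θ ^ d * volume.real (elem s) * (θ ^ d * volume.real (elem t))) := by rw [mul_pow]
      _ ≤ ballVol d * (C₁ ^ d * (κ * volume.real (elem t)) * Metric.diam (elem s) ^ 2)
          * (energy g s + energy g t)
          / (θ ^ d * volume.real (elem s) * (θ ^ d * volume.real (elem t))) := by gcongr
      _ = _ := by rw [hM', scale]; field_simp
  have e3' : M * (scale t * energy g t) ≤ M * K * (scale s * energy g t) := by
    calc M * (scale t * energy g t) ≤ M * ((K * scale s) * energy g t) := by gcongr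
      _ = _ := by ring
  -- the chain `S`, copy of `S`, copy of `T`, `T`
  have hsum : (avg (elem s) v - avg (elem t) v) ^ 2 ≤ 3 * ((avg (elem s) v - avg A v) ^ 2
      + (avg A v - avg B v) ^ 2 + (avg (elem t) v - avg B v) ^ 2) := by
    have hz : avg (elem s) v - avg (elem t) v = (avg (elem s) v - avg A v)
      + (avg A v - avg B v) - (avg (elem t) v - avg B v) := by ring
    rw [hz]
    generalize avg (elem s) v - avg A v = x
    generalize avg A v - avg B v = y
    generalize avg (elem t) v - avg B v = w
    nlinarith [sq_nonneg (x - y), sq_nonneg (x + w), sq_nonneg (y + w)]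
  set X := scale s * energy g s with hX
  set Y := scale s * energy g t with hY
  have hX0 : 0 ≤ X := by positivity
  have hY0 : 0 ≤ Y := by positivity
  have hsplit : scale s * (energy g s + energy g t) = X + Y := by rw [hX, hY]; ring
  rw [hsplit] at e2'
  rw [mul_assoc, hsplit]
  have f1 : 0 ≤ M * K := by positivity
  calc (avg (elem s) v - avg (elem t) v) ^ 2
      ≤ 3 * (M * X + M' * (X + Y) + M * K * Y) := by linarith
    _ ≤ 3 * (M * (X + Y) + M' * (X + Y) + M * K * (X + Y)) := by gcongr <;> linarith
    _ = 3 * (M + M' + M * K) * (X + Y) := by ring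
    _ ≤ _ := by
      have : 0 ≤ X + Y := by positivity
      gcongr
      linarith

/-- Comparison of the elements of a vertex patch: a bounded number of elements of comparable size,
whose averages differ by no more than the local Dirichlet energy permits. -/
theorem exists_const_star (hd : 2 ≤ d) {κ : ℝ} (hκ : 0 ≤ κ) :
    ∃ C : ℝ, 1 ≤ C ∧ ∀ {Ω : Set (Euc d)} (_ : IsBoundedLipschitz Ω) (T : Mesh Ω),
      T.ShapeRegular κ → ∀ z, ((T.star z).card : ℝ) ≤ C ∧ ∀ s ∈ T.star z, ∀ t ∈ T.star z,
        Metric.diam (elem s) ≤ C * Metric.diam (elem t) ∧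
        ∀ {v : Euc d → ℝ} {g : Euc d → Euc d}, HasWeakGrad Ω v g →
          (avg (elem s) v - avg (elem t) v) ^ 2
            ≤ C * scale s * ∑ r ∈ T.star z, energy g r := by
  obtain ⟨C, hC1, hC⟩ := exists_const_shareFace hd hκ
  obtain ⟨N, hN⟩ := exists_nat_ge (κ * ballVol d)
  -- `L` is the factor per step of a chain of face neighbours: `(x + y)² ≤ 2 x² + 2 y²`, and each of
  -- the two energies in a step is bounded by the energy of the star
  set L := 2 + 4 * C with hL
  have hL1 : 1 ≤ L := by linarith
  have hCL : C ≤ L := by linarith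
  refine ⟨L ^ N + N, by have := one_le_pow₀ hL1 (n := N); linarith [N.cast_nonneg (α := ℝ)], ?_⟩
  intro Ω hΩ T h z
  have hcard : ((T.star z).card : ℝ) ≤ N := (h.card_star_le hd hκ z).trans hN
  have hLN : L ^ N ≤ L ^ N + N := by linarith [N.cast_nonneg (α := ℝ)]
  refine ⟨hcard.trans (by linarith [show 0 ≤ L ^ N by positivity]), fun s hs t ht => ?_⟩
  have hdp : ∀ r ∈ T.star z, 0 ≤ Metric.diam (elem r) := fun r _ => Metric.diam_nonneg
  have hstar : ∀ r, r ∈ T.star z → r ∈ T.cells := fun r hr => T.star_subset z hr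
  have hle : ∀ k, L ^ k ≤ L ^ (k + 1) := fun k => pow_le_pow_right₀ hL1 (Nat.le_succ k)
  have hdiam : Metric.diam (elem s) ≤ L ^ N * Metric.diam (elem t) := by
    refine T.star_induction hΩ hs
      (Q := fun k t => Metric.diam (elem s) ≤ L ^ k * Metric.diam (elem t)) (by simp) ?_ ?_ ht
      (by exact_mod_cast hcard)
    · intro k r hr hQ
      exact hQ.trans (mul_le_mul_of_nonneg_right (hle k) (hdp r hr))
    · intro k r hr r' hr' hface hQ
      have h1 := (hC hΩ T h r (hstar r hr) r' (hstar r' hr') hface).1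
      have h2 := hdp r' hr'
      calc Metric.diam (elem s) ≤ L ^ k * Metric.diam (elem r) := hQ
        _ ≤ L ^ k * (C * Metric.diam (elem r')) := by gcongr
        _ ≤ L ^ k * (L * Metric.diam (elem r')) := by gcongr
        _ = _ := by ring
  refine ⟨hdiam.trans (mul_le_mul_of_nonneg_right hLN (hdp t ht)), ?_⟩
  intro v g hv
  set E := ∑ r ∈ T.star z, energy g r with hE
  have hE0 : 0 ≤ E := Finset.sum_nonneg fun r _ => energy_nonneg g r
  have hEle : ∀ r ∈ T.star z, energy g r ≤ E := fun r hr =>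
    Finset.single_le_sum (fun r _ => energy_nonneg g r) hr
  have hs0 := scale_nonneg s
  have key := T.star_induction hΩ hs (N := N)
      (Q := fun k t => scale t ≤ L ^ k * scale s ∧
        (avg (elem s) v - avg (elem t) v) ^ 2 ≤ L ^ k * (scale s * E))
      ⟨by simp, by simp; positivity⟩ ?_ ?_ ht (by exact_mod_cast hcard)
  · refine key.2.trans ?_
    rw [← mul_assoc]
    gcongr
  · intro k r hr hQ
    exact ⟨hQ.1.trans (mul_le_mul_of_nonneg_right (hle k) hs0),
      hQ.2.trans (mul_le_mul_of_nonneg_right (hle k) (by positivity))⟩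
  · intro k r hr r' hr' hface hQ
    have h1 := hC hΩ T h r (hstar r hr) r' (hstar r' hr') hface
    have h1' := hC hΩ T h r' (hstar r' hr') r (hstar r hr) hface.symm
    refine ⟨?_, ?_⟩
    · calc scale r' ≤ C * scale r := h1'.2.1
        _ ≤ L * (L ^ k * scale s) := by
          have := scale_nonneg r
          gcongr
          exact hQ.1
        _ = _ := by ring
    · have h2 := h1.2.2 hv
      have h3 : C * scale r * (energy g r + energy g r') ≤ C * (L ^ k * scale s) * (E + E) := by
        have := scale_nonneg r
        have := energy_nonneg g r
        have := energy_nonneg g r'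
        gcongr
        · exact hQ.1
        · exact hEle r hr
        · exact hEle r' hr'
      calc (avg (elem s) v - avg (elem r') v) ^ 2
          ≤ 2 * (avg (elem s) v - avg (elem r) v) ^ 2
            + 2 * (avg (elem r) v - avg (elem r') v) ^ 2 := by
            nlinarith [sq_nonneg ((avg (elem s) v - avg (elem r) v)
              - (avg (elem r) v - avg (elem r') v))]
        _ ≤ 2 * (L ^ k * (scale s * E)) + 2 * (C * (L ^ k * scale s) * (E + E)) := by
            linarith [hQ.2]
        _ = L ^ (k + 1) * (scale s * E) := by rw [hL]; ring

end Mesh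

/-! ### Weak gradients of continuous piecewise smooth functions -/

/-- A function that agrees with `L`-Lipschitz functions on the members of a finite closed cover is
`L`-Lipschitz: along a segment, all slopes to the right are frequently bounded. -/
theorem lipschitzWith_of_finite_cover {ι : Type*} [Finite ι] {K : ι → Set (Euc d)}
    (hK : ∀ i, IsClosed (K i)) (hcov : ⋃ i, K i = univ) {F : Euc d → ℝ} {f : ι → Euc d → ℝ}
    {L : ℝ≥0} (hf : ∀ i, LipschitzWith L (f i)) (hF : ∀ i, ∀ x ∈ K i, F x = f i x) :
    LipschitzWith L F := by
  have hcont : Continuous F := (locallyFinite_of_finite K).continuous hcov hK fun i =>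
    (hf i).continuous.continuousOn.congr (hF i)
  have key : ∀ x y, F y - F x ≤ L * ‖y - x‖ := by
    intro x y
    let γ : ℝ → Euc d := fun s => AffineMap.lineMap x y s
    have hγ : Continuous γ := AffineMap.lineMap_continuous
    have hB : ∀ s : ℝ, HasDerivAt (fun s => L * ‖y - x‖ * s) (L * ‖y - x‖) s := fun s => by
      simpa using (hasDerivAt_id s).const_mul (L * ‖y - x‖ : ℝ)
    have := image_le_of_liminf_slope_right_le_deriv_boundary (f := fun s => F (γ s) - F x)
      (a := 0) (b := 1) (B := fun s => L * ‖y - x‖ * s) (B' := fun _ => L * ‖y - x‖)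
      (by fun_prop) (by simp [γ]) (by fun_prop) (fun s _ => (hB s).hasDerivWithinAt) ?_
      (right_mem_Icc.2 zero_le_one)
    · simpa [γ] using this
    · intro s _ r hr
      -- the closed sets that meet the segment near `γ s` contain `γ s`, so that nearby slopes are
      -- slopes of a single `f i`
      have hev : ∀ᶠ z in nhds s, ∀ i, γ z ∈ K i → γ s ∈ K i := by
        refine Filter.eventually_all.2 fun i => ?_
        by_cases hi : γ s ∈ K i
        · exact Filter.Eventually.of_forall fun _ _ => hi
        · filter_upwards [hγ.continuousAt.eventually_mem ((hK i).isOpen_compl.mem_nhds hi)]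
            with z hz hz'
          exact absurd hz' hz
      refine Filter.Eventually.frequently ?_
      filter_upwards [hev.filter_mono nhdsWithin_le_nhds, self_mem_nhdsWithin] with z hz hsz
      obtain ⟨i, hi⟩ := mem_iUnion.1 (hcov ▸ mem_univ (γ z))
      have hsz' : 0 < z - s := sub_pos.2 hsz
      refine lt_of_le_of_lt ?_ hr
      rw [slope_def_field, div_le_iff₀ hsz', hF i _ hi, hF i _ (hz i hi)]
      have h1 := (hf i).norm_sub_le (γ z) (γ s)
      have h2 : γ z - γ s = (z - s) • (y - x) := by
        simp only [γ, AffineMap.lineMap_apply_module']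
        module
      rw [h2, norm_smul, Real.norm_eq_abs, Real.norm_eq_abs, abs_of_pos hsz'] at h1
      have h3 := le_abs_self (f i (γ z) - f i (γ s))
      linarith
  refine LipschitzWith.of_dist_le_mul fun x y => ?_
  rw [Real.dist_eq, dist_eq_norm, abs_le]
  have h1 := key x y
  have h2 := key y x
  rw [norm_sub_rev] at h1
  constructor <;> linarith

theorem continuous_gradient {f : Euc d → ℝ} (hf : ContDiff ℝ (⊤ : ℕ∞) f) :
    Continuous (gradient f) := by
  unfold gradient
  exact (InnerProductSpace.toDual ℝ (Euc d)).symm.continuous.comp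
    (hf.continuous_fderiv (by simp))

namespace Mesh

variable {Ω : Set (Euc d)} (T : Mesh Ω)

/-- The piecewise gradient. -/
def pwGrad (F : Finset (Euc d) → Euc d → ℝ) (x : Euc d) : Euc d :=
  ∑ t ∈ T.cells, (elem t).indicator (gradient (F t)) x

theorem pwGrad_eq (F : Finset (Euc d) → Euc d → ℝ) {t : Finset (Euc d)} (ht : t ∈ T.cells)
    {x : Euc d} (hx : x ∈ elem t) : T.pwGrad F x = gradient (F t) x := by
  unfold pwGrad
  rw [Finset.sum_eq_single_of_mem t ht, indicator_of_mem hx]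
  intro s hs hst
  exact indicator_of_notMem (fun hxs =>
    Set.disjoint_left.1 (T.pairwiseDisjoint_elem hs ht hst) hxs hx) _

theorem isFiniteMeasure (T : Mesh Ω) : IsFiniteMeasure (volume.restrict Ω) :=
  ⟨by rw [Measure.restrict_apply_univ]; exact T.volume_lt_top⟩

theorem memLp_pwGrad {F : Finset (Euc d) → Euc d → ℝ}
    (hF : ∀ t ∈ T.cells, ContDiff ℝ (⊤ : ℕ∞) (F t)) :
    MemLp (T.pwGrad F) 2 (volume.restrict Ω) := by
  have := T.isFiniteMeasure
  unfold pwGrad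
  refine memLp_finsetSum _ fun t ht => ?_
  have hc := continuous_gradient (hF t ht)
  obtain ⟨M, hM⟩ := (isCompact_convexHull t).exists_bound_of_continuousOn hc.continuousOn
  refine MemLp.of_bound (hc.measurable.indicator (measurableSet_elem t)).aestronglyMeasurable
    (max M 0) (Filter.Eventually.of_forall fun x => ?_)
  by_cases hx : x ∈ elem t
  · rw [indicator_of_mem hx]
    exact (hM x (elem_subset t hx)).trans (le_max_left _ _)
  · rw [indicator_of_notMem hx, norm_zero]
    exact le_max_right _ _

theorem memLp_of_bddMeas (T : Mesh Ω) {f : Euc d → ℝ} (hf : BddMeas f) :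
    MemLp f 2 (volume.restrict Ω) := by
  have := T.isFiniteMeasure
  obtain ⟨M, hM⟩ := hf.2
  exact MemLp.of_bound hf.1.aestronglyMeasurable M (Filter.Eventually.of_forall hM)

/-- Green's formula for a continuous piecewise smooth function `f` and a test function `ψ`: the
product `f ψ` is Lipschitz with compact support, so that the integral of its derivative vanishes. -/
theorem green_piecewise (hΩ : IsOpen Ω) (hI : interior (closure Ω) = Ω) {f : Euc d → ℝ}
    (hf : BddMeas f) {F : Finset (Euc d) → Euc d → ℝ}
    (hF : ∀ t ∈ T.cells, ContDiff ℝ (⊤ : ℕ∞) (F t))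
    (hfF : ∀ t ∈ T.cells, ∀ x ∈ convexHull ℝ (t : Set (Euc d)), f x = F t x) {ψ : Euc d → ℝ}
    (hψ : IsTest Ω ψ) (e : Euc d) :
    ∫ x in Ω, f x * fderiv ℝ ψ x e = - ∫ x in Ω, ⟪e, T.pwGrad F x⟫_ℝ * ψ x := by
  set H : Euc d → ℝ := fun x => f x * ψ x with hH
  have hFL : ∀ t : T.cells, ∃ C : ℝ≥0, LipschitzWith C fun x => F t.1 x * ψ x := fun t =>
    ContDiff.lipschitzWith_of_hasCompactSupport hψ.2.1.mul_left ((hF t.1 t.2).mul hψ.1) (by simp)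
  choose C hC using hFL
  have hLip : LipschitzWith (∑ t, C t) H := by
    -- the product vanishes on the complement of `Ω`, the closed set with index `none`
    refine lipschitzWith_of_finite_cover (ι := Option T.cells)
      (K := fun o => o.elim Ωᶜ fun t => convexHull ℝ (t.1 : Set (Euc d)))
      (f := fun o => o.elim (fun _ => 0) fun t x => F t.1 x * ψ x) ?_ ?_ ?_ ?_
    · rintro (_ | t)
      · exact hΩ.isClosed_compl
      · exact (isCompact_convexHull t.1).isClosed
    · refine eq_univ_of_forall fun x => ?_
      by_cases hx : x ∈ Ω
      · have h1 := subset_closure hx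
        rw [← T.cover] at h1
        simp only [mem_iUnion] at h1
        obtain ⟨t, ht, hxt⟩ := h1
        exact mem_iUnion.2 ⟨some ⟨t, ht⟩, hxt⟩
      · exact mem_iUnion.2 ⟨none, hx⟩
    · rintro (_ | t)
      · exact LipschitzWith.const _ |>.weaken zero_le
      · exact (hC t).weaken (Finset.single_le_sum (f := C) (fun _ _ => zero_le)
          (Finset.mem_univ t))
    · rintro (_ | t) x hx
      · simp only [hH, hψ.eq_zero (U := Ω) hx, mul_zero, Option.elim]
      · simp only [hH, Option.elim]
        rw [hfF t.1 t.2 x hx]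
  have hsupp : HasCompactSupport H := hψ.2.1.mul_left
  have hzero : ∫ x, lineDeriv ℝ H x e = 0 := by
    have h1 := (LipschitzWith.const (1 : ℝ)).integral_lineDeriv_mul_eq (μ := volume)
      (hLip.weaken le_rfl) hsupp (-e)
    simp only [neg_neg, mul_one] at h1
    rw [← h1]
    have h2 : ∀ x : Euc d, lineDeriv ℝ (fun _ : Euc d => (1 : ℝ)) x (-e) = 0 := fun x => by
      simp [lineDeriv]
    simp [h2]
  -- the boundary is a null set, and off the closure the product vanishes locally
  have hout : ∀ᵐ x, x ∉ Ω → lineDeriv ℝ H x e = 0 := by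
    have hnull : volume (closure Ω \ Ω) = 0 := by
      rw [measure_sdiff subset_closure hΩ.measurableSet.nullMeasurableSet T.volume_lt_top.ne,
        T.volume_closure hI, tsub_self]
    filter_upwards [measure_eq_zero_iff_ae_notMem.1 hnull] with x hx hxΩ
    have hxc : x ∉ closure Ω := fun h => hx ⟨h, hxΩ⟩
    have h1 : H =ᶠ[nhds x] fun _ => 0 := by
      filter_upwards [isClosed_closure.isOpen_compl.mem_nhds hxc] with y hy
      simp only [hH, hψ.eq_zero (fun h => hy (subset_closure h)), mul_zero]
    rw [h1.lineDeriv_eq]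
    simp [lineDeriv]
  have hin : ∀ᵐ x ∂volume.restrict Ω, lineDeriv ℝ H x e
      = f x * fderiv ℝ ψ x e + ⟪e, T.pwGrad F x⟫_ℝ * ψ x := by
    refine T.ae_domain hI fun t ht x hx => ?_
    have h1 : H =ᶠ[nhds x] fun y => F t y * ψ y := by
      filter_upwards [(isOpen_elem t).mem_nhds hx] with y hy
      simp only [hH, hfF t ht y (elem_subset t hy)]
    have d1 : HasFDerivAt (F t) (fderiv ℝ (F t) x) x :=
      ((hF t ht).differentiable (by simp) x).hasFDerivAt
    have d2 : HasFDerivAt ψ (fderiv ℝ ψ x) x := (hψ.1.differentiable (by simp) x).hasFDerivAt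
    rw [h1.lineDeriv_eq, show lineDeriv ℝ (fun y => F t y * ψ y) x e = _ from
      ((d1.mul d2).hasLineDerivAt e).lineDeriv, T.pwGrad_eq F ht hx,
      hfF t ht x (elem_subset t hx), gradient, real_inner_comm, InnerProductSpace.toDual_symm_apply]
    simp only [FunLike.coe_add, Pi.add_apply, FunLike.coe_smul, Pi.smul_apply,
      smul_eq_mul]
    ring
  have i1 : Integrable (fun x => f x * fderiv ℝ ψ x e) (volume.restrict Ω) :=
    (T.memLp_of_bddMeas hf).integrable_mul (hψ.memLp_fderiv Ω e)
  have i2 : Integrable (fun x => ⟪e, T.pwGrad F x⟫_ℝ * ψ x) (volume.restrict Ω) :=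
    ((T.memLp_pwGrad hF).const_inner e).integrable_mul (hψ.memLp Ω)
  have h3 : ∫ x in Ω, lineDeriv ℝ H x e = 0 := by
    rw [← hzero]
    exact setIntegral_eq_integral_of_ae_compl_eq_zero hout
  rw [integral_congr_ae hin, integral_add i1 i2] at h3
  linarith

/-- A continuous piecewise smooth function belongs to `H¹(Ω)`, with the piecewise gradient. -/
theorem exists_H1_of_piecewise (hΩ : IsOpen Ω) (hI : interior (closure Ω) = Ω) {f : Euc d → ℝ}
    (hf : BddMeas f) {F : Finset (Euc d) → Euc d → ℝ}
    (hF : ∀ t ∈ T.cells, ContDiff ℝ (⊤ : ℕ∞) (F t))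
    (hfF : ∀ t ∈ T.cells, ∀ x ∈ convexHull ℝ (t : Set (Euc d)), f x = F t x) :
    ∃ W : H1 Ω, W.1.fst = T.cls f hf ∧
      ∀ᵐ x ∂volume.restrict Ω, W.1.fst x = f x ∧ W.1.snd x = T.pwGrad F x := by
  have m1 := T.memLp_of_bddMeas hf
  have m2 := T.memLp_pwGrad hF
  refine ⟨⟨WithLp.toLp 2 (m1.toLp f, m2.toLp _), ?_⟩, rfl, ?_⟩
  · intro ψ hψ e
    have h := T.green_piecewise hΩ hI hf hF hfF hψ e
    refine Eq.trans (Eq.trans (integral_congr_ae ?_) h) (congrArg Neg.neg (integral_congr_ae ?_))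
    · filter_upwards [m1.coeFn_toLp] with x hx
      rw [← hx]
      rfl
    · filter_upwards [m2.coeFn_toLp] with x hx
      rw [← hx]
      rfl
  · filter_upwards [m1.coeFn_toLp, m2.coeFn_toLp] with x h1 h2
    exact ⟨h1, h2⟩

end Mesh

/-! ### Uniqueness of weak gradients -/

theorem H1.eq_of_fst_eq {Ω : Set (Euc d)} (hΩ : IsOpen Ω) {p q : H1 Ω} (h : p.1.fst = q.1.fst) :
    p = q := by
  have hsnd : p.1.snd = q.1.snd := by
    rw [← sub_eq_zero, Lp.eq_zero_iff_ae_eq_zero]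
    have hloc : LocallyIntegrableOn (p.1.snd - q.1.snd : L2Vec Ω) Ω volume :=
      locallyIntegrableOn_of_locallyIntegrable_restrict
        ((Lp.memLp _).locallyIntegrable (by norm_num))
    have h0 := hΩ.ae_eq_zero_of_integral_contDiff_smul_eq_zero hloc fun ψ h1 h2 h3 => by
      have hψ : IsTest Ω ψ := ⟨h1, h2, h3⟩
      rw [← setIntegral_eq_integral_of_forall_compl_eq_zero (s := Ω)
        fun x hx => by rw [hψ.eq_zero hx, zero_smul]]
      have hint : Integrable (fun x => ψ x • (p.1.snd - q.1.snd : L2Vec Ω) x)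
          (volume.restrict Ω) := by
        have := (Lp.memLp (p.1.snd - q.1.snd : L2Vec Ω)).smul (hψ.memLp Ω) (r := 1)
        exact memLp_one_iff_integrable.1 this
      refine ext_inner_left ℝ fun e => ?_
      rw [inner_zero_right, ← integral_inner hint]
      have hp := p.2 ψ hψ e
      have hq := q.2 ψ hψ e
      rw [h, hq] at hp
      have i1 := integrable_inner_mul hψ e p.1.snd
      have i2 := integrable_inner_mul hψ e q.1.snd
      have h4 : ∫ x in Ω, ⟪e, ψ x • (p.1.snd - q.1.snd : L2Vec Ω) x⟫_ℝ
          = ∫ x in Ω, (⟪e, p.1.snd x⟫_ℝ * ψ x - ⟪e, q.1.snd x⟫_ℝ * ψ x) := by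
        refine integral_congr_ae ?_
        filter_upwards [Lp.coeFn_sub p.1.snd q.1.snd] with x hx
        rw [hx, Pi.sub_apply, inner_smul_right, inner_sub_right]
        ring
      rw [h4, integral_sub i1 i2]
      linarith
    exact (ae_restrict_iff' hΩ.measurableSet).2 h0
  refine Subtype.ext (WithLp.ofLp_injective 2 (Prod.ext h hsnd))

/-- `H¹(Ω)` is dense in `L²(Ω)`. -/
theorem eq_of_inner_H1_eq {Ω : Set (Euc d)} (hΩ : IsOpen Ω) {f g : L2 Ω}
    (h : ∀ v : H1 Ω, ⟪f, v.1.fst⟫_ℝ = ⟪g, v.1.fst⟫_ℝ) : f = g := by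
  rw [← sub_eq_zero, Lp.eq_zero_iff_ae_eq_zero]
  have hm : MemLp (f - g : L2 Ω) 2 (volume.restrict Ω) := Lp.memLp _
  -- test functions on `Ω` belong to `H¹(Ω)`, and are dense in `L²(Ω)`
  have key := integral_sq_le_of_test hΩ hm le_rfl fun ψ hψ => by
    have hgrad : MemLp (gradient ψ) 2 (volume.restrict Ω) := by
      refine (continuous_gradient hψ.1).memLp_of_hasCompactSupport ?_
      exact (hψ.2.1.fderiv (𝕜 := ℝ)).comp_left (map_zero _)
    let v : H1 Ω := ⟨WithLp.toLp 2 ((hψ.memLp Ω).toLp ψ, hgrad.toLp _), by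
      intro χ hχ e
      have hprod : ∫ x, ψ x * fderiv ℝ χ x e = - ∫ x, fderiv ℝ ψ x e * χ x := by
        refine integral_mul_fderiv_eq_neg_fderiv_mul_of_integrable ?_ ?_ ?_
          (fun x _ => hψ.1.differentiable (by simp) x)
          (fun x _ => hχ.1.differentiable (by simp) x)
        · exact (((hψ.1.continuous_fderiv (by simp)).clm_apply continuous_const).mul
            hχ.1.continuous).integrable_of_hasCompactSupport hχ.2.1.mul_left
        · exact (hψ.1.continuous.mul ((hχ.1.continuous_fderiv (by simp)).clm_apply
            continuous_const)).integrable_of_hasCompactSupport hψ.2.1.mul_right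
        · exact (hψ.1.continuous.mul hχ.1.continuous).integrable_of_hasCompactSupport
            hψ.2.1.mul_right
      rw [← setIntegral_eq_integral_of_forall_compl_eq_zero (s := Ω) fun x hx => by
          rw [hψ.eq_zero hx, zero_mul],
        ← setIntegral_eq_integral_of_forall_compl_eq_zero (s := Ω) (f := fun x =>
          fderiv ℝ ψ x e * χ x) fun x hx => by rw [hχ.eq_zero hx, mul_zero]] at hprod
      refine Eq.trans (Eq.trans (integral_congr_ae ?_) hprod)
        (congrArg Neg.neg (integral_congr_ae ?_))
      · filter_upwards [(hψ.memLp Ω).coeFn_toLp] with x hx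
        rw [← hx]
        rfl
      · filter_upwards [hgrad.coeFn_toLp] with x hx
        have : (hgrad.toLp _ : L2Vec Ω) x = gradient ψ x := hx
        change _ = ⟪e, (hgrad.toLp _ : L2Vec Ω) x⟫_ℝ * χ x
        rw [this, real_inner_comm, gradient, InnerProductSpace.toDual_symm_apply]⟩
    have h1 := h v
    rw [← sub_eq_zero, ← inner_sub_left, L2.inner_def] at h1
    have h2 : ∫ x in Ω, (f - g : L2 Ω) x * ψ x = 0 := by
      rw [← h1]
      refine integral_congr_ae ?_
      filter_upwards [(hψ.memLp Ω).coeFn_toLp] with x hx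
      have : v.1.fst x = ψ x := hx
      rw [this]
      simp [mul_comm]
    rw [h2]
    simp
  have h0 : ∫ x in Ω, ((f - g : L2 Ω) x) ^ 2 = 0 :=
    le_antisymm (by simpa using key) (integral_nonneg fun x => sq_nonneg _)
  rw [integral_eq_zero_iff_of_nonneg (fun x => sq_nonneg _) hm.integrable_sq] at h0
  filter_upwards [h0] with x hx
  simpa using hx

/-! ### The dual basis -/

/-- The barycentric coordinates are linearly independent in `L²(T)`, so that the Gram matrix is
invertible. -/
theorem IsSimplex.isUnit_det_gram {t : Finset (Euc d)} (h : IsSimplex t) :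
    IsUnit (gram t).det := by
  rw [isUnit_iff_ne_zero]
  intro hdet
  obtain ⟨c, hc, hgc⟩ := Matrix.exists_mulVec_eq_zero_iff.2 hdet
  apply hc
  -- a kernel vector `c` of the Gram matrix yields an affine function with vanishing `L²(T)` norm
  set f : Euc d → ℝ := fun x => ∑ z : t, c z * bary t z x with hf
  have hfc : Continuous f :=
    continuous_finsetSum _ fun z _ => continuous_const.mul (continuous_bary t z)
  have hint : ∀ {g : Euc d → ℝ}, Continuous g → IntegrableOn g (elem t) := fun hg =>
    (hg.continuousOn.integrableOn_compact (isCompact_convexHull t)).mono_set (elem_subset t)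
  have hsq : ∫ x in elem t, f x ^ 2 = 0 := by
    have h1 : ∀ x, f x ^ 2 = ∑ z : t, ∑ z' : t, c z * (bary t z x * bary t z' x * c z') := by
      intro x
      rw [sq, hf, Finset.sum_mul_sum]
      exact Finset.sum_congr rfl fun z _ => Finset.sum_congr rfl fun z' _ => by ring
    have hc2 : ∀ z z' : t, Continuous fun x => bary t z x * bary t z' x := fun z z' =>
      (continuous_bary t z).mul (continuous_bary t z')
    have hi : ∀ z z' : t,
        IntegrableOn (fun x => c z * (bary t z x * bary t z' x * c z')) (elem t) :=
      fun z z' => hint (continuous_const.mul ((hc2 z z').mul continuous_const))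
    simp only [h1]
    rw [integral_finsetSum _ fun z _ => integrable_finsetSum _ fun z' _ => hi z z']
    refine Finset.sum_eq_zero fun z _ => ?_
    rw [integral_finsetSum _ fun z' _ => hi z z']
    have h2 := congrFun hgc z
    simp only [Matrix.mulVec, dotProduct, gram, Pi.zero_apply] at h2
    rw [← mul_zero (c z), ← h2, Finset.mul_sum]
    refine Finset.sum_congr rfl fun z' _ => ?_
    rw [integral_const_mul, integral_mul_const]
  have hae : f =ᵐ[volume.restrict (elem t)] fun _ => 0 := by
    rw [integral_eq_zero_iff_of_nonneg (fun x => sq_nonneg _) (hint (hfc.pow 2))] at hsq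
    filter_upwards [hsq] with x hx
    simpa using hx
  have heq : EqOn f (fun _ => 0) (elem t) :=
    Measure.eqOn_open_of_ae_eq hae (isOpen_elem t) hfc.continuousOn continuousOn_const
  have hcl : EqOn f (fun _ => 0) (closure (elem t)) := heq.closure hfc continuous_const
  rw [h.closure_elem] at hcl
  funext z
  have h3 := hcl (subset_hull z.2)
  simp only [hf] at h3
  rw [Finset.sum_eq_single z (fun y _ hyz => by
    rw [bary_ne z.2 (fun hh => hyz (Subtype.ext hh)), mul_zero]) (by simp), h.bary_self z.2] at h3
  simpa using h3

/-- The dual basis functions have integral one, since the nodal basis is a partition of unity. -/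
theorem IsSimplex.integral_dualFn {t : Finset (Euc d)} (h : IsSimplex t) {z : Euc d} (hz : z ∈ t) :
    ∫ x in elem t, dualFn t z x = 1 := by
  classical
  have hint : ∀ {g : Euc d → ℝ}, Continuous g → IntegrableOn g (elem t) := fun hg =>
    (hg.continuousOn.integrableOn_compact (isCompact_convexHull t)).mono_set (elem_subset t)
  have h1 : ∀ z' : t, ∫ x in elem t, bary t z' x = ∑ y : t, gram t z' y := fun z' => by
    have h2 : ∀ x, bary t z' x = ∑ y : t, bary t z' x * bary t y x := fun x => by
      rw [← Finset.mul_sum, Finset.sum_coe_sort t fun y => bary t y x, h.sum_bary, mul_one]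
    have hi : ∀ y : t, IntegrableOn (fun x => bary t z' x * bary t y x) (elem t) := fun y =>
      hint ((continuous_bary t z').mul (continuous_bary t y))
    simp only [gram]
    rw [← integral_finsetSum _ fun y _ => hi y]
    exact integral_congr_ae (Filter.Eventually.of_forall h2)
  have h3 : ∀ x, dualFn t z x = ∑ z' : t, (gram t)⁻¹ ⟨z, hz⟩ z' * bary t z' x := fun x => by
    simp only [dualFn, hz, dite_true]
  have hi : ∀ z' : t, IntegrableOn (fun x => (gram t)⁻¹ ⟨z, hz⟩ z' * bary t z' x) (elem t) :=
    fun z' => hint (continuous_const.mul (continuous_bary t z'))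
  simp only [h3]
  rw [integral_finsetSum _ fun z' _ => hi z']
  simp only [integral_const_mul, h1, Finset.mul_sum]
  rw [Finset.sum_comm]
  have h4 : ∀ y : t, ∑ z' : t, (gram t)⁻¹ ⟨z, hz⟩ z' * gram t z' y
      = (1 : Matrix t t ℝ) ⟨z, hz⟩ y := fun y => by
    rw [← Matrix.nonsing_inv_mul (gram t) h.isUnit_det_gram, Matrix.mul_apply]
  simp only [h4, Matrix.one_apply]
  simp

namespace Mesh

variable {Ω : Set (Euc d)} (T : Mesh Ω)

/-! ### The operators on `L²(Ω)` -/

theorem coeFn_cls (T : Mesh Ω) {f : Euc d → ℝ} (hf : BddMeas f) :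
    (T.cls f hf : Euc d → ℝ) =ᵐ[volume.restrict Ω] f := MemLp.coeFn_toLp _

theorem ae_elem (hI : interior (closure Ω) = Ω) {t : Finset (Euc d)} (ht : t ∈ T.cells)
    {p : Euc d → Prop} (h : ∀ᵐ x ∂volume.restrict Ω, p x) :
    ∀ᵐ x ∂volume.restrict (elem t), p x :=
  ae_mono (Measure.restrict_mono (T.elem_subset_domain hI ht) le_rfl) h

theorem inner_cls_onElem (hI : interior (closure Ω) = Ω) {t : Finset (Euc d)} (ht : t ∈ T.cells)
    {f : Euc d → ℝ} (hf : BddMeas (onElem t f)) (v : L2 Ω) :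
    ⟪T.cls (onElem t f) hf, v⟫_ℝ = ∫ x in elem t, f x * v x := by
  rw [L2.inner_def]
  have h1 : ∫ x in Ω, ⟪T.cls (onElem t f) hf x, v x⟫_ℝ
      = ∫ x in Ω, (elem t).indicator (fun x => f x * v x) x := by
    refine integral_congr_ae ?_
    filter_upwards [T.coeFn_cls hf] with x hx
    rw [hx]
    by_cases hxt : x ∈ elem t <;> simp [onElem, hxt, mul_comm]
  rw [h1, setIntegral_indicator (measurableSet_elem t),
    inter_eq_right.2 (T.elem_subset_domain hI ht)]

theorem inner_chi (hI : interior (closure Ω) = Ω) {t : Finset (Euc d)} (ht : t ∈ T.cells)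
    (v : L2 Ω) : ⟪T.chi t, v⟫_ℝ = ∫ x in elem t, v x := by
  rw [chi, T.inner_cls_onElem hI ht]
  simp

/-- The piecewise constant function with the value `w t` on the element `t`. -/
def pw (w : Finset (Euc d) → ℝ) : L2 Ω := ∑ t ∈ T.cells, w t • T.chi t

theorem pw_mem (w : Finset (Euc d) → ℝ) : T.pw w ∈ T.P0 :=
  Submodule.sum_mem _ fun t ht => Submodule.smul_mem _ _
    (Submodule.subset_span ⟨⟨t, ht⟩, rfl⟩)

theorem chi_ae (hI : interior (closure Ω) = Ω) {s t : Finset (Euc d)} (hs : s ∈ T.cells)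
    (ht : t ∈ T.cells) : ∀ᵐ x ∂volume.restrict (elem t), T.chi s x = if s = t then 1 else 0 := by
  filter_upwards [T.ae_elem hI ht (T.coeFn_cls (bddMeas_onElem s continuous_const)),
    ae_restrict_mem (measurableSet_elem t)] with x hx hxt
  rw [chi, hx, onElem]
  split_ifs with hst
  · subst hst
    exact indicator_of_mem hxt _
  · exact indicator_of_notMem (fun hxs =>
      Set.disjoint_left.1 (T.pairwiseDisjoint_elem hs ht hst) hxs hxt) _

theorem pw_ae (hI : interior (closure Ω) = Ω) (w : Finset (Euc d) → ℝ) {t : Finset (Euc d)}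
    (ht : t ∈ T.cells) : ∀ᵐ x ∂volume.restrict (elem t), T.pw w x = w t := by
  have h1 : ∀ᵐ x ∂volume.restrict Ω, T.pw w x = ∑ s ∈ T.cells, w s * T.chi s x := by
    have h2 := Lp.coeFn_finsetSum T.cells fun s => w s • T.chi s
    have h3 : ∀ᵐ x ∂volume.restrict Ω, ∀ s ∈ T.cells, (w s • T.chi s : L2 Ω) x = w s * T.chi s x :=
      (Finset.eventually_all T.cells).2 fun s _ => by
        filter_upwards [Lp.coeFn_smul (w s) (T.chi s)] with x hx
        rw [hx]; rfl
    filter_upwards [h2, h3] with x h2 h3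
    rw [pw, h2, Finset.sum_apply]
    exact Finset.sum_congr rfl h3
  have h4 : ∀ᵐ x ∂volume.restrict (elem t), ∀ s ∈ T.cells,
      T.chi s x = if s = t then 1 else 0 :=
    (Finset.eventually_all T.cells).2 fun s hs => T.chi_ae hI hs ht
  filter_upwards [T.ae_elem hI ht h1, h4] with x h1 h4
  rw [h1, Finset.sum_congr rfl fun s hs => by rw [h4 s hs]]
  simp [ht]

theorem setIntegral_pw (hI : interior (closure Ω) = Ω) (w : Finset (Euc d) → ℝ)
    {t : Finset (Euc d)} (ht : t ∈ T.cells) :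
    ∫ x in elem t, T.pw w x = w t * volume.real (elem t) := by
  rw [integral_congr_ae (T.pw_ae hI w ht)]
  simp [mul_comm]

theorem Pi0_apply (hI : interior (closure Ω) = Ω) (v : L2 Ω) :
    T.Pi0 v = T.pw fun t => avg (elem t) v := by
  refine Submodule.eq_starProjection_of_mem_of_inner_eq_zero (T.pw_mem _) fun u hu => ?_
  refine Submodule.span_induction ?_ ?_ ?_ ?_ hu
  · rintro _ ⟨t, rfl⟩
    rw [real_inner_comm, inner_sub_right, T.inner_chi hI t.2, T.inner_chi hI t.2,
      T.setIntegral_pw hI _ t.2, avg, div_mul_cancel₀ _ (T.isSimplex t.1 t.2).volume_pos.ne',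
      sub_self]
  · exact inner_zero_right _
  · intro x y _ _ hx hy
    rw [inner_add_right, hx, hy, add_zero]
  · intro c x _ hx
    rw [inner_smul_right, hx, mul_zero]

/-- The value of `J̄ v` at the node `z`. -/
def nodal (v : L2 Ω) (z : Euc d) : ℝ :=
  ∑ t ∈ T.star z, volume.real (elem t) / (∑ t' ∈ T.star z, volume.real (elem t'))
    * ⟪T.dualL2 t z, v⟫_ℝ

theorem JBar_apply (v : L2 Ω) : T.JBar v = ∑ z ∈ T.nodes, T.nodal v z • T.hatL2 z := by
  simp only [JBar, sum_apply]
  refine Finset.sum_congr rfl fun z hz => ?_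
  rw [T.patch_singleton hz, nodal, Finset.sum_smul]
  refine Finset.sum_congr rfl fun t _ => ?_
  simp [smul_smul]

/-- The coefficient of the bubble function of the element `t` in `P̄ v`. -/
def bubbleCoef (v : L2 Ω) (t : Finset (Euc d)) : ℝ :=
  (∫ x in elem t, T.bubble t x)⁻¹ * ⟪T.chi t, v - T.JBar v⟫_ℝ

theorem PBar_apply (v : L2 Ω) : T.PBar v = ∑ z ∈ T.nodes, T.nodal v z • T.hatL2 z
    + ∑ t ∈ T.cells, T.bubbleCoef v t • T.bubbleL2 t := by
  rw [← T.JBar_apply]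
  simp only [PBar, bubbleOp, add_apply, ContinuousLinearMap.comp_apply,
    sum_apply, _root_.smul_apply,
    ContinuousLinearMap.smulRight_apply, sub_apply,
    ContinuousLinearMap.id_apply, innerSL_apply_apply, smul_smul]
  rfl

theorem integral_bubble (T : Mesh Ω) {s t : Finset (Euc d)} (hs : s ∈ T.cells) (ht : t ∈ T.cells) :
    ∫ x in elem t, T.bubble s x = if s = t then ∫ x in elem t, ∏ z ∈ t, bary t z x else 0 := by
  split_ifs with hst
  · subst hst
    exact setIntegral_congr_fun (measurableSet_elem s) fun x hx =>
      T.bubble_eq hs s (elem_subset s hx)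
  · rw [← integral_zero (Euc d) ℝ (μ := volume.restrict (elem t))]
    exact setIntegral_congr_fun (measurableSet_elem t) fun x hx =>
      T.bubble_eq_zero ht hs hst (elem_subset t hx)

theorem integral_bubble_pos (T : Mesh Ω) {t : Finset (Euc d)} (ht : t ∈ T.cells) :
    0 < ∫ x in elem t, T.bubble t x := by
  rw [T.integral_bubble ht ht, if_pos rfl]
  have h1 := (T.isSimplex t ht).volume_pos
  refine lt_of_lt_of_le ?_ (T.isSimplex t ht).le_integral_prod_bary
  positivity

/-- The bubble correction makes `P̄` preserve the integrals over the elements. -/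
theorem inner_chi_PBar (hI : interior (closure Ω) = Ω) {t : Finset (Euc d)} (ht : t ∈ T.cells)
    (v : L2 Ω) : ⟪T.chi t, T.PBar v⟫_ℝ = ⟪T.chi t, v⟫_ℝ := by
  have h1 : ∀ s ∈ T.cells, ⟪T.chi t, T.bubbleL2 s⟫_ℝ
      = if s = t then ∫ x in elem t, T.bubble t x else 0 := fun s hs => by
    rw [T.inner_chi hI ht, bubbleL2,
      integral_congr_ae (T.ae_elem hI ht (T.coeFn_cls (T.bddMeas_bubble s))),
      T.integral_bubble hs ht, T.integral_bubble ht ht]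
    simp
  rw [T.PBar_apply, ← T.JBar_apply, inner_add_right, inner_sum]
  have h2 : ∑ s ∈ T.cells, ⟪T.chi t, T.bubbleCoef v s • T.bubbleL2 s⟫_ℝ
      = T.bubbleCoef v t * ∫ x in elem t, T.bubble t x := by
    rw [Finset.sum_eq_single_of_mem t ht fun s hs hst => by
      rw [inner_smul_right, h1 s hs, if_neg hst, mul_zero]]
    rw [inner_smul_right, h1 t ht, if_pos rfl]
  have h3 := (T.integral_bubble_pos ht).ne'
  rw [h2, bubbleCoef, mul_comm, ← mul_assoc, mul_inv_cancel₀ h3, one_mul, inner_sub_right]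
  ring

/-- The adjoint of `P̄` is the identity on the piecewise constants. -/
theorem adjoint_PBar_of_mem (hI : interior (closure Ω) = Ω) {q : L2 Ω} (hq : q ∈ T.P0) :
    ContinuousLinearMap.adjoint T.PBar q = q := by
  refine ext_inner_right ℝ fun v => ?_
  rw [ContinuousLinearMap.adjoint_inner_left]
  refine Submodule.span_induction ?_ ?_ ?_ ?_ hq
  · rintro _ ⟨t, rfl⟩
    exact T.inner_chi_PBar hI t.2 v
  · rw [inner_zero_left, inner_zero_left]
  · intro x y _ _ hx hy
    rw [inner_add_left, inner_add_left, hx, hy]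
  · intro c x _ hx
    rw [inner_smul_left, inner_smul_left, hx]

theorem Pi0_mem (v : L2 Ω) : T.Pi0 v ∈ T.P0 := Submodule.starProjection_apply_mem _ _

theorem Pi0_of_mem {q : L2 Ω} (hq : q ∈ T.P0) : T.Pi0 q = q :=
  Submodule.starProjection_eq_self_iff.2 hq

theorem QTilde_of_mem (hI : interior (closure Ω) = Ω) {q : L2 Ω} (hq : q ∈ T.P0) :
    T.QTilde q = q := by
  rw [QTilde, ContinuousLinearMap.comp_apply, T.adjoint_PBar_of_mem hI hq, T.Pi0_of_mem hq]

theorem QTilde_mem (φ : L2 Ω) : T.QTilde φ ∈ T.P0 := T.Pi0_mem _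

theorem inner_Pi0 (u v : L2 Ω) : ⟪T.Pi0 u, v⟫_ℝ = ⟪u, T.Pi0 v⟫_ℝ :=
  Submodule.inner_starProjection_left_eq_right _ _ _

theorem inner_QTilde (φ v : L2 Ω) : ⟪T.QTilde φ, v⟫_ℝ = ⟪φ, T.PBar (T.Pi0 v)⟫_ℝ := by
  rw [QTilde, ContinuousLinearMap.comp_apply, inner_Pi0, ContinuousLinearMap.adjoint_inner_left]

theorem QTilde_comp_self (hI : interior (closure Ω) = Ω) : T.QTilde ∘L T.QTilde = T.QTilde :=
  ContinuousLinearMap.ext fun φ => T.QTilde_of_mem hI (T.QTilde_mem φ)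

theorem range_QTilde (hI : interior (closure Ω) = Ω) : T.QTilde.range = T.P0 := by
  ext q
  constructor
  · rintro ⟨φ, rfl⟩
    exact T.QTilde_mem φ
  · intro hq
    exact ⟨q, T.QTilde_of_mem hI hq⟩

/-! ### The smoothing operator maps into `H¹(Ω)` -/

theorem BddMeas.linearCombination {ι : Type*} (s : Finset ι) (a : ι → ℝ) {f : ι → Euc d → ℝ}
    (h : ∀ i, BddMeas (f i)) : BddMeas fun x => ∑ i ∈ s, a i * f i x := by
  choose hm M hM using h
  refine ⟨Finset.measurable_sum s fun i _ => (hm i).const_mul _, ∑ i ∈ s, |a i| * M i, fun x => ?_⟩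
  refine (Finset.abs_sum_le_sum_abs _ _).trans (Finset.sum_le_sum fun i _ => ?_)
  rw [abs_mul]
  exact mul_le_mul_of_nonneg_left (hM i x) (abs_nonneg _)

theorem BddMeas.add {f g : Euc d → ℝ} (hf : BddMeas f) (hg : BddMeas g) :
    BddMeas fun x => f x + g x := by
  obtain ⟨h1, M, hM⟩ := hf
  obtain ⟨h2, N, hN⟩ := hg
  exact ⟨h1.add h2, M + N, fun x => (abs_add_le _ _).trans (add_le_add (hM x) (hN x))⟩

/-- The function `P̄ v` on the element `t`. -/
def localPBar (v : L2 Ω) (t : Finset (Euc d)) (x : Euc d) : ℝ :=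
  ∑ z ∈ t, T.nodal v z * bary t z x + T.bubbleCoef v t * ∏ z ∈ t, bary t z x

theorem contDiff_localPBar (v : L2 Ω) (t : Finset (Euc d)) {n : WithTop ℕ∞} :
    ContDiff ℝ n (T.localPBar v t) := by
  unfold localPBar
  exact (ContDiff.sum fun z _ => contDiff_const.mul (contDiff_bary t z)).add
    (contDiff_const.mul (contDiff_prod fun z _ => contDiff_bary t z))

theorem sum_hat_eq (T : Mesh Ω) (a : Euc d → ℝ) {t : Finset (Euc d)} (ht : t ∈ T.cells) {x : Euc d}
    (hx : x ∈ convexHull ℝ (t : Set (Euc d))) :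
    ∑ z ∈ T.nodes, a z * T.hat z x = ∑ z ∈ t, a z * bary t z x := by
  have h1 : t ⊆ T.nodes := fun z hz => T.mem_nodes_of_mem ht hz
  rw [← Finset.sum_subset h1 fun z _ hz => by rw [T.hat_eq ht z hx, bary_of_notMem hz, mul_zero]]
  exact Finset.sum_congr rfl fun z _ => by rw [T.hat_eq ht z hx]

theorem coeFn_sum_cls (T : Mesh Ω) {ι : Type*} (s : Finset ι) (a : ι → ℝ) {f : ι → Euc d → ℝ}
    (hf : ∀ i, BddMeas (f i)) :
    ((∑ i ∈ s, a i • T.cls (f i) (hf i) : L2 Ω) : Euc d → ℝ)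
      =ᵐ[volume.restrict Ω] fun x => ∑ i ∈ s, a i * f i x := by
  have h2 := Lp.coeFn_finsetSum s fun i => a i • T.cls (f i) (hf i)
  have h3 : ∀ᵐ x ∂volume.restrict Ω, ∀ i ∈ s, (a i • T.cls (f i) (hf i) : L2 Ω) x = a i * f i x :=
    (Finset.eventually_all s).2 fun i _ => by
      filter_upwards [Lp.coeFn_smul (a i) (T.cls (f i) (hf i)), T.coeFn_cls (hf i)] with x h1 h2
      rw [h1, Pi.smul_apply, h2, smul_eq_mul]
  filter_upwards [h2, h3] with x h2 h3
  rw [h2, Finset.sum_apply]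
  exact Finset.sum_congr rfl h3

/-- `P̄ v` is continuous and piecewise polynomial, so its weak gradient is the piecewise one. -/
theorem exists_H1_PBar (hΩ : IsOpen Ω) (hI : interior (closure Ω) = Ω) (v : L2 Ω) :
    ∃ W : H1 Ω, W.1.fst = T.PBar v ∧ ∀ t ∈ T.cells, ∀ᵐ x ∂volume.restrict (elem t),
      W.1.fst x = T.localPBar v t x ∧ W.1.snd x = gradient (T.localPBar v t) x := by
  have hb1 := BddMeas.linearCombination T.nodes (T.nodal v) T.bddMeas_hat
  have hb2 := BddMeas.linearCombination T.cells (T.bubbleCoef v) T.bddMeas_bubble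
  have hloc : ∀ t ∈ T.cells, ∀ x ∈ convexHull ℝ (t : Set (Euc d)),
      ∑ z ∈ T.nodes, T.nodal v z * T.hat z x + ∑ s ∈ T.cells, T.bubbleCoef v s * T.bubble s x
        = T.localPBar v t x := fun t ht x hx => by
    rw [T.sum_hat_eq _ ht hx, localPBar, Finset.sum_eq_single_of_mem t ht fun s hs hst => by
      rw [T.bubble_eq_zero ht hs hst hx, mul_zero], T.bubble_eq ht t hx]
  obtain ⟨W, hW1, hW2⟩ := T.exists_H1_of_piecewise hΩ hI (BddMeas.add hb1 hb2)
    (fun t _ => T.contDiff_localPBar v t) hloc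
  refine ⟨W, ?_, fun t ht => ?_⟩
  · rw [hW1, T.PBar_apply]
    refine Lp.ext ?_
    filter_upwards [T.coeFn_cls (BddMeas.add hb1 hb2),
      T.coeFn_sum_cls T.nodes (T.nodal v) T.bddMeas_hat,
      T.coeFn_sum_cls T.cells (T.bubbleCoef v) T.bddMeas_bubble,
      Lp.coeFn_add (∑ z ∈ T.nodes, T.nodal v z • T.hatL2 z)
        (∑ t ∈ T.cells, T.bubbleCoef v t • T.bubbleL2 t)] with x h1 h2 h3 h4
    rw [h1, h4, Pi.add_apply]
    exact (congrArg₂ (· + ·) h2 h3).symm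
  · filter_upwards [T.ae_elem hI ht hW2, ae_restrict_mem (measurableSet_elem t)] with x hx hxt
    rw [hx.1, hx.2, hloc t ht x (elem_subset t hxt), T.pwGrad_eq _ ht hxt]
    exact ⟨rfl, rfl⟩

/-! ### Bounds for the smoothing operator on piecewise constants -/

/-- The nodal values of `J̄ w` are weighted means of the values of the piecewise constant `w`. -/
theorem nodal_pw (hI : interior (closure Ω) = Ω) (w : Finset (Euc d) → ℝ) (z : Euc d) :
    T.nodal (T.pw w) z = ∑ t ∈ T.star z,
      volume.real (elem t) / (∑ t' ∈ T.star z, volume.real (elem t')) * w t := by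
  refine Finset.sum_congr rfl fun t ht => ?_
  obtain ⟨htc, hzt⟩ := T.mem_star.1 ht
  congr 1
  rw [dualL2, T.inner_cls_onElem hI htc]
  have h1 : ∫ x in elem t, dualFn t z x * T.pw w x = ∫ x in elem t, dualFn t z x * w t := by
    refine integral_congr_ae ?_
    filter_upwards [T.pw_ae hI w htc] with x hx
    rw [hx]
  rw [h1, integral_mul_const, (T.isSimplex t htc).integral_dualFn hzt, one_mul]

/-- The oscillation of a piecewise constant function around an element. -/
def osc (w : Finset (Euc d) → ℝ) (t : Finset (Euc d)) : ℝ :=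
  ∑ z ∈ t, ∑ s ∈ T.star z, |w s - w t|

theorem osc_nonneg (w : Finset (Euc d) → ℝ) (t : Finset (Euc d)) : 0 ≤ T.osc w t :=
  Finset.sum_nonneg fun _ _ => Finset.sum_nonneg fun _ _ => abs_nonneg _

theorem sum_abs_nodal_sub_le (hI : interior (closure Ω) = Ω) (w : Finset (Euc d) → ℝ)
    {t : Finset (Euc d)} (ht : t ∈ T.cells) :
    ∑ z ∈ t, |T.nodal (T.pw w) z - w t| ≤ T.osc w t := by
  refine Finset.sum_le_sum fun z hz => ?_
  have hts : t ∈ T.star z := T.mem_star.2 ⟨ht, hz⟩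
  set S := ∑ t' ∈ T.star z, volume.real (elem t') with hS
  have hSpos : 0 < S := by
    refine lt_of_lt_of_le (T.isSimplex t ht).volume_pos ?_
    exact Finset.single_le_sum (f := fun t => volume.real (elem t))
      (fun _ _ => measureReal_nonneg) hts
  have h1 : T.nodal (T.pw w) z - w t
      = ∑ s ∈ T.star z, volume.real (elem s) / S * (w s - w t) := by
    rw [T.nodal_pw hI]
    simp only [mul_sub, Finset.sum_sub_distrib, ← Finset.sum_mul, ← Finset.sum_div]
    rw [← hS, div_self hSpos.ne', one_mul]
  rw [h1]
  refine (Finset.abs_sum_le_sum_abs _ _).trans (Finset.sum_le_sum fun s hs => ?_)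
  rw [abs_mul]
  refine mul_le_of_le_one_left (abs_nonneg _) ?_
  rw [abs_of_nonneg (div_nonneg measureReal_nonneg hSpos.le), div_le_one hSpos]
  exact Finset.single_le_sum (f := fun t => volume.real (elem t))
    (fun _ _ => measureReal_nonneg) hs

/-- The inverse of the lower bound of the mean value of a bubble function. -/
def bubbleConst (d : ℕ) : ℝ := ((1 / 2 : ℝ) ^ d * (1 / (2 * (d + 1))) ^ (d + 1))⁻¹

theorem bubbleConst_pos (d : ℕ) : 0 < bubbleConst d := by
  unfold bubbleConst
  positivity

theorem abs_bubbleCoef_pw_le (hI : interior (closure Ω) = Ω) (w : Finset (Euc d) → ℝ)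
    {t : Finset (Euc d)} (ht : t ∈ T.cells) :
    |T.bubbleCoef (T.pw w) t| ≤ bubbleConst d * T.osc w t := by
  have hS := T.isSimplex t ht
  have hv := hS.volume_pos
  have h0 := T.osc_nonneg w t
  have h1 : |⟪T.chi t, T.pw w - T.JBar (T.pw w)⟫_ℝ| ≤ T.osc w t * volume.real (elem t) := by
    rw [T.inner_chi hI ht, ← Real.norm_eq_abs]
    refine norm_setIntegral_le_of_norm_le_const_ae (volume_elem_ne_top t).lt_top ?_
    have h2 : ∀ᵐ x ∂volume.restrict Ω, (T.pw w - T.JBar (T.pw w) : L2 Ω) x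
        = T.pw w x - ∑ z ∈ T.nodes, T.nodal (T.pw w) z * T.hat z x := by
      rw [T.JBar_apply]
      filter_upwards [Lp.coeFn_sub (T.pw w) (∑ z ∈ T.nodes, T.nodal (T.pw w) z • T.hatL2 z),
        T.coeFn_sum_cls T.nodes (T.nodal (T.pw w)) T.bddMeas_hat] with x h1 h2
      rw [h1, Pi.sub_apply]
      exact congrArg _ h2
    filter_upwards [T.ae_elem hI ht h2, T.pw_ae hI w ht, ae_restrict_mem (measurableSet_elem t)]
      with x hx1 hx2 hxt
    have hxc := elem_subset t hxt
    rw [hx1, hx2, T.sum_hat_eq _ ht hxc]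
    have h3 : w t - ∑ z ∈ t, T.nodal (T.pw w) z * bary t z x
        = - ∑ z ∈ t, (T.nodal (T.pw w) z - w t) * bary t z x := by
      simp only [sub_mul, Finset.sum_sub_distrib, ← Finset.mul_sum, hS.sum_bary x]
      ring
    rw [h3, norm_neg, Real.norm_eq_abs]
    refine (Finset.abs_sum_le_sum_abs _ _).trans
      (le_trans (Finset.sum_le_sum fun z _ => ?_) (T.sum_abs_nodal_sub_le hI w ht))
    rw [abs_mul, abs_of_nonneg (bary_nonneg hxc z)]
    exact mul_le_of_le_one_right (abs_nonneg _) (hS.bary_le_one hxc z)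
  have h4 : bubbleConst d * ∫ x in elem t, T.bubble t x ≥ volume.real (elem t) := by
    rw [T.integral_bubble ht ht, if_pos rfl, bubbleConst, ge_iff_le, ← div_eq_inv_mul,
      le_div_iff₀ (by positivity), mul_comm]
    exact hS.le_integral_prod_bary
  have h5 := T.integral_bubble_pos ht
  rw [bubbleCoef, abs_mul, abs_of_pos (inv_pos.2 h5), inv_mul_le_iff₀ h5]
  calc _ ≤ T.osc w t * volume.real (elem t) := h1
    _ ≤ T.osc w t * (bubbleConst d * ∫ x in elem t, T.bubble t x) := by gcongr
    _ = _ := by ring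

/-- On each element, `P̄ w - w` is bounded by the oscillation of the piecewise constant function `w`
around the element, and its gradient by the oscillation divided by the diameter. -/
theorem ShapeRegular.localPBar_pw_le {T : Mesh Ω} (hd : 2 ≤ d)
    (hI : interior (closure Ω) = Ω) {κ : ℝ} (h : T.ShapeRegular κ) (w : Finset (Euc d) → ℝ)
    {t : Finset (Euc d)} (ht : t ∈ T.cells) {x : Euc d} (hx : x ∈ elem t) :
    |T.localPBar (T.pw w) t x - w t| ≤ (1 + bubbleConst d) * T.osc w t ∧
      ‖gradient (T.localPBar (T.pw w) t) x‖
        ≤ (1 + (d + 1) * bubbleConst d) * gradConst d κ / Metric.diam (elem t) * T.osc w t := by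
  classical
  have hS := T.isSimplex t ht
  have hxc := elem_subset t hx
  have hosc := T.osc_nonneg w t
  have hbc := bubbleConst_pos d
  set a := T.nodal (T.pw w) with ha
  set b := T.bubbleCoef (T.pw w) t with hb
  have hble : |b| ≤ bubbleConst d * T.osc w t := T.abs_bubbleCoef_pw_le hI w ht
  have hsum : ∑ z ∈ t, |a z - w t| ≤ T.osc w t := T.sum_abs_nodal_sub_le hI w ht
  have h0 : ∀ z, 0 ≤ bary t z x := bary_nonneg hxc
  have h1 : ∀ z, bary t z x ≤ 1 := hS.bary_le_one hxc
  -- partition of unity: the constant `w t` is split off, which leaves the deviations of the nodal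
  -- values from it
  have hform : T.localPBar (T.pw w) t = fun y => w t + (∑ z ∈ t, (a z - w t) * bary t z y
      + b * ∏ z ∈ t, bary t z y) := by
    funext y
    simp only [localPBar, sub_mul, Finset.sum_sub_distrib, ← Finset.mul_sum, hS.sum_bary y]
    ring
  refine ⟨?_, ?_⟩
  · rw [hform, add_sub_cancel_left]
    refine (abs_add_le _ _).trans ?_
    have h2 : |∑ z ∈ t, (a z - w t) * bary t z x| ≤ T.osc w t := by
      refine (Finset.abs_sum_le_sum_abs _ _).trans (le_trans (Finset.sum_le_sum fun z _ => ?_) hsum)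
      rw [abs_mul, abs_of_nonneg (h0 z)]
      exact mul_le_of_le_one_right (abs_nonneg _) (h1 z)
    have h3 : |b * ∏ z ∈ t, bary t z x| ≤ bubbleConst d * T.osc w t := by
      rw [abs_mul, abs_of_nonneg (Finset.prod_nonneg fun z _ => h0 z)]
      exact (mul_le_of_le_one_right (abs_nonneg _)
        (Finset.prod_le_one (fun z _ => h0 z) fun z _ => h1 z)).trans hble
    linarith
  · have hder : HasFDerivAt (T.localPBar (T.pw w) t)
        (∑ z ∈ t, (a z - w t) • innerSL ℝ (baryGrad t z)
          + b • ∑ z ∈ t, (∏ y ∈ t.erase z, bary t y x) • innerSL ℝ (baryGrad t z)) x := by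
      rw [hform]
      refine HasFDerivAt.const_add _ (HasFDerivAt.add ?_ ?_)
      · exact HasFDerivAt.fun_sum fun z _ => (hasFDerivAt_bary t z x).const_mul _
      · exact (HasFDerivAt.finsetProd fun z _ => hasFDerivAt_bary t z x).const_mul b
    set G := gradConst d κ / Metric.diam (elem t) with hG
    have hGb : ∀ z, ‖innerSL ℝ (baryGrad t z)‖ ≤ G := fun z => by
      rw [innerSL_apply_norm]; exact h.norm_baryGrad_le hd ht z
    have hG0 : 0 ≤ G := (norm_nonneg _).trans (hGb 0)
    rw [gradient, LinearIsometryEquiv.norm_map, hder.fderiv]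
    refine (norm_add_le _ _).trans ?_
    have h2 : ‖∑ z ∈ t, (a z - w t) • innerSL ℝ (baryGrad t z)‖ ≤ T.osc w t * G := by
      refine (norm_sum_le _ _).trans ?_
      calc ∑ z ∈ t, ‖(a z - w t) • innerSL ℝ (baryGrad t z)‖ ≤ ∑ z ∈ t, |a z - w t| * G := by
            refine Finset.sum_le_sum fun z _ => ?_
            rw [norm_smul, Real.norm_eq_abs]
            gcongr
            exact hGb z
        _ = (∑ z ∈ t, |a z - w t|) * G := by rw [Finset.sum_mul]
        _ ≤ _ := by gcongr
    have h3 : ‖∑ z ∈ t, (∏ y ∈ t.erase z, bary t y x) • innerSL ℝ (baryGrad t z)‖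
        ≤ (d + 1) * G := by
      refine (norm_sum_le _ _).trans ?_
      calc ∑ z ∈ t, ‖(∏ y ∈ t.erase z, bary t y x) • innerSL ℝ (baryGrad t z)‖
          ≤ ∑ z ∈ t, G := by
            refine Finset.sum_le_sum fun z _ => ?_
            rw [norm_smul, Real.norm_eq_abs, abs_of_nonneg (Finset.prod_nonneg fun y _ => h0 y)]
            exact (mul_le_of_le_one_left (norm_nonneg _)
              (Finset.prod_le_one (fun y _ => h0 y) fun y _ => h1 y)).trans (hGb z)
        _ = (d + 1) * G := by rw [Finset.sum_const, hS.1, nsmul_eq_mul]; push_cast; ring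
    rw [norm_smul, Real.norm_eq_abs]
    calc _ ≤ T.osc w t * G + (bubbleConst d * T.osc w t) * ((d + 1) * G) := by gcongr
      _ = (1 + (d + 1) * bubbleConst d) * G * T.osc w t := by ring
      _ = _ := by rw [hG]; ring

end Mesh

/-! ### Sums over the elements -/

theorem integral_sq_sub_le {α : Type*} [MeasurableSpace α] {μ : Measure α} [IsFiniteMeasure μ]
    {f g : α → ℝ} (hf : MemLp f 2 μ) (hg : MemLp g 2 μ) (c : ℝ) :
    ∫ x, (f x - g x) ^ 2 ∂μ ≤ 2 * (∫ x, (f x - c) ^ 2 ∂μ) + 2 * ∫ x, (g x - c) ^ 2 ∂μ := by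
  have h1 : Integrable (fun x => (f x - c) ^ 2) μ := (hf.sub (memLp_const c)).integrable_sq
  have h2 : Integrable (fun x => (g x - c) ^ 2) μ := (hg.sub (memLp_const c)).integrable_sq
  have h3 : Integrable (fun x => (f x - g x) ^ 2) μ := (hf.sub hg).integrable_sq
  rw [← integral_const_mul, ← integral_const_mul,
    ← integral_add (h1.const_mul 2) (h2.const_mul 2)]
  refine integral_mono h3 ((h1.const_mul 2).add (h2.const_mul 2)) fun x => ?_
  beta_reduce
  nlinarith [sq_nonneg ((f x - c) + (g x - c))]

namespace Mesh

variable {Ω : Set (Euc d)} (T : Mesh Ω)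

theorem memLp_elem {E : Type*} [NormedAddCommGroup E] (T : Mesh Ω)
    (hI : interior (closure Ω) = Ω) {t : Finset (Euc d)}
    (ht : t ∈ T.cells) (f : Lp E 2 (volume.restrict Ω)) : MemLp f 2 (volume.restrict (elem t)) :=
  (Lp.memLp f).mono_measure (Measure.restrict_mono (T.elem_subset_domain hI ht) le_rfl)

theorem sum_integral_sq (hI : interior (closure Ω) = Ω) (f : L2 Ω) :
    ∑ t ∈ T.cells, ∫ x in elem t, f x ^ 2 = ‖f‖ ^ 2 := by
  rw [norm_sq_L2, ← T.setIntegral_domain hI (Lp.memLp f).integrable_sq]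
  simp

theorem sum_energy (hI : interior (closure Ω) = Ω) (g : L2Vec Ω) :
    ∑ t ∈ T.cells, energy g t = ‖g‖ ^ 2 := by
  rw [norm_sq_L2, T.setIntegral_domain hI ((Lp.memLp g).integrable_norm_pow two_ne_zero)]
  rfl

theorem inner_eq_sum (hI : interior (closure Ω) = Ω) (f u : L2 Ω) :
    ⟪f, u⟫_ℝ = ∑ t ∈ T.cells, ∫ x in elem t, f x * u x := by
  have h1 : IntegrableOn (fun x => f x * u x) Ω := (Lp.memLp f).integrable_mul (Lp.memLp u)
  rw [L2.inner_def, ← T.setIntegral_domain hI h1]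
  refine integral_congr_ae (Filter.Eventually.of_forall fun x => ?_)
  simp [mul_comm]

/-- The energy in the union of the stars of the vertices of `t`, where each element is counted as
often as it shares a vertex with `t`. -/
def starEnergy (g : Euc d → Euc d) (t : Finset (Euc d)) : ℝ :=
  ∑ z ∈ t, ∑ r ∈ T.star z, energy g r

theorem starEnergy_nonneg (g : Euc d → Euc d) (t : Finset (Euc d)) : 0 ≤ T.starEnergy g t :=
  Finset.sum_nonneg fun _ _ => Finset.sum_nonneg fun r _ => energy_nonneg g r

theorem energy_le_starEnergy (g : Euc d → Euc d) {t : Finset (Euc d)} (ht : t ∈ T.cells) :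
    energy g t ≤ T.starEnergy g t := by
  obtain ⟨z, hz⟩ : t.Nonempty := by
    rw [← Finset.card_pos, (T.isSimplex t ht).1]
    omega
  refine le_trans ?_ (Finset.single_le_sum (f := fun z => ∑ r ∈ T.star z, energy g r)
    (fun z _ => Finset.sum_nonneg fun r _ => energy_nonneg g r) hz)
  exact Finset.single_le_sum (f := energy g) (fun r _ => energy_nonneg g r)
    (T.mem_star.2 ⟨ht, hz⟩)

/-- The stars overlap only finitely often. -/
theorem sum_starEnergy_le {N : ℝ} (hN : ∀ z, ((T.star z).card : ℝ) ≤ N) (g : Euc d → Euc d) :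
    ∑ t ∈ T.cells, T.starEnergy g t ≤ (d + 1) * N * ∑ r ∈ T.cells, energy g r := by
  classical
  have h1 : ∀ t ∈ T.cells, T.starEnergy g t
      = ∑ r ∈ T.cells, ∑ z ∈ r, if z ∈ t then energy g r else 0 := fun t ht => by
    have h2 : ∀ z, ∑ r ∈ T.star z, energy g r = ∑ r ∈ T.cells, if z ∈ r then energy g r else 0 :=
      fun z => by
        rw [← Finset.sum_filter]
        refine Finset.sum_congr (Finset.ext fun r => ?_) fun _ _ => rfl
        rw [T.mem_star, Finset.mem_filter]
    rw [starEnergy, Finset.sum_congr rfl fun z _ => h2 z, Finset.sum_comm]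
    refine Finset.sum_congr rfl fun r _ => ?_
    rw [← Finset.sum_filter, ← Finset.sum_filter]
    refine Finset.sum_congr (Finset.ext fun z => ?_) fun _ _ => rfl
    rw [Finset.mem_filter, Finset.mem_filter, and_comm]
  rw [Finset.sum_congr rfl h1, Finset.sum_comm, Finset.mul_sum]
  refine Finset.sum_le_sum fun r hr => ?_
  rw [Finset.sum_comm]
  have h3 : ∀ z ∈ r, ∑ t ∈ T.cells, (if z ∈ t then energy g r else 0) ≤ N * energy g r :=
    fun z _ => by
      rw [← Finset.sum_filter, Finset.sum_const, nsmul_eq_mul]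
      refine mul_le_mul_of_nonneg_right (le_trans (le_of_eq ?_) (hN z)) (energy_nonneg g r)
      congr 2
  refine (Finset.sum_le_sum h3).trans (le_of_eq ?_)
  rw [Finset.sum_const, (T.isSimplex r hr).1, nsmul_eq_mul]
  push_cast
  ring

/-! ### Stability and approximation of the smoothing operator -/

/-- The constant in the bounds of `P̄ w - w` and its gradient by the oscillation of a piecewise
constant function `w`. -/
def smoothConst (d : ℕ) (κ : ℝ) : ℝ := ((1 + (d + 1) * bubbleConst d) * gradConst d κ) ^ 2

theorem smoothConst_nonneg (d : ℕ) (κ : ℝ) : 0 ≤ smoothConst d κ := sq_nonneg _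

/-- The pointwise bounds of `P̄ w - w` and of its gradient, integrated over an element. -/
theorem ShapeRegular.exists_H1_PBar_pw {T : Mesh Ω} (hd : 2 ≤ d) (hΩ : IsOpen Ω)
    (hI : interior (closure Ω) = Ω) {κ : ℝ} (h : T.ShapeRegular κ) (w : Finset (Euc d) → ℝ) :
    ∃ W : H1 Ω, W.1.fst = T.PBar (T.pw w) ∧ ∀ t ∈ T.cells,
      (∫ x in elem t, (W.1.fst x - w t) ^ 2)
        ≤ smoothConst d κ * T.osc w t ^ 2 * volume.real (elem t) ∧
      Metric.diam (elem t) ^ 2 * energy W.1.snd t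
        ≤ smoothConst d κ * T.osc w t ^ 2 * volume.real (elem t) := by
  obtain ⟨W, hW, hloc⟩ := T.exists_H1_PBar hΩ hI (T.pw w)
  refine ⟨W, hW, fun t ht => ?_⟩
  have hS := T.isSimplex t ht
  have hdp := hS.diam_pos hd
  have hbc := bubbleConst_pos d
  have hgc := one_le_gradConst d κ
  have hosc := T.osc_nonneg w t
  have hd1 : (1 : ℝ) ≤ d + 1 := by linarith [(Nat.cast_nonneg d : (0 : ℝ) ≤ d)]
  have hb : ∀ᵐ x ∂volume.restrict (elem t),
      |W.1.fst x - w t| ≤ (1 + bubbleConst d) * T.osc w t ∧ ‖W.1.snd x‖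
        ≤ (1 + (d + 1) * bubbleConst d) * gradConst d κ / Metric.diam (elem t) * T.osc w t := by
    filter_upwards [hloc t ht, ae_restrict_mem (measurableSet_elem t)] with x hx hxt
    rw [hx.1, hx.2]
    exact h.localPBar_pw_le hd hI w ht hxt
  have hfin := (volume_elem_ne_top t).lt_top
  constructor
  · refine (Real.le_norm_self _).trans ((norm_setIntegral_le_of_norm_le_const_ae
      (C := smoothConst d κ * T.osc w t ^ 2) hfin ?_))
    filter_upwards [hb] with x hx
    rw [norm_pow, Real.norm_eq_abs, smoothConst, ← mul_pow]
    refine pow_le_pow_left₀ (abs_nonneg _) (hx.1.trans ?_) 2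
    refine mul_le_mul_of_nonneg_right ?_ hosc
    nlinarith [mul_nonneg hbc.le (sub_nonneg.2 hd1),
      mul_nonneg (mul_pos (by linarith : (0:ℝ) < d + 1) hbc).le (sub_nonneg.2 hgc)]
  · have h1 : energy W.1.snd t ≤ smoothConst d κ * T.osc w t ^ 2 / Metric.diam (elem t) ^ 2
        * volume.real (elem t) := by
      refine (Real.le_norm_self _).trans ((norm_setIntegral_le_of_norm_le_const_ae hfin ?_))
      filter_upwards [hb] with x hx
      rw [norm_pow, norm_norm]
      refine (pow_le_pow_left₀ (norm_nonneg _) hx.2 2).trans (le_of_eq ?_)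
      rw [smoothConst]
      ring
    calc _ ≤ Metric.diam (elem t) ^ 2 * (smoothConst d κ * T.osc w t ^ 2
          / Metric.diam (elem t) ^ 2 * volume.real (elem t)) := by gcongr
      _ = _ := by field_simp

/-- On each element, `P̄ Π⁰ v` approximates `v` to first order and has a bounded gradient, in terms
of the energy of `v` in the surrounding elements. -/
theorem exists_const_smoothing (hd : 2 ≤ d) {κ : ℝ} (hκ : 0 ≤ κ) :
    ∃ C : ℝ, 1 ≤ C ∧ ∀ {Ω : Set (Euc d)} (_ : IsBoundedLipschitz Ω) (T : Mesh Ω),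
      T.ShapeRegular κ → ∀ v : H1 Ω, ∃ W : H1 Ω, W.1.fst = T.PBar (T.Pi0 v.1.fst) ∧
        ∑ t ∈ T.cells, T.starEnergy v.1.snd t ≤ C * ‖v.1.snd‖ ^ 2 ∧
        ∀ t ∈ T.cells,
          (∫ x in elem t, (v.1.fst - W.1.fst : L2 Ω) x ^ 2)
            ≤ C * (Metric.diam (elem t) ^ 2 * T.starEnergy v.1.snd t) ∧
          energy W.1.snd t ≤ C * T.starEnergy v.1.snd t := by
  obtain ⟨N, hN1, hN⟩ := exists_const_star hd hκ
  have hN0 : 0 ≤ N := by linarith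
  set K := smoothConst d κ * ((d + 1) ^ 2 * N ^ 3) with hK
  have hK0 : 0 ≤ K := mul_nonneg (smoothConst_nonneg d κ) (by positivity)
  have hB0 : 0 ≤ ballVol d * κ := mul_nonneg (ballVol_pos d).le hκ
  have hd0 : (0 : ℝ) ≤ (d + 1) * N := by positivity
  refine ⟨1 + (d + 1) * N + 2 * (ballVol d * κ) + 2 * K, by linarith, ?_⟩
  intro Ω hΩ T h v
  have hI := hΩ.interior_closure
  have hv := HasWeakGrad.of_H1 v
  obtain ⟨g, hg⟩ : ∃ g : Euc d → Euc d, g = ⇑v.1.snd := ⟨_, rfl⟩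
  rw [← hg] at hv ⊢
  set w : Finset (Euc d) → ℝ := fun t => avg (elem t) v.1.fst with hw
  obtain ⟨W, hW, hloc⟩ := h.exists_H1_PBar_pw hd hΩ.1 hI w
  refine ⟨W, by rw [hW, T.Pi0_apply hI], ?_, fun t ht => ?_⟩
  · refine (T.sum_starEnergy_le (fun z => (hN hΩ T h z).1) g).trans ?_
    rw [hg, T.sum_energy hI]
    refine mul_le_mul_of_nonneg_right ?_ (sq_nonneg _)
    linarith
  have hS := T.isSimplex t ht
  have hdp := hS.diam_pos hd
  have hvp := hS.volume_pos
  set E := T.starEnergy g t with hE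
  have hE0 : 0 ≤ E := T.starEnergy_nonneg g t
  have hsc := scale_nonneg t
  -- the oscillation of the mean values is a sum over at most `(d + 1) N` pairs of elements with a
  -- common vertex
  have hosc : T.osc w t ^ 2 ≤ (d + 1) ^ 2 * N ^ 3 * (scale t * E) := by
    have h1 : ∀ z ∈ t, ∀ s ∈ T.star z, |w s - w t| ≤ √(N * scale t * E) := fun z hz s hs => by
      refine Real.abs_le_sqrt ?_
      have h2 := ((hN hΩ T h z).2 t (T.mem_star.2 ⟨ht, hz⟩) s hs).2 hv
      rw [← neg_sq, neg_sub]
      refine h2.trans (mul_le_mul_of_nonneg_left ?_ (by positivity))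
      exact Finset.single_le_sum (f := fun z => ∑ r ∈ T.star z, energy g r)
        (fun z _ => Finset.sum_nonneg fun r _ => energy_nonneg g r) hz
    have h2 : T.osc w t ≤ (d + 1) * (N * √(N * scale t * E)) := by
      calc T.osc w t ≤ ∑ z ∈ t, N * √(N * scale t * E) := by
            refine Finset.sum_le_sum fun z hz => (Finset.sum_le_sum (h1 z hz)).trans ?_
            rw [Finset.sum_const, nsmul_eq_mul]
            exact mul_le_mul_of_nonneg_right (hN hΩ T h z).1 (Real.sqrt_nonneg _)
        _ = _ := by
            rw [Finset.sum_const, hS.1, nsmul_eq_mul]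
            push_cast
            ring
    refine (pow_le_pow_left₀ (T.osc_nonneg w t) h2 2).trans (le_of_eq ?_)
    rw [mul_pow, mul_pow, Real.sq_sqrt (by positivity)]
    ring
  have hsv : scale t * volume.real (elem t) = Metric.diam (elem t) ^ 2 := by
    rw [scale, div_mul_cancel₀ _ hvp.ne']
  have hbound : smoothConst d κ * T.osc w t ^ 2 * volume.real (elem t)
      ≤ Metric.diam (elem t) ^ 2 * (K * E) := by
    have := smoothConst_nonneg d κ
    calc _ ≤ smoothConst d κ * ((d + 1) ^ 2 * N ^ 3 * (scale t * E)) * volume.real (elem t) := by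
          gcongr
      _ = K * E * (scale t * volume.real (elem t)) := by rw [hK]; ring
      _ = _ := by rw [hsv]; ring
  obtain ⟨hl1, hl2⟩ := hloc t ht
  have hD2 : 0 < Metric.diam (elem t) ^ 2 := by positivity
  constructor
  · have : IsFiniteMeasure (volume.restrict (elem t)) :=
      ⟨by rw [Measure.restrict_apply_univ]; exact (volume_elem_ne_top t).lt_top⟩
    have h1 : ∫ x in elem t, (v.1.fst - W.1.fst : L2 Ω) x ^ 2
        = ∫ x in elem t, (v.1.fst x - W.1.fst x) ^ 2 := by
      refine integral_congr_ae ?_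
      filter_upwards [T.ae_elem hI ht (Lp.coeFn_sub v.1.fst W.1.fst)] with x hx
      rw [hx, Pi.sub_apply]
    rw [h1]
    have h2 := integral_sq_sub_le (T.memLp_elem hI ht v.1.fst) (T.memLp_elem hI ht W.1.fst) (w t)
    have h3 := h.integral_sq_sub_avg_le hI ht hv
    have h4 : Metric.diam (elem t) ^ 2 * energy g t ≤ Metric.diam (elem t) ^ 2 * E :=
      mul_le_mul_of_nonneg_left (T.energy_le_starEnergy g ht) hD2.le
    have h5 : ballVol d * κ * (Metric.diam (elem t) ^ 2 * energy g t)
        ≤ ballVol d * κ * (Metric.diam (elem t) ^ 2 * E) := mul_le_mul_of_nonneg_left h4 hB0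
    have h6 : 0 ≤ (1 + (d + 1) * N) * (Metric.diam (elem t) ^ 2 * E) := by positivity
    calc _ ≤ _ := h2
      _ ≤ 2 * (ballVol d * κ * (Metric.diam (elem t) ^ 2 * E))
          + 2 * (Metric.diam (elem t) ^ 2 * (K * E)) := by
          linarith [h3, h5, hl1.trans hbound]
      _ ≤ _ := by linarith
  · have h1 : energy W.1.snd t ≤ K * E := le_of_mul_le_mul_left (hl2.trans hbound) hD2
    refine h1.trans (mul_le_mul_of_nonneg_right ?_ hE0)
    linarith

/-- The bound of `P̄ χ_T`, which vanishes outside the patch of `T`. -/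
theorem exists_const_smoothing_chi (hd : 2 ≤ d) {κ : ℝ} (hκ : 0 ≤ κ) :
    ∃ C : ℝ, 1 ≤ C ∧ ∀ {Ω : Set (Euc d)} (_ : IsBoundedLipschitz Ω) (T : Mesh Ω),
      T.ShapeRegular κ → ∀ t ∈ T.cells, ∃ W : H1 Ω, W.1.fst = T.PBar (T.chi t) ∧
        (∀ s ∈ T.cells, s ∉ T.patch (elem t) →
          ∀ᵐ x ∂volume.restrict (elem s), W.1.fst x = 0 ∧ W.1.snd x = 0) ∧
        ‖W.1.fst‖ ^ 2 ≤ C * volume.real (elem t) ∧ scale t * ‖W.1.snd‖ ^ 2 ≤ C := by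
  classical
  obtain ⟨N, hN1, hN⟩ := exists_const_star hd hκ
  have hN0 : 0 ≤ N := by linarith
  set K := 2 * (smoothConst d κ * ((d + 1) * N) ^ 2 + 1) with hK
  have hsm := smoothConst_nonneg d κ
  have hK0 : 0 ≤ K := by positivity
  have hbv := (ballVol_pos d).le
  set L := (d + 1) * N * (K * (ballVol d * N ^ d * κ)) with hL
  have hL0 : 0 ≤ L := by positivity
  refine ⟨1 + L + N ^ 2 * L, by nlinarith [mul_nonneg (sq_nonneg N) hL0], ?_⟩
  intro Ω hΩ T h t ht
  have hI := hΩ.interior_closure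
  set w : Finset (Euc d) → ℝ := fun s => if s = t then 1 else 0 with hw
  have hpw : T.pw w = T.chi t := by
    simp [pw, hw, ht]
  obtain ⟨W, hW, hloc⟩ := h.exists_H1_PBar_pw hd hΩ.1 hI w
  have hSt := T.isSimplex t ht
  have hdt := hSt.diam_pos hd
  have hvt := hSt.volume_pos
  have hosc : ∀ s ∈ T.cells, T.osc w s ≤ (d + 1) * N := fun s hs => by
    calc T.osc w s ≤ ∑ z ∈ s, N := by
          refine Finset.sum_le_sum fun z _ => ?_
          have h1 : ∑ r ∈ T.star z, |w r - w s| ≤ ∑ r ∈ T.star z, (1 : ℝ) :=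
            Finset.sum_le_sum fun r _ => by
              simp only [hw]
              split_ifs <;> simp
          exact h1.trans (by simpa using (hN hΩ T h z).1)
      _ = (d + 1) * N := by
          rw [Finset.sum_const, (T.isSimplex s hs).1, nsmul_eq_mul]
          push_cast
          ring
  -- `χ_T` vanishes on all elements that share a vertex with an element outside the patch of `T`
  have hout : ∀ s ∈ T.cells, s ∉ T.patch (elem t) → w s = 0 ∧ T.osc w s = 0 := fun s hs hst => by
    rw [T.mem_patch_elem ht, not_and] at hst
    have hst := hst hs
    have h1 : w s = 0 := if_neg fun hh => by
      obtain ⟨z, hz⟩ : t.Nonempty := by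
        rw [← Finset.card_pos, hSt.1]
        omega
      exact hst ⟨z, hh ▸ hz, hz⟩
    refine ⟨h1, Finset.sum_eq_zero fun z hz => Finset.sum_eq_zero fun r hr => ?_⟩
    have h2 : w r = 0 := if_neg fun hh : r = t => hst ⟨z, hz, hh ▸ (T.mem_star.1 hr).2⟩
    rw [h1, h2, sub_zero, abs_zero]
  have hsz : ∀ s ∈ T.patch (elem t), Metric.diam (elem s) ≤ N * Metric.diam (elem t) ∧
      Metric.diam (elem t) ≤ N * Metric.diam (elem s) ∧
      volume.real (elem s) ≤ ballVol d * N ^ d * κ * volume.real (elem t) := fun s hs => by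
    obtain ⟨hsc, z, hzs, hzt⟩ := (T.mem_patch_elem ht).1 hs
    have h1 := ((hN hΩ T h z).2 s (T.mem_star.2 ⟨hsc, hzs⟩) t (T.mem_star.2 ⟨ht, hzt⟩)).1
    have h2 := ((hN hΩ T h z).2 t (T.mem_star.2 ⟨ht, hzt⟩) s (T.mem_star.2 ⟨hsc, hzs⟩)).1
    refine ⟨h1, h2, ?_⟩
    calc volume.real (elem s) ≤ Metric.diam (elem s) ^ d * ballVol d :=
          (T.isSimplex s hsc).volume_le
      _ ≤ (N * Metric.diam (elem t)) ^ d * ballVol d := by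
          gcongr
      _ = ballVol d * N ^ d * Metric.diam (elem t) ^ d := by ring
      _ ≤ ballVol d * N ^ d * (κ * volume.real (elem t)) :=
          mul_le_mul_of_nonneg_left (h t ht) (by positivity)
      _ = _ := by ring
  have hcard : ((T.patch (elem t)).card : ℝ) ≤ (d + 1) * N := by
    have h1 : T.patch (elem t) ⊆ t.biUnion T.star := fun s hs => by
      obtain ⟨hsc, z, hzs, hzt⟩ := (T.mem_patch_elem ht).1 hs
      exact Finset.mem_biUnion.2 ⟨z, hzt, T.mem_star.2 ⟨hsc, hzs⟩⟩
    have h2 : ((T.patch (elem t)).card : ℝ) ≤ ∑ z ∈ t, ((T.star z).card : ℝ) := by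
      exact_mod_cast (Finset.card_le_card h1).trans Finset.card_biUnion_le
    refine h2.trans ((Finset.sum_le_sum fun z _ => (hN hΩ T h z).1).trans (le_of_eq ?_))
    rw [Finset.sum_const, hSt.1, nsmul_eq_mul]
    push_cast
    ring
  have hfin : ∀ s : Finset (Euc d), IsFiniteMeasure (volume.restrict (elem s)) := fun s =>
    ⟨by rw [Measure.restrict_apply_univ]; exact (volume_elem_ne_top s).lt_top⟩
  have hsq : ∀ s ∈ T.cells, smoothConst d κ * T.osc w s ^ 2 * volume.real (elem s)
      ≤ smoothConst d κ * ((d + 1) * N) ^ 2 * volume.real (elem s) := fun s hs => by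
    have h1 := hosc s hs
    have h2 := T.osc_nonneg w s
    gcongr
  have hzero : ∀ s ∈ T.cells, s ∉ T.patch (elem t) →
      ∀ᵐ x ∂volume.restrict (elem s), W.1.fst x = 0 ∧ W.1.snd x = 0 := fun s hs hst => by
    obtain ⟨h1, h2⟩ := hout s hs hst
    obtain ⟨h3, h4⟩ := hloc s hs
    rw [h1, h2] at h3
    rw [h2] at h4
    simp only [sub_zero, ne_eq, OfNat.ofNat_ne_zero, not_false_eq_true, zero_pow, mul_zero,
      zero_mul] at h3 h4
    have hds := (T.isSimplex s hs).diam_pos hd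
    have h5 : ∫ x in elem s, W.1.fst x ^ 2 = 0 :=
      le_antisymm h3 (integral_nonneg fun x => sq_nonneg _)
    have h6 : ∫ x in elem s, ‖W.1.snd x‖ ^ 2 = 0 :=
      le_antisymm (nonpos_of_mul_nonpos_right h4 (by positivity)) (energy_nonneg _ s)
    rw [integral_eq_zero_iff_of_nonneg (fun x => sq_nonneg _)
      (T.memLp_elem hI hs W.1.fst).integrable_sq] at h5
    rw [integral_eq_zero_iff_of_nonneg (fun x => sq_nonneg _)
      ((T.memLp_elem hI hs W.1.snd).integrable_norm_pow two_ne_zero)] at h6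
    filter_upwards [h5, h6] with x h5 h6
    exact ⟨by simpa using h5, by simpa using h6⟩
  have hin1 : ∀ s ∈ T.patch (elem t), ∫ x in elem s, W.1.fst x ^ 2
      ≤ K * (ballVol d * N ^ d * κ) * volume.real (elem t) := fun s hs => by
    have hsc := T.patch_subset _ hs
    have := hfin s
    have h1 := integral_sq_sub_le (memLp_const (0 : ℝ)) (T.memLp_elem hI hsc W.1.fst) (w s)
    have h2 := (hloc s hsc).1.trans (hsq s hsc)
    have h3 : ∫ x in elem s, ((0 : ℝ) - w s) ^ 2 ≤ 1 * volume.real (elem s) := by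
      rw [setIntegral_const, smul_eq_mul, mul_comm]
      refine mul_le_mul_of_nonneg_right ?_ measureReal_nonneg
      simp only [hw]
      split_ifs <;> simp
    have h4 : ∫ x in elem s, ((0 : ℝ) - W.1.fst x) ^ 2 = ∫ x in elem s, W.1.fst x ^ 2 := by
      simp
    rw [h4] at h1
    calc _ ≤ K * volume.real (elem s) := by rw [hK]; linarith
      _ ≤ K * (ballVol d * N ^ d * κ * volume.real (elem t)) := by
          gcongr
          exact (hsz s hs).2.2
      _ = _ := by ring
  have hin2 : ∀ s ∈ T.patch (elem t), Metric.diam (elem t) ^ 2 * energy W.1.snd s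
      ≤ N ^ 2 * (K * (ballVol d * N ^ d * κ)) * volume.real (elem t) := fun s hs => by
    have hsc := T.patch_subset _ hs
    have h2 := (hloc s hsc).2.trans (hsq s hsc)
    have he := energy_nonneg W.1.snd s
    have hds := (T.isSimplex s hsc).diam_pos hd
    calc Metric.diam (elem t) ^ 2 * energy W.1.snd s
        ≤ (N * Metric.diam (elem s)) ^ 2 * energy W.1.snd s := by
          gcongr
          exact (hsz s hs).2.1
      _ = N ^ 2 * (Metric.diam (elem s) ^ 2 * energy W.1.snd s) := by ring
      _ ≤ N ^ 2 * (K * volume.real (elem s)) := by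
          refine mul_le_mul_of_nonneg_left (h2.trans ?_) (sq_nonneg N)
          refine mul_le_mul_of_nonneg_right ?_ measureReal_nonneg
          rw [hK]
          nlinarith [mul_nonneg hsm (sq_nonneg ((d + 1) * N))]
      _ ≤ N ^ 2 * (K * (ballVol d * N ^ d * κ * volume.real (elem t))) := by
          gcongr
          exact (hsz s hs).2.2
      _ = _ := by ring
  refine ⟨W, by rw [hW, hpw], hzero, ?_, ?_⟩
  · rw [← T.sum_integral_sq hI, ← Finset.sum_subset (T.patch_subset (elem t)) fun s hs hst => by
      rw [← integral_zero (Euc d) ℝ (μ := volume.restrict (elem s))]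
      refine integral_congr_ae ?_
      filter_upwards [hzero s hs hst] with x hx
      rw [hx.1]
      simp]
    refine (Finset.sum_le_sum hin1).trans ?_
    rw [Finset.sum_const, nsmul_eq_mul]
    calc _ ≤ ((d + 1) * N) * (K * (ballVol d * N ^ d * κ) * volume.real (elem t)) := by gcongr
      _ = L * volume.real (elem t) := by rw [hL]; ring
      _ ≤ _ := by
        refine mul_le_mul_of_nonneg_right ?_ measureReal_nonneg
        nlinarith [mul_nonneg (sq_nonneg N) hL0]
  · rw [← T.sum_energy hI, ← Finset.sum_subset (T.patch_subset (elem t)) fun s hs hst => by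
      rw [energy, ← integral_zero (Euc d) ℝ (μ := volume.restrict (elem s))]
      refine integral_congr_ae ?_
      filter_upwards [hzero s hs hst] with x hx
      rw [hx.2]
      simp]
    rw [scale, div_mul_eq_mul_div, div_le_iff₀ hvt, Finset.mul_sum]
    refine (Finset.sum_le_sum hin2).trans ?_
    rw [Finset.sum_const, nsmul_eq_mul]
    calc _ ≤ ((d + 1) * N) * (N ^ 2 * (K * (ballVol d * N ^ d * κ)) * volume.real (elem t)) := by
          gcongr
      _ = N ^ 2 * L * volume.real (elem t) := by rw [hL]; ring
      _ ≤ _ := by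
        refine mul_le_mul_of_nonneg_right ?_ measureReal_nonneg
        linarith

end Mesh

/-! ### Norms, extension by zero, and restriction -/

theorem toHTilde_apply {Ω : Set (Euc d)} (φ : L2 Ω) (v : H1 Ω) :
    toHTilde φ v = ⟪φ, v.1.fst⟫_ℝ := rfl

theorem H1.norm_sq {Ω : Set (Euc d)} (v : H1 Ω) : ‖v‖ ^ 2 = ‖v.1.fst‖ ^ 2 + ‖v.1.snd‖ ^ 2 :=
  WithLp.prod_norm_sq_eq_of_L2 v.1

theorem H1.norm_fst_le {Ω : Set (Euc d)} (v : H1 Ω) : ‖v.1.fst‖ ≤ ‖v‖ := by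
  rw [← pow_le_pow_iff_left₀ (norm_nonneg _) (norm_nonneg _) two_ne_zero, H1.norm_sq]
  linarith [sq_nonneg ‖v.1.snd‖]

theorem H1.norm_snd_le {Ω : Set (Euc d)} (v : H1 Ω) : ‖v.1.snd‖ ≤ ‖v‖ := by
  rw [← pow_le_pow_iff_left₀ (norm_nonneg _) (norm_nonneg _) two_ne_zero, H1.norm_sq]
  linarith [sq_nonneg ‖v.1.fst‖]

theorem H1.norm_le {Ω : Set (Euc d)} (v : H1 Ω) : ‖v‖ ≤ ‖v.1.fst‖ + ‖v.1.snd‖ := by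
  rw [← pow_le_pow_iff_left₀ (norm_nonneg _) (by positivity) two_ne_zero, H1.norm_sq]
  nlinarith [mul_nonneg (norm_nonneg v.1.fst) (norm_nonneg v.1.snd)]

theorem eLpNorm_two_eq {α E : Type*} [MeasurableSpace α] {μ : Measure α} [NormedAddCommGroup E]
    [InnerProductSpace ℝ E] {f : α → E} (hf : MemLp f 2 μ) :
    eLpNorm f 2 μ = ENNReal.ofReal √(∫ x, ‖f x‖ ^ 2 ∂μ) := by
  rw [← norm_sq_toLp hf, Real.sqrt_sq (norm_nonneg _), Lp.norm_toLp,
    ENNReal.ofReal_toReal hf.2.ne]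

/-- The extension by zero of a function of `H¹_{Γ,c}(G)` belongs to `H¹(Ω)`. -/
theorem H1c.exists_extend {Ω G : Set (Euc d)} (hG : MeasurableSet G) (hGΩ : G ⊆ Ω)
    (p : H1c Ω G) : ∃ q : H1 Ω, q.1.fst =ᵐ[volume.restrict Ω] G.indicator p.1.fst ∧
      q.1.snd =ᵐ[volume.restrict Ω] G.indicator p.1.snd := by
  have hres : (volume.restrict Ω).restrict G = volume.restrict G := by
    rw [Measure.restrict_restrict hG, inter_eq_left.2 hGΩ]
  have m1 : MemLp (G.indicator p.1.fst) 2 (volume.restrict Ω) := by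
    rw [memLp_indicator_iff_restrict hG, hres]
    exact Lp.memLp _
  have m2 : MemLp (G.indicator p.1.snd) 2 (volume.restrict Ω) := by
    rw [memLp_indicator_iff_restrict hG, hres]
    exact Lp.memLp _
  refine ⟨⟨WithLp.toLp 2 (m1.toLp _, m2.toLp _), ?_⟩, m1.coeFn_toLp, m2.coeFn_toLp⟩
  intro ψ hψ e
  have h := p.2.2 ψ hψ e
  have h1 : ∫ x in Ω, G.indicator p.1.fst x * fderiv ℝ ψ x e
      = ∫ x in G, p.1.fst x * fderiv ℝ ψ x e := by
    have : (fun x => G.indicator p.1.fst x * fderiv ℝ ψ x e)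
        = G.indicator fun x => p.1.fst x * fderiv ℝ ψ x e := by
      funext x
      by_cases hx : x ∈ G <;> simp [hx]
    rw [this, setIntegral_indicator hG, inter_eq_right.2 hGΩ]
  have h2 : ∫ x in Ω, ⟪e, G.indicator p.1.snd x⟫_ℝ * ψ x = ∫ x in G, ⟪e, p.1.snd x⟫_ℝ * ψ x := by
    have : (fun x => ⟪e, G.indicator p.1.snd x⟫_ℝ * ψ x)
        = G.indicator fun x => ⟪e, p.1.snd x⟫_ℝ * ψ x := by
      funext x
      by_cases hx : x ∈ G <;> simp [hx]
    rw [this, setIntegral_indicator hG, inter_eq_right.2 hGΩ]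
  rw [← h1, ← h2] at h
  refine Eq.trans (Eq.trans (integral_congr_ae ?_) h) (congrArg Neg.neg (integral_congr_ae ?_))
  · filter_upwards [m1.coeFn_toLp] with x hx
    rw [← hx]
    rfl
  · filter_upwards [m2.coeFn_toLp] with x hx
    rw [← hx]
    rfl

/-- The restriction to `G` of a function of `H¹(Ω)` that vanishes outside `G` belongs to
`H¹_{Γ,c}(G)`. -/
theorem H1.exists_restrict {Ω G : Set (Euc d)} (hΩ : IsOpen Ω) (hGΩ : G ⊆ Ω)
    (q : H1 Ω) (h0 : ∀ᵐ x ∂volume.restrict Ω, x ∉ G → q.1.fst x = 0 ∧ q.1.snd x = 0) :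
    ∃ p : H1c Ω G, p.1.fst =ᵐ[volume.restrict G] q.1.fst ∧
      p.1.snd =ᵐ[volume.restrict G] q.1.snd := by
  have hle : volume.restrict G ≤ volume.restrict Ω := Measure.restrict_mono hGΩ le_rfl
  have m1 : MemLp q.1.fst 2 (volume.restrict G) := (Lp.memLp _).mono_measure hle
  have m2 : MemLp q.1.snd 2 (volume.restrict G) := (Lp.memLp _).mono_measure hle
  have h0' := (ae_restrict_iff' hΩ.measurableSet).1 h0
  have hgreen : (WithLp.toLp 2 (m1.toLp _, m2.toLp _) : WithLp 2 (L2 G × L2Vec G))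
      ∈ greenSpace Ω G := by
    intro ψ hψ e
    have h := q.2 ψ hψ e
    rw [setIntegral_eq_of_subset_of_ae_sdiff_eq_zero hΩ.measurableSet.nullMeasurableSet hGΩ (by
        filter_upwards [h0'] with x hx hx'
        rw [(hx hx'.1 hx'.2).1, zero_mul]),
      setIntegral_eq_of_subset_of_ae_sdiff_eq_zero hΩ.measurableSet.nullMeasurableSet hGΩ (by
        filter_upwards [h0'] with x hx hx'
        rw [(hx hx'.1 hx'.2).2, inner_zero_right, zero_mul])] at h
    refine Eq.trans (Eq.trans (integral_congr_ae ?_) h) (congrArg Neg.neg (integral_congr_ae ?_))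
    · filter_upwards [m1.coeFn_toLp] with x hx
      rw [← hx]
      rfl
    · filter_upwards [m2.coeFn_toLp] with x hx
      rw [← hx]
      rfl
  exact ⟨⟨_, fun ψ hψ => hgreen ψ (hψ.mono hGΩ), hgreen⟩, m1.coeFn_toLp, m2.coeFn_toLp⟩

namespace Mesh

variable {Ω : Set (Euc d)} (T : Mesh Ω)

/-! ### The operator on the dual space -/

/-- Since the range of `P̄` is a finite-dimensional subspace of `H¹(Ω)`, the functional
`u ↦ ⟨φ, P̄ u⟩` is continuous on all of `L²(Ω)`. -/
theorem exists_PBar_dual (hΩ : IsOpen Ω) (hI : interior (closure Ω) = Ω) (φ : HTilde Ω) :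
    ∃ g : L2 Ω, ∀ (u : L2 Ω) (W : H1 Ω), W.1.fst = T.PBar u → ⟪g, u⟫_ℝ = φ W := by
  have hex : ∀ y : T.PBar.range, ∃ W : H1 Ω, W.1.fst = y.1 := by
    rintro ⟨_, u, rfl⟩
    obtain ⟨W, hW, -⟩ := T.exists_H1_PBar hΩ hI u
    exact ⟨W, hW⟩
  have hfin : FiniteDimensional ℝ T.PBar.range := by
    have hspan : FiniteDimensional ℝ (Submodule.span ℝ
        ((T.hatL2 '' T.nodes) ∪ (T.bubbleL2 '' T.cells))) :=
      FiniteDimensional.span_of_finite ℝ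
        ((T.nodes.finite_toSet.image _).union (T.cells.finite_toSet.image _))
    refine Submodule.finiteDimensional_of_le (S₂ := Submodule.span ℝ
      ((T.hatL2 '' T.nodes) ∪ (T.bubbleL2 '' T.cells))) ?_
    rintro _ ⟨u, rfl⟩
    change T.PBar u ∈ _
    rw [T.PBar_apply]
    refine Submodule.add_mem _ (Submodule.sum_mem _ fun z hz => ?_)
      (Submodule.sum_mem _ fun t ht => ?_)
    · exact Submodule.smul_mem _ _ (Submodule.subset_span (Or.inl ⟨z, hz, rfl⟩))
    · exact Submodule.smul_mem _ _ (Submodule.subset_span (Or.inr ⟨t, ht, rfl⟩))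
  choose L hL using hex
  let ℓ : T.PBar.range →ₗ[ℝ] H1 Ω :=
    { toFun := L
      map_add' := fun x y => H1.eq_of_fst_eq hΩ (by
        rw [hL]
        exact (congrArg₂ (· + ·) (hL x) (hL y)).symm)
      map_smul' := fun c x => H1.eq_of_fst_eq hΩ (by
        rw [hL]
        exact (congrArg (c • ·) (hL x)).symm) }
  let f : StrongDual ℝ (L2 Ω) := φ ∘L ℓ.toContinuousLinearMap ∘L
    T.PBar.codRestrict T.PBar.range fun u => ⟨u, rfl⟩
  refine ⟨(InnerProductSpace.toDual ℝ (L2 Ω)).symm f, fun u W hW => ?_⟩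
  rw [InnerProductSpace.toDual_symm_apply]
  refine congrArg φ (H1.eq_of_fst_eq hΩ ?_)
  rw [hW]
  exact hL _

/-- The identity that defines `P̄'φ` by testing with `H¹(Ω)` holds for all functions in `L²(Ω)`. -/
theorem IsPBarDual.inner_eq {T : Mesh Ω} (hΩ : IsOpen Ω) (hI : interior (closure Ω) = Ω)
    {φ : HTilde Ω} {g : L2 Ω} (h : T.IsPBarDual φ g) (u : L2 Ω) (W : H1 Ω)
    (hW : W.1.fst = T.PBar u) : ⟪g, u⟫_ℝ = φ W := by
  obtain ⟨g', hg'⟩ := T.exists_PBar_dual hΩ hI φ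
  have : g = g' := eq_of_inner_H1_eq hΩ fun v => by
    obtain ⟨w, hw, hgw⟩ := h v
    rw [hgw, hg' _ w hw]
  rw [this, hg' u W hW]

theorem existsUnique_isQTildeOf (hΩ : IsOpen Ω) (hI : interior (closure Ω) = Ω) (φ : HTilde Ω) :
    ∃! q : L2 Ω, T.IsQTildeOf φ q := by
  obtain ⟨g, hg⟩ := T.exists_PBar_dual hΩ hI φ
  refine ⟨T.Pi0 g, ⟨g, fun v => ?_, rfl⟩, ?_⟩
  · obtain ⟨W, hW, -⟩ := T.exists_H1_PBar hΩ hI v.1.fst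
    exact ⟨W, hW, hg _ W hW⟩
  · rintro _ ⟨g', hg', rfl⟩
    congr 1
    refine eq_of_inner_H1_eq hΩ fun v => ?_
    obtain ⟨w, hw, hgw⟩ := hg' v
    rw [hgw, hg _ w hw]

theorem isQTildeOf_toHTilde (hΩ : IsOpen Ω) (hI : interior (closure Ω) = Ω) (φ : L2 Ω) :
    T.IsQTildeOf (toHTilde φ) (T.QTilde φ) := by
  refine ⟨ContinuousLinearMap.adjoint T.PBar φ, fun v => ?_, rfl⟩
  obtain ⟨W, hW, -⟩ := T.exists_H1_PBar hΩ hI v.1.fst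
  exact ⟨W, hW, by rw [toHTilde_apply, hW, ContinuousLinearMap.adjoint_inner_left]⟩

theorem IsQTildeOf.mem {T : Mesh Ω} {φ : HTilde Ω} {q : L2 Ω} (h : T.IsQTildeOf φ q) :
    q ∈ T.P0 := by
  obtain ⟨g, -, rfl⟩ := h
  exact T.Pi0_mem g

/-! ### Global bounds -/

theorem diam_elem_le (hΩ : IsBoundedLipschitz Ω) {t : Finset (Euc d)} (ht : t ∈ T.cells) :
    Metric.diam (elem t) ≤ Metric.diam Ω :=
  Metric.diam_mono (T.elem_subset_domain hΩ.interior_closure ht) hΩ.2.1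

theorem abs_inner_le_of_local (hI : interior (closure Ω) = Ω) (φ u : L2 Ω)
    {a E : Finset (Euc d) → ℝ} (hE : ∀ t, 0 ≤ E t)
    (hu : ∀ t ∈ T.cells, ∫ x in elem t, u x ^ 2 ≤ a t ^ 2 * E t) :
    |⟪φ, u⟫_ℝ| ≤ √(∑ t ∈ T.cells, a t ^ 2 * ∫ x in elem t, φ x ^ 2) * √(∑ t ∈ T.cells, E t) := by
  rw [T.inner_eq_sum hI]
  have h0 : ∀ t, 0 ≤ a t ^ 2 * ∫ x in elem t, φ x ^ 2 := fun t =>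
    mul_nonneg (sq_nonneg _) (integral_nonneg fun x => sq_nonneg _)
  refine (Finset.abs_sum_le_sum_abs _ _).trans (le_trans (Finset.sum_le_sum fun t ht => ?_)
    (Real.sum_sqrt_mul_sqrt_le T.cells h0 hE))
  refine (abs_integral_mul_le (T.memLp_elem hI ht φ) (T.memLp_elem hI ht u)).trans ?_
  rw [← Real.sqrt_mul (integral_nonneg fun x => sq_nonneg _), ← Real.sqrt_mul (h0 t)]
  refine Real.sqrt_le_sqrt ?_
  calc _ ≤ (∫ x in elem t, φ x ^ 2) * (a t ^ 2 * E t) :=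
        mul_le_mul_of_nonneg_left (hu t ht) (integral_nonneg fun x => sq_nonneg _)
    _ = _ := by ring

/-- `P̄ Π⁰` is bounded on `H¹(Ω)`, and approximates the identity to first order. -/
theorem exists_const_smoothing_global (hd : 2 ≤ d) {κ : ℝ} (hκ : 0 ≤ κ)
    (hΩ : IsBoundedLipschitz Ω) :
    ∃ C : ℝ, 1 ≤ C ∧ ∀ T : Mesh Ω, T.ShapeRegular κ → ∀ v : H1 Ω, ∃ W : H1 Ω,
      W.1.fst = T.PBar (T.Pi0 v.1.fst) ∧ ‖W‖ ≤ C * ‖v‖ ∧ ∀ φ : L2 Ω,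
        |⟪φ, v.1.fst - W.1.fst⟫_ℝ|
          ≤ C * √(∑ t ∈ T.cells, Metric.diam (elem t) ^ 2 * ∫ x in elem t, φ x ^ 2) * ‖v‖ := by
  obtain ⟨C, hC1, hC⟩ := exists_const_smoothing hd hκ
  have hC0 : 0 ≤ C := by linarith
  have hI := hΩ.interior_closure
  set D := Metric.diam Ω with hD
  have hD0 : 0 ≤ D := Metric.diam_nonneg
  refine ⟨1 + C * D + C, by nlinarith [mul_nonneg hC0 hD0], ?_⟩
  intro T h v
  obtain ⟨W, hW, hsum, hloc⟩ := hC hΩ T h v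
  have hE0 := T.starEnergy_nonneg v.1.snd
  have hdiff : ‖v.1.fst - W.1.fst‖ ≤ C * D * ‖v.1.snd‖ := by
    rw [← pow_le_pow_iff_left₀ (norm_nonneg _) (by positivity) two_ne_zero,
      ← T.sum_integral_sq hI]
    calc _ ≤ ∑ t ∈ T.cells, C * (D ^ 2 * T.starEnergy v.1.snd t) := by
          refine Finset.sum_le_sum fun t ht => (hloc t ht).1.trans ?_
          have h1 := hE0 t
          have h2 := T.diam_elem_le hΩ ht
          have h3 : 0 ≤ Metric.diam (elem t) := Metric.diam_nonneg
          gcongr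
      _ = C * D ^ 2 * ∑ t ∈ T.cells, T.starEnergy v.1.snd t := by
          rw [Finset.mul_sum]
          exact Finset.sum_congr rfl fun t _ => by ring
      _ ≤ C * D ^ 2 * (C * ‖v.1.snd‖ ^ 2) := by gcongr
      _ = _ := by ring
  have hsnd : ‖W.1.snd‖ ≤ C * ‖v.1.snd‖ := by
    rw [← pow_le_pow_iff_left₀ (norm_nonneg _) (by positivity) two_ne_zero, ← T.sum_energy hI]
    calc _ ≤ ∑ t ∈ T.cells, C * T.starEnergy v.1.snd t :=
          Finset.sum_le_sum fun t ht => (hloc t ht).2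
      _ = C * ∑ t ∈ T.cells, T.starEnergy v.1.snd t := by rw [Finset.mul_sum]
      _ ≤ C * (C * ‖v.1.snd‖ ^ 2) := by gcongr
      _ = _ := by ring
  have hvf := H1.norm_fst_le v
  have hvs := H1.norm_snd_le v
  refine ⟨W, hW, ?_, fun φ => ?_⟩
  · have h1 : ‖W.1.fst‖ ≤ ‖v.1.fst‖ + ‖v.1.fst - W.1.fst‖ := by
      have := norm_sub_le v.1.fst (v.1.fst - W.1.fst)
      rwa [sub_sub_cancel] at this
    have h2 : C * D * ‖v.1.snd‖ ≤ C * D * ‖v‖ := by gcongr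
    have h3 : C * ‖v.1.snd‖ ≤ C * ‖v‖ := by gcongr
    linarith [H1.norm_le W]
  · refine (T.abs_inner_le_of_local hI φ _ (a := fun t => Metric.diam (elem t))
      (E := fun t => C * T.starEnergy v.1.snd t) (fun t => mul_nonneg hC0 (hE0 t))
      (fun t ht => (hloc t ht).1.trans (le_of_eq (by ring)))).trans ?_
    have h1 : √(∑ t ∈ T.cells, C * T.starEnergy v.1.snd t) ≤ (1 + C * D + C) * ‖v‖ := by
      refine Real.sqrt_le_iff.2 ⟨by positivity, ?_⟩
      rw [← Finset.mul_sum]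
      calc _ ≤ C * (C * ‖v.1.snd‖ ^ 2) := by gcongr
        _ = (C * ‖v.1.snd‖) ^ 2 := by ring
        _ ≤ ((1 + C * D + C) * ‖v‖) ^ 2 := by
          have h4 : C ≤ 1 + C * D + C := by nlinarith [mul_nonneg hC0 hD0]
          gcongr
    calc _ ≤ √(∑ t ∈ T.cells, Metric.diam (elem t) ^ 2 * ∫ x in elem t, φ x ^ 2)
          * ((1 + C * D + C) * ‖v‖) := by gcongr
      _ = _ := by ring

theorem meshSize_eq {t : Finset (Euc d)} (ht : t ∈ T.cells) {x : Euc d} (hx : x ∈ elem t) :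
    T.meshSize x = Metric.diam (elem t) := by
  rw [meshSize, Finset.sum_eq_single_of_mem t ht fun s hs hst => indicator_of_notMem (fun hxs =>
    Set.disjoint_left.1 (T.pairwiseDisjoint_elem hs ht hst) hxs hx) _, indicator_of_mem hx]

theorem eLpNorm_meshSize_mul (hI : interior (closure Ω) = Ω) (φ : L2 Ω) :
    eLpNorm (fun x => T.meshSize x * φ x) 2 (volume.restrict Ω)
      = ENNReal.ofReal √(∑ t ∈ T.cells, Metric.diam (elem t) ^ 2 * ∫ x in elem t, φ x ^ 2) := by
  have hmeas : Measurable T.meshSize :=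
    Finset.measurable_sum _ fun t _ => measurable_const.indicator (measurableSet_elem t)
  have hm : MemLp (fun x => T.meshSize x * φ x) 2 (volume.restrict Ω) := by
    refine (Lp.memLp φ).of_le_mul (c := ∑ t ∈ T.cells, Metric.diam (elem t))
      (hmeas.aestronglyMeasurable.mul (Lp.aestronglyMeasurable φ))
      (Filter.Eventually.of_forall fun x => ?_)
    rw [norm_mul]
    refine mul_le_mul_of_nonneg_right ?_ (norm_nonneg _)
    refine (norm_sum_le _ _).trans (Finset.sum_le_sum fun t _ => ?_)
    refine (norm_indicator_le_norm_self _ _).trans (le_of_eq ?_)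
    rw [Real.norm_eq_abs, abs_of_nonneg Metric.diam_nonneg]
  rw [eLpNorm_two_eq hm, T.setIntegral_domain hI (hm.integrable_norm_pow two_ne_zero)]
  congr 2
  refine Finset.sum_congr rfl fun t ht => ?_
  rw [← integral_const_mul]
  refine setIntegral_congr_fun (measurableSet_elem t) fun x hx => ?_
  simp only [T.meshSize_eq ht hx, Real.norm_eq_abs, sq_abs, mul_pow]

/-- The approximation property and the boundedness of `Q̃` in the norm of the dual of `H¹(Ω)` follow
by duality from the first-order approximation and the `H¹`-boundedness of `P̄ Π⁰`. -/
theorem exists_const_global (hd : 2 ≤ d) {κ : ℝ} (hκ : 0 ≤ κ) (hΩ : IsBoundedLipschitz Ω) :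
    ∃ C : ℝ, ∀ T : Mesh Ω, T.ShapeRegular κ →
      (∀ φ : L2 Ω, ‖toHTilde (φ - T.QTilde φ)‖ₑ
        ≤ ENNReal.ofReal C * eLpNorm (fun x => T.meshSize x * φ x) 2 (volume.restrict Ω)) ∧
      ∀ (φ : HTilde Ω) (q : L2 Ω), T.IsQTildeOf φ q → ‖toHTilde q‖ₑ ≤ ENNReal.ofReal C * ‖φ‖ₑ := by
  obtain ⟨C, hC1, hC⟩ := exists_const_smoothing_global hd hκ hΩ
  have hC0 : 0 ≤ C := by linarith
  have hI := hΩ.interior_closure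
  refine ⟨C, fun T h => ⟨fun φ => ?_, fun φ q hq => ?_⟩⟩
  · rw [T.eLpNorm_meshSize_mul hI, ← ofReal_norm, ← ENNReal.ofReal_mul hC0]
    refine ENNReal.ofReal_le_ofReal (ContinuousLinearMap.opNorm_le_bound _ (by positivity)
      fun v => ?_)
    obtain ⟨W, hW, -, hWφ⟩ := hC T h v
    rw [toHTilde_apply, inner_sub_left, T.inner_QTilde, ← hW, ← inner_sub_right]
    exact hWφ φ
  · rw [← ofReal_norm, ← ofReal_norm, ← ENNReal.ofReal_mul hC0]
    refine ENNReal.ofReal_le_ofReal (ContinuousLinearMap.opNorm_le_bound _ (by positivity)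
      fun v => ?_)
    obtain ⟨W, hW, hWn, -⟩ := hC T h v
    obtain ⟨g, hg, rfl⟩ := hq
    rw [toHTilde_apply, T.inner_Pi0, hg.inner_eq hΩ.1 hI _ W hW]
    calc ‖φ W‖ ≤ ‖φ‖ * ‖W‖ := φ.le_opNorm W
      _ ≤ ‖φ‖ * (C * ‖v‖) := by gcongr
      _ = _ := by ring

/-! ### Local bounds -/

theorem ae_of_notMem_patchDomain (hI : interior (closure Ω) = Ω) (S : Set (Euc d))
    {p : Euc d → Prop}
    (h : ∀ s ∈ T.cells, s ∉ T.patch S → ∀ᵐ x ∂volume.restrict (elem s), p x) :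
    ∀ᵐ x ∂volume.restrict Ω, x ∉ T.patchDomain S → p x := by
  rw [T.restrict_domain hI, ae_restrict_biUnion_finset_iff]
  intro s hs
  by_cases hsS : s ∈ T.patch S
  · filter_upwards [ae_restrict_mem (measurableSet_elem s)] with x hx hx'
    exact absurd (T.elem_subset_patchDomain hsS hx) hx'
  · filter_upwards [h s hs hsS] with x hx _
    exact hx

theorem chi_mem {t : Finset (Euc d)} (ht : t ∈ T.cells) : T.chi t ∈ T.P0 :=
  Submodule.subset_span ⟨⟨t, ht⟩, rfl⟩

theorem inner_eq_setIntegral (hΩ : IsOpen Ω) {G : Set (Euc d)} (hG : G ⊆ Ω) (φ u : L2 Ω)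
    (h0 : ∀ᵐ x ∂volume.restrict Ω, x ∉ G → u x = 0) : ⟪φ, u⟫_ℝ = ∫ x in G, φ x * u x := by
  have h0' := (ae_restrict_iff' hΩ.measurableSet).1 h0
  rw [L2.inner_def, ← setIntegral_eq_of_subset_of_ae_sdiff_eq_zero
    hΩ.measurableSet.nullMeasurableSet hG (f := fun x => φ x * u x) (by
      filter_upwards [h0'] with x hx hx'
      rw [hx hx'.1 hx'.2, mul_zero])]
  refine integral_congr_ae (Filter.Eventually.of_forall fun x => ?_)
  simp [mul_comm]

/-- `Q̃ φ` is constant on `T`, and the constant is found by testing with `χ_T`: its image `P̄ χ_T`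
is supported in the patch and bounded in `L²`. -/
theorem exists_const_local_L2 (hd : 2 ≤ d) {κ : ℝ} (hκ : 0 ≤ κ) (hΩ : IsBoundedLipschitz Ω) :
    ∃ C : ℝ, ∀ T : Mesh Ω, T.ShapeRegular κ → ∀ t ∈ T.cells, ∀ φ : L2 Ω,
      eLpNorm (T.QTilde φ) 2 (volume.restrict (elem t))
        ≤ ENNReal.ofReal C * eLpNorm φ 2 (volume.restrict (T.patchDomain (elem t))) := by
  obtain ⟨C, hC1, hC⟩ := exists_const_smoothing_chi hd hκ
  have hC0 : 0 ≤ C := by linarith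
  have hI := hΩ.interior_closure
  refine ⟨C, fun T h t ht φ => ?_⟩
  obtain ⟨W, hW, hzero, hWn, -⟩ := hC hΩ T h t ht
  have hvt := (T.isSimplex t ht).volume_pos
  set G := T.patchDomain (elem t) with hG
  have hGΩ : G ⊆ Ω := T.patchDomain_subset hI _
  have hle : volume.restrict G ≤ volume.restrict Ω := Measure.restrict_mono hGΩ le_rfl
  set a := avg (elem t) (T.QTilde φ) with ha
  have hQ : T.QTilde φ = T.pw fun s => avg (elem s) (T.QTilde φ) := by
    rw [← T.Pi0_apply hI, T.Pi0_of_mem (T.QTilde_mem φ)]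
  have hsq : ∫ x in elem t, ‖T.QTilde φ x‖ ^ 2 = a ^ 2 * volume.real (elem t) := by
    have h1 : ∫ x in elem t, ‖T.QTilde φ x‖ ^ 2 = ∫ x in elem t, a ^ 2 := by
      refine integral_congr_ae ?_
      have h2 := T.pw_ae hI (fun s => avg (elem s) (T.QTilde φ)) ht
      rw [← hQ] at h2
      filter_upwards [h2] with x hx
      rw [hx, Real.norm_eq_abs, sq_abs]
    rw [h1, setIntegral_const, smul_eq_mul, mul_comm]
  have hint : a * volume.real (elem t) = ∫ x in G, φ x * W.1.fst x := by
    rw [ha, avg, div_mul_cancel₀ _ hvt.ne', ← T.inner_chi hI ht, real_inner_comm,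
      T.inner_QTilde, T.Pi0_of_mem (T.chi_mem ht), ← hW]
    refine inner_eq_setIntegral hΩ.1 hGΩ φ W.1.fst ?_
    exact T.ae_of_notMem_patchDomain hI _ fun s hs hst => (hzero s hs hst).mono fun x hx => hx.1
  have hWG : ∫ x in G, W.1.fst x ^ 2 ≤ C * volume.real (elem t) := by
    refine le_trans ?_ hWn
    rw [norm_sq_L2]
    simp only [Real.norm_eq_abs, sq_abs]
    exact setIntegral_mono_set (Lp.memLp W.1.fst).integrable_sq
      (Filter.Eventually.of_forall fun x => sq_nonneg _) hGΩ.eventuallyLE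
  have hP0 : 0 ≤ ∫ x in G, φ x ^ 2 := integral_nonneg fun x => sq_nonneg _
  have hmain : a ^ 2 * volume.real (elem t) ≤ C * ∫ x in G, φ x ^ 2 := by
    have h1 := abs_integral_mul_le ((Lp.memLp φ).mono_measure hle)
      ((Lp.memLp W.1.fst).mono_measure hle)
    rw [← hint] at h1
    have h2 : (a * volume.real (elem t)) ^ 2
        ≤ (∫ x in G, φ x ^ 2) * (C * volume.real (elem t)) := by
      rw [← sq_abs]
      refine (pow_le_pow_left₀ (abs_nonneg _) h1 2).trans ?_
      rw [mul_pow, Real.sq_sqrt hP0, Real.sq_sqrt (integral_nonneg fun x => sq_nonneg _)]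
      exact mul_le_mul_of_nonneg_left hWG hP0
    refine le_of_mul_le_mul_right ?_ hvt
    calc _ = (a * volume.real (elem t)) ^ 2 := by ring
      _ ≤ _ := h2
      _ = _ := by ring
  rw [eLpNorm_two_eq (T.memLp_elem hI ht _), eLpNorm_two_eq ((Lp.memLp φ).mono_measure hle), hsq,
    ← ENNReal.ofReal_mul hC0]
  refine ENNReal.ofReal_le_ofReal (Real.sqrt_le_iff.2 ⟨by positivity, ?_⟩)
  simp only [Real.norm_eq_abs, sq_abs]
  rw [mul_pow, Real.sq_sqrt hP0]
  refine hmain.trans (mul_le_mul_of_nonneg_right ?_ hP0)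
  nlinarith

/-- Pairing `Q̃ φ` with a function on the element `t` amounts to pairing `φ` with the image of its
extension by zero under `P̄ Π⁰`. -/
theorem setIntegral_QTilde_mul (hI : interior (closure Ω) = Ω) {t : Finset (Euc d)}
    (ht : t ∈ T.cells) (φ u : L2 Ω) {v : Euc d → ℝ}
    (hu : u =ᵐ[volume.restrict Ω] (elem t).indicator v) :
    ∫ x in elem t, T.QTilde φ x * v x = ⟪φ, T.PBar (T.Pi0 u)⟫_ℝ := by
  rw [← T.inner_QTilde, ← inter_eq_right.2 (T.elem_subset_domain hI ht),
    ← setIntegral_indicator (measurableSet_elem t), L2.inner_def]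
  refine integral_congr_ae ?_
  filter_upwards [hu] with x hx
  rw [hx]
  by_cases hxt : x ∈ elem t
  · rw [indicator_of_mem hxt, indicator_of_mem hxt]
    exact mul_comm _ _
  · rw [indicator_of_notMem hxt, indicator_of_notMem hxt, inner_zero_right]

/-- For an element `T` that does not fill the domain and `v ∈ H¹_{Γ,c}(T)`, the extension of `v` by
zero has vanishing mean value on a neighbouring element. This yields a Friedrichs inequality for
the mean value of `v`, and the `H¹`-bound of `P̄ Π⁰ v` by the gradient alone. -/
theorem exists_const_smoothing_local (hd : 2 ≤ d) {κ : ℝ} (hκ : 0 ≤ κ)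
    (hΩ : IsBoundedLipschitz Ω) (hc : IsPreconnected Ω) :
    ∃ C : ℝ, 1 ≤ C ∧ ∀ T : Mesh Ω, T.ShapeRegular κ → ∀ t ∈ T.cells,
      volume (elem t) ≠ volume Ω → ∀ v : H1c Ω (elem t), ∃ W : H1 Ω,
        (∀ φ : L2 Ω, ∫ x in elem t, T.QTilde φ x * v.1.fst x = ⟪φ, W.1.fst⟫_ℝ) ∧
        (∀ s ∈ T.cells, s ∉ T.patch (elem t) →
          ∀ᵐ x ∂volume.restrict (elem s), W.1.fst x = 0 ∧ W.1.snd x = 0) ∧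
        ‖W.1.fst‖ ≤ C * ‖v.1.snd‖ ∧ ‖W.1.snd‖ ≤ C * ‖v.1.snd‖ := by
  obtain ⟨C₁, hC₁, hshare⟩ := exists_const_shareFace hd hκ
  obtain ⟨C₂, hC₂, hchi⟩ := exists_const_smoothing_chi hd hκ
  have hI := hΩ.interior_closure
  set D := Metric.diam Ω with hD
  have hD0 : 0 ≤ D := Metric.diam_nonneg
  set C := C₁ * C₂ with hCdef
  have hC1 : 1 ≤ C := one_le_mul_of_one_le_of_one_le hC₁ hC₂
  have hC0 : 0 ≤ C := by linarith
  refine ⟨C * (1 + D), by nlinarith [mul_nonneg hC0 hD0], ?_⟩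
  intro T h t ht hne v
  have hvt := (T.isSimplex t ht).volume_pos
  have htΩ := T.elem_subset_domain hI ht
  obtain ⟨u, hu1, hu2⟩ := H1c.exists_extend (measurableSet_elem t) htΩ v
  obtain ⟨W₀, hW₀, hzero, hn1, hn2⟩ := hchi hΩ T h t ht
  obtain ⟨s, hs, hst, hface⟩ := T.exists_neighbour hΩ hc ht hne
  set a := avg (elem t) u.1.fst with ha
  have havg : ∀ r ∈ T.cells, r ≠ t → avg (elem r) u.1.fst = 0 := fun r hr hrt => by
    have h1 : ∫ x in elem r, u.1.fst x = ∫ x in elem r, (0 : ℝ) := by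
      refine integral_congr_ae ?_
      filter_upwards [T.ae_elem hI hr hu1, ae_restrict_mem (measurableSet_elem r)] with x hx hxr
      rw [hx]
      exact indicator_of_notMem (fun hxt =>
        Set.disjoint_left.1 (T.pairwiseDisjoint_elem hr ht hrt) hxr hxt) _
    rw [avg, h1, integral_zero, zero_div]
  have hPi : T.Pi0 u.1.fst = a • T.chi t := by
    rw [T.Pi0_apply hI, pw, Finset.sum_eq_single_of_mem t ht fun r hr hrt => by
      rw [havg r hr hrt, zero_smul]]
  have het : energy u.1.snd t = ‖v.1.snd‖ ^ 2 := by
    rw [norm_sq_L2]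
    refine integral_congr_ae ?_
    filter_upwards [T.ae_elem hI ht hu2, ae_restrict_mem (measurableSet_elem t)] with x hx hxt
    rw [hx, indicator_of_mem hxt]
  have hes : energy u.1.snd s = 0 := by
    rw [energy, ← integral_zero (Euc d) ℝ (μ := volume.restrict (elem s))]
    refine integral_congr_ae ?_
    filter_upwards [T.ae_elem hI hs hu2, ae_restrict_mem (measurableSet_elem s)] with x hx hxs
    rw [hx, indicator_of_notMem (fun hxt =>
      Set.disjoint_left.1 (T.pairwiseDisjoint_elem hs ht hst) hxs hxt)]
    simp
  have hfried : a ^ 2 ≤ C₁ * scale t * ‖v.1.snd‖ ^ 2 := by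
    have h1 := (hshare hΩ T h t ht s hs hface).2.2 (HasWeakGrad.of_H1 u)
    rwa [havg s hs hst, het, hes, sub_zero, add_zero] at h1
  have hsc := scale_nonneg t
  have hC₁0 : 0 ≤ C₁ := by linarith
  have hC₂0 : 0 ≤ C₂ := by linarith
  have hCC : C ≤ C ^ 2 := by nlinarith
  refine ⟨a • W₀, fun φ => ?_, fun r hr hrt => ?_, ?_, ?_⟩
  · have h1 : (a • W₀ : H1 Ω).1.fst = T.PBar (T.Pi0 u.1.fst) := by
      rw [hPi, map_smul, ← hW₀]
      rfl
    rw [h1]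
    exact T.setIntegral_QTilde_mul hI ht φ u.1.fst hu1
  · have h1 := T.ae_elem hI hr (Lp.coeFn_smul a W₀.1.fst)
    have h2 := T.ae_elem hI hr (Lp.coeFn_smul a W₀.1.snd)
    filter_upwards [h1, h2, hzero r hr hrt] with x h1 h2 h3
    refine ⟨h1.trans ?_, h2.trans ?_⟩
    · rw [Pi.smul_apply, h3.1, smul_zero]
    · rw [Pi.smul_apply, h3.2, smul_zero]
  · have h1 : ‖(a • W₀ : H1 Ω).1.fst‖ = |a| * ‖W₀.1.fst‖ := norm_smul a W₀.1.fst
    have h2 : scale t * volume.real (elem t) = Metric.diam (elem t) ^ 2 := by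
      rw [scale, div_mul_cancel₀ _ hvt.ne']
    have h3 : Metric.diam (elem t) ≤ D := T.diam_elem_le hΩ ht
    have h4 : 0 ≤ Metric.diam (elem t) := Metric.diam_nonneg
    rw [h1, ← pow_le_pow_iff_left₀ (by positivity) (by positivity) two_ne_zero, mul_pow, sq_abs]
    calc _ ≤ C₁ * scale t * ‖v.1.snd‖ ^ 2 * (C₂ * volume.real (elem t)) := by gcongr
      _ = C * ‖v.1.snd‖ ^ 2 * (scale t * volume.real (elem t)) := by rw [hCdef]; ring
      _ = C * ‖v.1.snd‖ ^ 2 * Metric.diam (elem t) ^ 2 := by rw [h2]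
      _ ≤ C ^ 2 * ‖v.1.snd‖ ^ 2 * (1 + D) ^ 2 := by
          gcongr
          linarith
      _ = _ := by ring
  · have h1 : ‖(a • W₀ : H1 Ω).1.snd‖ = |a| * ‖W₀.1.snd‖ := norm_smul a W₀.1.snd
    rw [h1, ← pow_le_pow_iff_left₀ (by positivity) (by positivity) two_ne_zero, mul_pow, sq_abs]
    calc _ ≤ C₁ * scale t * ‖v.1.snd‖ ^ 2 * ‖W₀.1.snd‖ ^ 2 := by gcongr
      _ = C₁ * ‖v.1.snd‖ ^ 2 * (scale t * ‖W₀.1.snd‖ ^ 2) := by ring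
      _ ≤ C₁ * ‖v.1.snd‖ ^ 2 * C₂ := by gcongr
      _ = C * ‖v.1.snd‖ ^ 2 * 1 ^ 2 := by rw [hCdef]; ring
      _ ≤ C ^ 2 * ‖v.1.snd‖ ^ 2 * (1 + D) ^ 2 := by
          gcongr
          linarith
      _ = _ := by ring

/-- The pairing of `φ` with a function that vanishes outside the patch is bounded by the auxiliary
norm on the patch. -/
theorem ofReal_inner_le_auxNorm (hΩ : IsOpen Ω) {G : Set (Euc d)} (hGΩ : G ⊆ Ω)
    (φ : L2 Ω) (W : H1 Ω)
    (h0 : ∀ᵐ x ∂volume.restrict Ω, x ∉ G → W.1.fst x = 0 ∧ W.1.snd x = 0) {M : ℝ}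
    (hM : 0 < M) (h1 : ‖W.1.fst‖ ≤ M) (h2 : ‖W.1.snd‖ ≤ M) :
    ENNReal.ofReal ⟪φ, W.1.fst⟫_ℝ ≤ auxNorm G φ * ENNReal.ofReal (2 * M) := by
  rw [auxNorm]
  split_ifs with hvol
  · rw [← ofReal_norm, ← ENNReal.ofReal_mul (norm_nonneg _)]
    refine ENNReal.ofReal_le_ofReal ?_
    rw [← toHTilde_apply]
    refine (le_abs_self _).trans (((toHTilde φ).le_opNorm W).trans ?_)
    refine mul_le_mul_of_nonneg_left ?_ (toHTilde φ).opNorm_nonneg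
    linarith [H1.norm_le W]
  · obtain ⟨p, hp1, hp2⟩ := H1.exists_restrict hΩ hGΩ W h0
    have hnum : ⟪φ, W.1.fst⟫_ℝ = ∫ x in G, φ x * p.1.fst x := by
      rw [inner_eq_setIntegral hΩ hGΩ φ W.1.fst (h0.mono fun x hx hxG => (hx hxG).1)]
      refine integral_congr_ae ?_
      filter_upwards [hp1] with x hx
      rw [hx]
    have hden : ‖p.1.snd‖ ≤ M := by
      refine le_trans ?_ h2
      rw [← pow_le_pow_iff_left₀ (norm_nonneg _) (norm_nonneg _) two_ne_zero, norm_sq_L2,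
        norm_sq_L2]
      refine (le_of_eq (integral_congr_ae ?_)).trans (setIntegral_mono_set
        ((Lp.memLp W.1.snd).integrable_norm_pow two_ne_zero)
        (Filter.Eventually.of_forall fun x => sq_nonneg _) hGΩ.eventuallyLE)
      filter_upwards [hp2] with x hx
      rw [hx]
    set S := ⨆ (v : H1c Ω G) (_ : v ≠ 0),
      ENNReal.ofReal (∫ x in G, φ x * v.1.fst x) / ‖v.1.snd‖ₑ with hS
    -- the supremum may be infinite, but then the bound is trivial because `M > 0`
    by_cases hStop : S = ∞
    · rw [hStop, ENNReal.top_mul (by simpa using hM)]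
      exact le_top
    -- the supremum is over nonzero functions only; for `p = 0` the pairing vanishes
    by_cases hp : p = 0
    · have : ∫ x in G, φ x * p.1.fst x = 0 := by
        rw [← integral_zero (Euc d) ℝ (μ := volume.restrict G)]
        refine integral_congr_ae ?_
        have h3 : p.1.fst = 0 := by rw [hp]; rfl
        filter_upwards [Lp.coeFn_zero ℝ 2 (volume.restrict G)] with x hx
        rw [h3, hx, Pi.zero_apply, mul_zero]
      rw [hnum, this, ENNReal.ofReal_zero]
      exact zero_le
    · have h3 : ENNReal.ofReal (∫ x in G, φ x * p.1.fst x) / ‖p.1.snd‖ₑ ≤ S :=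
        le_iSup₂_of_le p hp le_rfl
      rw [ENNReal.div_le_iff_le_mul (Or.inr hStop) (Or.inl enorm_ne_top)] at h3
      rw [hnum]
      refine h3.trans (mul_le_mul_right ?_ S)
      rw [← ofReal_norm]
      exact ENNReal.ofReal_le_ofReal (by linarith)

/-- Local boundedness in the auxiliary norm. If `T` fills the domain, both auxiliary norms are the
norm of the dual of `H¹(Ω)`, and the global bound applies. -/
theorem exists_const_local_auxNorm (hd : 2 ≤ d) {κ : ℝ} (hκ : 0 ≤ κ)
    (hΩ : IsBoundedLipschitz Ω) (hc : IsPreconnected Ω) :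
    ∃ C : ℝ, ∀ T : Mesh Ω, T.ShapeRegular κ → ∀ t ∈ T.cells, ∀ φ : L2 Ω,
      auxNorm (elem t) (T.QTilde φ)
        ≤ ENNReal.ofReal C * auxNorm (T.patchDomain (elem t)) φ := by
  obtain ⟨C₁, hC₁⟩ := exists_const_global hd hκ hΩ
  obtain ⟨C₂, hC₂, hloc⟩ := exists_const_smoothing_local hd hκ hΩ hc
  have hI := hΩ.interior_closure
  refine ⟨max C₁ (2 * C₂), fun T h t ht φ => ?_⟩
  have hGΩ := T.patchDomain_subset hI (elem t)
  by_cases hvol : volume (elem t) = volume Ω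
  · have htp : t ∈ T.patch (elem t) := by
      obtain ⟨z, hz⟩ : t.Nonempty := by
        rw [← Finset.card_pos, (T.isSimplex t ht).1]
        omega
      exact (T.mem_patch_elem ht).2 ⟨ht, z, hz, hz⟩
    have hvol' : volume (T.patchDomain (elem t)) = volume Ω :=
      le_antisymm (measure_mono hGΩ)
        (hvol ▸ measure_mono (T.elem_subset_patchDomain htp))
    rw [auxNorm, if_pos hvol, auxNorm, if_pos hvol']
    refine ((hC₁ T h).2 _ _ (T.isQTildeOf_toHTilde hΩ.1 hI φ)).trans ?_
    gcongr
    exact le_max_left _ _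
  · rw [auxNorm, if_neg hvol]
    refine iSup₂_le fun v _ => ENNReal.div_le_of_le_mul ?_
    obtain ⟨W, hW, hzero, h1, h2⟩ := hloc T h t ht hvol v
    rw [hW φ]
    -- if `∇v = 0` then `W = 0` by the Friedrichs inequality, and the numerator vanishes
    rcases (norm_nonneg v.1.snd).eq_or_lt with hv | hv
    · rw [← hv, mul_zero] at h1
      rw [norm_le_zero_iff.1 h1, inner_zero_right, ENNReal.ofReal_zero]
      exact zero_le
    · refine (ofReal_inner_le_auxNorm hΩ.1 hGΩ φ W
        (T.ae_of_notMem_patchDomain hI _ hzero) (M := C₂ * ‖v.1.snd‖) (by positivity)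
        h1 h2).trans ?_
      rw [← mul_assoc, ENNReal.ofReal_mul (by positivity), ofReal_norm, ← mul_assoc,
        mul_comm (auxNorm _ _)]
      gcongr
      exact le_max_right _ _

end Mesh

end NegSob

end

theorem mainTheorem8 (d : ℕ) (hd : 2 ≤ d) (Ω : Set (NegSob.Euc d))
    (hΩ : NegSob.IsBoundedLipschitz Ω) (hsc : SimplyConnectedSpace Ω) (κ : ℝ) :
    ∃ C : ℝ≥0, ∀ T : NegSob.Mesh Ω, T.ShapeRegular κ →
      -- projection onto the piecewise constants
      (T.QTilde ∘L T.QTilde = T.QTilde ∧ T.QTilde.range = T.P0) ∧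
      -- approximation
      (∀ φ : NegSob.L2 Ω, ‖NegSob.toHTilde (φ - T.QTilde φ)‖ₑ
        ≤ C * eLpNorm (fun x => T.meshSize x * φ x) 2 (volume.restrict Ω)) ∧
      -- local boundedness in the norm of L² and in the auxiliary norms
      (∀ t ∈ T.cells, ∀ φ : NegSob.L2 Ω,
        eLpNorm (T.QTilde φ) 2 (volume.restrict (NegSob.elem t))
            ≤ C * eLpNorm φ 2 (volume.restrict (T.patchDomain (NegSob.elem t))) ∧
        NegSob.auxNorm (NegSob.elem t) (T.QTilde φ)
            ≤ C * NegSob.auxNorm (T.patchDomain (NegSob.elem t)) φ) ∧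
      -- the operator is well defined on the dual of H¹(Ω), where it extends the one on L²(Ω),
      -- and it is a projection onto the piecewise constants there, too
      (∀ φ : NegSob.HTilde Ω, ∃! q : NegSob.L2 Ω, T.IsQTildeOf φ q) ∧
      (∀ φ : NegSob.L2 Ω, T.IsQTildeOf (NegSob.toHTilde φ) (T.QTilde φ)) ∧
      (∀ (φ : NegSob.HTilde Ω) (q : NegSob.L2 Ω), T.IsQTildeOf φ q →
        q ∈ T.P0 ∧ T.IsQTildeOf (NegSob.toHTilde q) q) ∧
      -- global boundedness
      (∀ (φ : NegSob.HTilde Ω) (q : NegSob.L2 Ω), T.IsQTildeOf φ q →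
        ‖NegSob.toHTilde q‖ₑ ≤ C * ‖φ‖ₑ) := by
  have hI := hΩ.interior_closure
  have hc : IsPreconnected Ω := isPreconnected_iff_preconnectedSpace.2 inferInstance
  -- the constants are built for a nonnegative shape parameter
  have hκ : (0 : ℝ) ≤ max κ 1 := le_max_of_le_right zero_le_one
  obtain ⟨C₁, h₁⟩ := NegSob.Mesh.exists_const_global hd hκ hΩ
  obtain ⟨C₂, h₂⟩ := NegSob.Mesh.exists_const_local_L2 hd hκ hΩ
  obtain ⟨C₃, h₃⟩ := NegSob.Mesh.exists_const_local_auxNorm hd hκ hΩ hc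
  have e₁ : ENNReal.ofReal C₁ ≤ (max C₁ (max C₂ C₃)).toNNReal :=
    ENNReal.ofReal_le_ofReal (le_max_left _ _)
  have e₂ : ENNReal.ofReal C₂ ≤ (max C₁ (max C₂ C₃)).toNNReal :=
    ENNReal.ofReal_le_ofReal ((le_max_left _ _).trans (le_max_right _ _))
  have e₃ : ENNReal.ofReal C₃ ≤ (max C₁ (max C₂ C₃)).toNNReal :=
    ENNReal.ofReal_le_ofReal ((le_max_right _ _).trans (le_max_right _ _))
  refine ⟨(max C₁ (max C₂ C₃)).toNNReal, fun T hT => ?_⟩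
  have h := hT.mono (le_max_left κ 1)
  refine ⟨⟨T.QTilde_comp_self hI, T.range_QTilde hI⟩, fun φ => ?_, fun t ht φ => ⟨?_, ?_⟩,
    T.existsUnique_isQTildeOf hΩ.1 hI, T.isQTildeOf_toHTilde hΩ.1 hI, fun φ q hq => ⟨hq.mem, ?_⟩,
    fun φ q hq => ?_⟩
  · exact ((h₁ T h).1 φ).trans (mul_le_mul_left e₁ _)
  · exact (h₂ T h t ht φ).trans (mul_le_mul_left e₂ _)
  · exact (h₃ T h t ht φ).trans (mul_le_mul_left e₃ _)
  · have h' := T.isQTildeOf_toHTilde hΩ.1 hI q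
    rwa [T.QTilde_of_mem hI hq.mem] at h'
  · exact ((h₁ T h).2 φ q hq).trans (mul_le_mul_left e₁ _)
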